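/- Let $(M,g)$ be a simple surface: a (nonempty) compact Riemannian surface with smooth, strictly convex boundary such that, for every $\mathrm x\in M$, the exponential map $\exp_{\mathrm x}$ is a diffeomorphism from its maximal domain in $T_{\mathrm x}M$ onto $M$. Such a surface is diffeomorphic to a closed disc, so $M$ is regarded as a compact domain with smooth boundary in $\mathbb R^2$, carrying an arbitrary Riemannian metric $g$ that is smooth up to the boundary. Let $SM$ be the unit circle bundle with coordinates $(\mathrm x,\theta)$, where $\theta$ is the angle of a unit tangent vector with $\partial_x$; let $X$ be the generator of the geodesic flow $\varphi_t$, let $V=\partial_\theta$ and $X_\perp=[X,V]$, and let $\kappa$ be the Gaussian curvature. Let $d\Sigma^3=dM\,d\theta$ and, for $k\in\mathbb Z$, let $H_k\subset L^2(SM,\mathbb C)=L^2(SM,d\Sigma^3)$ be the eigenspace of $-iV$ for the eigenvalue $k$, that is, the space of all elements of the form $\tilde f(\mathrm x)e^{ik\theta}$. For a function $u$ on $SM$ write $$u_k(\mathrm x,\theta)=e^{ik\theta}\,\frac1{2\pi}\int_0^{2\pi}u(\mathrm x,s)e^{-iks}\,ds .$$ For $f$ on $SM$ let $u^f(\mathrm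 x,\theta)=\int_0^{\tau(\mathrm x,\theta)}f(\varphi_t(\mathrm x,\theta))\,dt$, with $\tau$ the exit time, be the solution of $Xu=-f$ that vanishes on the outgoing boundary of $SM$. For $f=\tilde f(\mathrm x)e^{ik\theta}$ with $\tilde f$ smooth, complex valued and compactly supported in the interior of $M$, the function $u^f$ is continuously differentiable over the interior of $M$; put $W_kf=(X_\perp u^f)_k$. Then there are constants $C_1,C_2>0$, depending only on $(M,g)$, such that for every integer $k$ the operator $W_k$ extends uniquely to a bounded operator $W_k:H_k\to H_k$, and $$\|W_k\|_{\mathcal L(H_k)}\le C_1\|\nabla\kappa\|_\infty+|k|\,C_2\,\|\kappa\|_\infty ,$$ where $\|\kappa\|_\infty=\sup_M|\kappa|$ and $\|\nabla\kappa\|_\infty=\sup_M|\nabla\kappa|_g$. -/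

import Mathlib

open MeasureTheory Set
open scoped ContDiff

noncomputable section

/-- The coordinate plane carrying a global chart of the surface. -/
abbrev Plane : Type := ℝ × ℝ

/-- Coordinates `(x, θ)` on the unit circle bundle. The angle is a real number; functions on the
unit circle bundle are `2π`-periodic in it. -/
abbrev CircleCoord : Type := Plane × ℝ

/-- `ρ` is a smooth defining function of the closed domain `M`: `M = {ρ ≤ 0}`, and `0` is a regular
value of `ρ`. -/
def IsDefiningFunction (M : Set Plane) (ρ : Plane → ℝ) : Prop :=
  ContDiff ℝ ∞ ρ ∧ M = {x | ρ x ≤ 0} ∧ ∀ x, ρ x = 0 → fderiv ℝ ρ x ≠ 0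

/-- A compact Riemannian surface `(M, g)` with smooth boundary, in a global chart: `M` is a nonempty
compact planar domain with smooth boundary, and `g = E dx² + 2 F dx dy + G dy²` is an arbitrary
metric that is smooth up to the boundary (equivalently, it is the restriction to `M` of a smooth
metric on the plane; nothing below depends on the choice of the extension). -/
structure RiemannianSurface where
  /-- the underlying set `M` -/
  M : Set Plane
  isCompact : IsCompact M
  nonempty : M.Nonempty
  smooth_boundary : ∃ ρ, IsDefiningFunction M ρ
  /-- `E = g(∂_x, ∂_x)` -/
  E : Plane → ℝ
  /-- `F = g(∂_x, ∂_y)` -/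
  F : Plane → ℝ
  /-- `G = g(∂_y, ∂_y)` -/
  G : Plane → ℝ
  smooth_E : ContDiff ℝ ∞ E
  smooth_F : ContDiff ℝ ∞ F
  smooth_G : ContDiff ℝ ∞ G
  E_pos : ∀ x, 0 < E x
  det_pos : ∀ x, 0 < E x * G x - F x ^ 2

namespace RiemannianSurface

variable (S : RiemannianSurface)

/-! ### The metric, the frame, the curvature -/

/-- The metric `g_x(v, w)`. -/
def metric (x : Plane) (v w : Plane) : ℝ :=
  S.E x * (v.1 * w.1) + S.F x * (v.1 * w.2 + v.2 * w.1) + S.G x * (v.2 * w.2)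

/-- The Riemannian area density `√(E G - F²)`. -/
def areaDensity (x : Plane) : ℝ := √(S.E x * S.G x - S.F x ^ 2)

/-- The unit vector field in the direction of `∂_x`. -/
def e₁ (x : Plane) : Plane := (1 / √(S.E x), 0)

/-- The `g`-rotation of `e₁` by `+π/2`; `(e₁, e₂)` is an oriented orthonormal frame. In isothermal
coordinates `g = e^{2λ}(dx² + dy²)` one has `e₁ = e^{-λ} ∂_x` and `e₂ = e^{-λ} ∂_y`. -/
def e₂ (x : Plane) : Plane :=
  (- S.F x / (√(S.E x) * S.areaDensity x), S.E x / (√(S.E x) * S.areaDensity x))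

/-- The coefficient `c₁` in `[e₁, e₂] = c₁ e₁ + c₂ e₂`. -/
def c₁ (x : Plane) : ℝ := S.metric x (VectorField.lieBracket ℝ S.e₁ S.e₂ x) (S.e₁ x)

/-- The coefficient `c₂` in `[e₁, e₂] = c₁ e₁ + c₂ e₂`. -/
def c₂ (x : Plane) : ℝ := S.metric x (VectorField.lieBracket ℝ S.e₁ S.e₂ x) (S.e₂ x)

/-- The Gaussian curvature, `κ = e₁(c₂) - e₂(c₁) - c₁² - c₂²`. This is Cartan's structure equation
`dω = -κ e¹ ∧ e²` for the Levi-Civita connection form `ω`, `∇e₁ = ω ⊗ e₂`; vanishing torsion means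
`ω(e₁) = -c₁` and `ω(e₂) = -c₂`. In isothermal coordinates it reads `κ = - e^{-2λ} Δλ`. -/
def curvature (x : Plane) : ℝ :=
  fderiv ℝ S.c₂ x (S.e₁ x) - fderiv ℝ S.c₁ x (S.e₂ x) - S.c₁ x ^ 2 - S.c₂ x ^ 2

/-- The Riemannian length `|∇κ|_g` of the gradient of the curvature. -/
def gradCurvature (x : Plane) : ℝ :=
  √(fderiv ℝ S.curvature x (S.e₁ x) ^ 2 + fderiv ℝ S.curvature x (S.e₂ x) ^ 2)

/-- `‖κ‖_∞ = sup_M |κ|`. -/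
def curvatureSup : ℝ := ⨆ x : S.M, |S.curvature x|

/-- `‖∇κ‖_∞ = sup_M |∇κ|_g`. -/
def gradCurvatureSup : ℝ := ⨆ x : S.M, S.gradCurvature x

/-! ### The unit circle bundle

The unit tangent vector with coordinates `(x, θ)` is `cos θ e₁(x) + sin θ e₂(x)`, so that `θ` is its
angle with `∂_x`. -/

/-- The generator `X` of the geodesic flow: the base point moves along the unit vector and
`θ' = -ω(γ') = c₁ cos θ + c₂ sin θ`. In isothermal coordinates,
`X = e^{-λ}(cos θ ∂_x + sin θ ∂_y + (-sin θ ∂_xλ + cos θ ∂_yλ) ∂_θ)`. -/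
def X (p : CircleCoord) : CircleCoord :=
  (Real.cos p.2 • S.e₁ p.1 + Real.sin p.2 • S.e₂ p.1,
    S.c₁ p.1 * Real.cos p.2 + S.c₂ p.1 * Real.sin p.2)

/-- The vertical vector field `V = ∂_θ`. -/
def V (_p : CircleCoord) : CircleCoord := (0, 1)

/-- The transverse vector field `X_⊥ = [X, V]`. -/
def Xperp : CircleCoord → CircleCoord := VectorField.lieBracket ℝ S.X V

/-- The geodesic with initial conditions `p`, lifted to the unit circle bundle, exists within `M`
on the time interval `[0, t]`, and is there given by `c`. -/
def IsOrbit (p : CircleCoord) (t : ℝ) (c : ℝ → CircleCoord) : Prop :=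
  c 0 = p ∧ ∀ s ∈ Icc 0 t, (c s).1 ∈ S.M ∧ HasDerivWithinAt c (S.X (c s)) (Icc 0 t) s

open Classical in
/-- The geodesic flow `φ_t(p)`, for all `t ≥ 0` up to which the geodesic stays in `M`. -/
def flow (p : CircleCoord) (t : ℝ) : CircleCoord :=
  if h : ∃ c, S.IsOrbit p t c then h.choose t else p

/-- The exit time `τ(x, θ)`. -/
def exitTime (p : CircleCoord) : ℝ := sSup {t | 0 ≤ t ∧ ∃ c, S.IsOrbit p t c}

/-- The solution `u^f` of `X u = -f` in `SM`, `u = 0` on the outgoing boundary `∂₋SM`, that is,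
`u^f(p) = ∫_0^{τ(p)} f(φ_t(p)) dt`. -/
def transport (f : CircleCoord → ℂ) (p : CircleCoord) : ℂ :=
  ∫ t in (0 : ℝ)..S.exitTime p, f (S.flow p t)

/-- `X_⊥ u`. -/
def XperpDeriv (u : CircleCoord → ℂ) (p : CircleCoord) : ℂ := fderiv ℝ u p (S.Xperp p)

/-! ### Simple surfaces -/

/-- The maximal domain of the exponential map at `x`. A tangent vector at `x` is represented by the
complex number `w = t e^{iθ}`, which stands for `t (cos θ e₁(x) + sin θ e₂(x))`. -/
def expDomain (x : Plane) : Set ℂ := {w | ∃ c, S.IsOrbit (x, w.arg) ‖w‖ c}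

/-- The exponential map at `x`. -/
def expMap (x : Plane) (w : ℂ) : Plane := (S.flow (x, w.arg) ‖w‖).1

/-- The boundary is strictly convex: along a geodesic that is tangent to the boundary, the second
derivative `X(Xρ) = Hess ρ (γ', γ')` of a defining function at the point of tangency is positive
(this is, up to the positive factor `|∇ρ|`, the second fundamental form of the boundary). -/
def StrictlyConvexBoundary : Prop :=
  ∃ ρ, IsDefiningFunction S.M ρ ∧
    let Xρ : CircleCoord → ℝ := fun p => fderiv ℝ ρ p.1 (S.X p).1
    ∀ p : CircleCoord, ρ p.1 = 0 → Xρ p = 0 → 0 < fderiv ℝ Xρ p (S.X p)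

/-- `(M, g)` is simple: the boundary is strictly convex, and at every point of `M` the exponential
map is a diffeomorphism from its maximal domain onto `M`. -/
def IsSimple : Prop :=
  S.StrictlyConvexBoundary ∧
  ∀ x ∈ S.M, BijOn (S.expMap x) (S.expDomain x) S.M ∧
    ContDiffOn ℝ ∞ (S.expMap x) (S.expDomain x) ∧
    ∃ L : Plane → ℂ, ContDiffOn ℝ ∞ L S.M ∧ ∀ w ∈ S.expDomain x, L (S.expMap x w) = w

/-! ### The spaces `H_k` and the operators `W_k` -/

/-- The volume `dΣ³ = dM dθ` of the unit circle bundle, the angle running over a period. -/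
def volSM : Measure CircleCoord :=
  ((volume.restrict S.M).withDensity fun x => ENNReal.ofReal (S.areaDensity x)).prod
    (volume.restrict (Ioc 0 (2 * Real.pi)))

/-- The function `f̃(x) e^{ikθ}`. -/
def mode (k : ℤ) (f : Plane → ℂ) (p : CircleCoord) : ℂ :=
  f p.1 * Complex.exp (Complex.I * k * p.2)

/-- The `k`-th fibrewise Fourier component `u_k(x, θ) = e^{ikθ} (1/2π) ∫ u(x, s) e^{-iks} ds`. -/
def component (k : ℤ) (u : CircleCoord → ℂ) : CircleCoord → ℂ :=
  mode k fun x => (1 / (2 * Real.pi) : ℂ) *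
    ∫ s in (0 : ℝ)..(2 * Real.pi), u (x, s) * Complex.exp (-(Complex.I * k * s))

/-- The eigenspace `H_k ⊆ L²(SM)` of `-iV` for the eigenvalue `k`: the elements of `L²(SM)` of the
form `f̃(x) e^{ikθ}`. -/
def H (k : ℤ) : Submodule ℂ (Lp ℂ 2 S.volSM) where
  carrier := {u | ∃ f : Plane → ℂ, u =ᵐ[S.volSM] mode k f}
  zero_mem' := by
    refine ⟨0, (Lp.coeFn_zero ℂ 2 S.volSM).trans ?_⟩
    filter_upwards with p
    simp [mode]
  add_mem' := by
    rintro u v ⟨f, hf⟩ ⟨g, hg⟩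
    refine ⟨f + g, ?_⟩
    filter_upwards [Lp.coeFn_add u v, hf, hg] with p h1 h2 h3
    rw [h1, Pi.add_apply, h2, h3]
    simp [mode, add_mul]
  smul_mem' := by
    rintro a u ⟨f, hf⟩
    refine ⟨a • f, ?_⟩
    filter_upwards [Lp.coeFn_smul a u, hf] with p h1 h2
    rw [h1, Pi.smul_apply, h2]
    simp [mode, mul_assoc]

/-- `f̃ ∈ C_0^∞(M)`: smooth, complex valued, with compact support in the interior of `M`. -/
def IsTestFunction (f : Plane → ℂ) : Prop :=
  ContDiff ℝ ∞ f ∧ HasCompactSupport f ∧ tsupport f ⊆ interior S.M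

/-- The bounded operator `W` on `H_k` extends the operator `W_k f = (X_⊥ u^f)_k`, which is defined
on the functions `f = f̃(x) e^{ikθ}` with `f̃ ∈ C_0^∞(M)`; for these, `u^f` is continuously
differentiable over the interior of `M`, so that the formula has its classical meaning there. -/
def IsExtensionOfWk (k : ℤ) (W : S.H k →L[ℂ] S.H k) : Prop :=
  ∀ f : Plane → ℂ, S.IsTestFunction f →
    ContDiffOn ℝ 1 (S.transport (mode k f)) (interior S.M ×ˢ univ) ∧
    ∀ u : S.H k, (u : Lp ℂ 2 S.volSM) =ᵐ[S.volSM] mode k f →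
      (W u : Lp ℂ 2 S.volSM) =ᵐ[S.volSM]
        component k (S.XperpDeriv (S.transport (mode k f)))

end RiemannianSurface

end

/-! Write `a`, `b` for the solutions of the Jacobi equation `y'' + κ y = 0` along a geodesic with
`a(0) = 1`, `a'(0) = 0` and `b(0) = 0`, `b'(0) = 1`. The structure equations of the frame `(X, X_⊥,
V)` show that the differential of the flow at time `t` sends `X_⊥` to `a X_⊥ - a' V` and `V` to `b'
V - b X_⊥` (`jacobi_system`). For `f = f̃ e^{ikθ}` and `h = f ∘ φ_t`, eliminating `X_⊥ f` and using
`a b' - a' b = 1` together with `V f = ik f` gives `b X_⊥ h = -a V h + ik h` (`jacB_mul_perpPull`).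

Divide by `b`, multiply by `e^{-ikθ}` and integrate over the circle at a fixed time `t > 0`.
Integration by parts in `θ` removes the derivative from `h`, and what is left is the integral of
`e^{-ikθ} h` against `V(a/b) - ik (a - 1)/b` (`kernelFactor`, `integral_perpPull`). Hence `W_k` is
an integral over geodesics issued from `x` of values of `f`, with this weight.

The weight is bounded. From `a'' = -κ a` follows `|a - 1| ≤ C ‖κ‖ t²`. The angle derivatives of `a`
and `b` solve Jacobi equations with source `b (X_⊥ κ) a`, respectively `b (X_⊥ κ) b`, and zero
initial data, so variation of constants gives `|b V a - a V b| ≤ C ‖∇κ‖ t⁴` (`jacobi_estimates`).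
Simplicity excludes conjugate points, and compactness improves this to `|b| ≥ c t` (`jacB_ne_zero`,
`exists_le_abs_jacB`). So the weight is at most `C (‖∇κ‖ + |k| ‖κ‖)`, and also bounded near `t = 0`.
The `L²` estimate then needs only Cauchy-Schwarz, a uniform bound on the length of geodesics, and
the fact that the flow distorts volumes by a bounded factor. Density of the test functions gives the
extension and its uniqueness.

Two technical points remain. The geodesic flow on `M` is replaced by the smooth global flow `Φ` of a
cut-off field on the plane. Smoothness of the exit time is never needed: strict convexity keeps
geodesics in the interior until they exit, and `f` vanishes near the boundary, so the transported
function extended by zero after the exit time is smooth over the interior (`contDiffAt_pull`). -/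

noncomputable section
/-! ### Smooth global flows -/

section Flows

open Filter Topology Metric
open scoped NNReal

universe u

/-- `φ` is a global flow of the vector field `v`. -/
structure IsGlobalFlow {E : Type*} [NormedAddCommGroup E] [NormedSpace ℝ E]
    (v : E → E) (φ : ℝ → E → E) : Prop where
  zero : ∀ x, φ 0 x = x
  deriv : ∀ t x, HasDerivAt (fun s => φ s x) (v (φ t x)) t

/-- A two-sided version of Grönwall's inequality. -/
theorem norm_le_gronwallBound_abs {E : Type*} [NormedAddCommGroup E] [NormedSpace ℝ E]
    {f f' : ℝ → E} {K ε T : ℝ}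
    (hf : ∀ t, |t| ≤ T → HasDerivAt f (f' t) t) (hb : ∀ t, |t| ≤ T → ‖f' t‖ ≤ K * ‖f t‖ + ε)
    {t : ℝ} (ht : |t| ≤ T) : ‖f t‖ ≤ gronwallBound ‖f 0‖ K ε |t| := by
  rcases le_total 0 t with h0 | h0
  · rw [abs_of_nonneg h0] at ht ⊢
    have hab : ∀ s ∈ Icc 0 t, |s| ≤ T := fun s hs => by
      rw [abs_of_nonneg hs.1]; exact hs.2.trans ht
    have := norm_le_gronwallBound_of_norm_deriv_right_le (f := f) (f' := f') (δ := ‖f 0‖)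
      (K := K) (ε := ε) (a := 0) (b := t)
      (fun s hs => (hf s (hab s hs)).continuousAt.continuousWithinAt)
      (fun s hs => (hf s (hab s (Ico_subset_Icc_self hs))).hasDerivWithinAt) le_rfl
      (fun s hs => hb s (hab s (Ico_subset_Icc_self hs))) t ⟨h0, le_rfl⟩
    simpa using this
  · rw [abs_of_nonpos h0] at ht ⊢
    have hab : ∀ s ∈ Icc 0 (-t), |-s| ≤ T := fun s hs => by
      rw [abs_neg, abs_of_nonneg hs.1]; exact hs.2.trans ht
    have hd : ∀ s ∈ Icc 0 (-t), HasDerivAt (fun r => f (-r)) (-f' (-s)) s := fun s hs => by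
      simpa [Function.comp_def] using (hf (-s) (hab s hs)).scomp s (hasDerivAt_neg s)
    have := norm_le_gronwallBound_of_norm_deriv_right_le (f := fun r => f (-r))
      (f' := fun s => -f' (-s)) (δ := ‖f 0‖)
      (K := K) (ε := ε) (a := 0) (b := -t)
      (fun s hs => (hd s hs).continuousAt.continuousWithinAt)
      (fun s hs => (hd s (Ico_subset_Icc_self hs)).hasDerivWithinAt) (by simp)
      (fun s hs => by
        simpa using hb (-s) (hab s (Ico_subset_Icc_self hs))) (-t) ⟨by linarith, le_rfl⟩
    simpa using this

section

variable {E : Type*} [NormedAddCommGroup E] [NormedSpace ℝ E]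

/-- Bounded Lipschitz vector fields have global flows. -/
theorem exists_isGlobalFlow [CompleteSpace E] {v : E → E} {K L : ℝ≥0} (hK : LipschitzWith K v)
    (hL : ∀ x, ‖v x‖ ≤ L) : ∃ φ, IsGlobalFlow v φ := by
  have hex : ∀ (x : E) (n : ℕ), ∃ α : ℝ → E, α 0 = x ∧
      ∀ t ∈ Icc (-((n : ℝ) + 1)) (n + 1), HasDerivWithinAt α (v (α t))
        (Icc (-((n : ℝ) + 1)) (n + 1)) t := by
    intro x n
    have hn : (0 : ℝ) ≤ n := n.cast_nonneg
    have hp : IsPicardLindelof (fun _ : ℝ => v) (tmin := -((n : ℝ) + 1)) (tmax := n + 1)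
        -- With speed at most `L`, a solution cannot leave the ball of radius `L (n + 1)` within
        -- time `n + 1`.
        ⟨0, by constructor <;> linarith⟩ x (L * (n + 1)) 0 L K := by
      refine .of_time_independent (fun x _ => hL x) hK.lipschitzOnWith ?_
      simp
    exact hp.exists_eq_forall_mem_Icc_hasDerivWithinAt₀
  choose α h0 hα using hex
  have hderiv : ∀ x (n : ℕ) t, |t| < (n : ℝ) + 1 → HasDerivAt (α x n) (v (α x n t)) t := by
    intro x n t ht
    rw [abs_lt] at ht
    exact (hα x n t ⟨ht.1.le, ht.2.le⟩).hasDerivAt (Icc_mem_nhds ht.1 ht.2)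
  have hagree : ∀ x (m n : ℕ) t, m ≤ n → |t| < (m : ℝ) + 1 → α x m t = α x n t := by
    intro x m n t hmn ht
    have hmn' : (m : ℝ) ≤ n := by exact_mod_cast hmn
    have := norm_le_gronwallBound_abs (f := fun t => α x m t - α x n t)
      (f' := fun t => v (α x m t) - v (α x n t)) (K := K) (ε := 0) (T := |t|) (t := t)
      (fun s hs => (hderiv x m s (hs.trans_lt ht)).sub
        (hderiv x n s (hs.trans_lt (ht.trans_le (by linarith)))))
      (fun s hs => by simpa using hK.norm_sub_le _ _) le_rfl
    simpa [h0, gronwallBound_ε0_δ0, sub_eq_zero] using this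
  have hceil : ∀ t : ℝ, |t| < (⌈|t|⌉₊ : ℝ) + 1 := fun t =>
    (Nat.le_ceil _).trans_lt (by linarith)
  -- The local solutions are glued by letting the interval grow with `t`; near a given time all of
  -- them agree with one solution whose index is larger by one.
  refine ⟨fun t x => α x ⌈|t|⌉₊ t, fun x => by simp [h0], fun t x => ?_⟩
  have hev : (fun s => α x ⌈|s|⌉₊ s) =ᶠ[𝓝 t] α x (⌈|t|⌉₊ + 1) := by
    have : ∀ᶠ s in 𝓝 t, |s| < (⌈|t|⌉₊ : ℝ) + 1 := continuous_abs.continuousAt.eventually_lt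
      continuousAt_const (hceil t)
    filter_upwards [this] with s hs
    refine hagree x _ _ s (Nat.ceil_le.2 ?_) (hceil s)
    push_cast; exact hs.le
  have h1 := hderiv x (⌈|t|⌉₊ + 1) t (by push_cast; linarith [hceil t])
  rw [hagree x _ (⌈|t|⌉₊ + 1) t (Nat.le_succ _) (hceil t)]
  exact h1.congr_of_eventuallyEq hev

namespace IsGlobalFlow

variable {v : E → E} {φ : ℝ → E → E} {K : ℝ≥0}

theorem eq_of_hasDerivAt (hφ : IsGlobalFlow v φ) (hK : LipschitzWith K v) {γ : ℝ → E} {T : ℝ}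
    (hγ : ∀ t, |t| ≤ T → HasDerivAt γ (v (γ t)) t) {t : ℝ} (ht : |t| ≤ T) :
    γ t = φ t (γ 0) := by
  have := norm_le_gronwallBound_abs (f := fun t => γ t - φ t (γ 0))
    (f' := fun t => v (γ t) - v (φ t (γ 0))) (K := K) (ε := 0)
    (fun s hs => (hγ s hs).sub (hφ.deriv s _)) (fun s hs => by simpa using hK.norm_sub_le _ _) ht
  simpa [hφ.zero, gronwallBound_ε0_δ0, sub_eq_zero] using this

theorem eq_of_hasDerivWithinAt (hφ : IsGlobalFlow v φ) (hK : LipschitzWith K v) {γ : ℝ → E} {T : ℝ}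
    (hγ : ∀ t ∈ Icc 0 T, HasDerivWithinAt γ (v (γ t)) (Icc 0 T) t) {t : ℝ} (ht : t ∈ Icc 0 T) :
    γ t = φ t (γ 0) := by
  have := ODE_solution_unique (v := fun _ => v) (K := K) (f := γ) (g := fun t => φ t (γ 0))
    (a := 0) (b := T) (fun _ => hK) (fun s hs => (hγ s hs).continuousWithinAt)
    (fun s hs => (hγ s (Ico_subset_Icc_self hs)).mono_of_mem_nhdsWithin
      (mem_of_superset (Icc_mem_nhdsGE hs.2) (Icc_subset_Icc_left hs.1)))
    (fun s hs => (hφ.deriv s _).continuousAt.continuousWithinAt)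
    (fun s hs => (hφ.deriv s _).hasDerivWithinAt) (by simp [hφ.zero])
  exact this ht

theorem add (hφ : IsGlobalFlow v φ) (hK : LipschitzWith K v) (s t : ℝ) (x : E) :
    φ (s + t) x = φ s (φ t x) := by
  have := hφ.eq_of_hasDerivAt hK (γ := fun r => φ (r + t) x) (T := |s|)
    (fun r _ => (hφ.deriv (r + t) x).comp_add_const r t) (le_refl |s|)
  simpa using this

theorem neg_apply (hφ : IsGlobalFlow v φ) (hK : LipschitzWith K v) (t : ℝ) (x : E) :
    φ (-t) (φ t x) = x := by
  rw [← hφ.add hK]; simp [hφ.zero]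

theorem norm_sub_le (hφ : IsGlobalFlow v φ) (hK : LipschitzWith K v) (t : ℝ) (x y : E) :
    ‖φ t x - φ t y‖ ≤ ‖x - y‖ * Real.exp (K * |t|) := by
  have := norm_le_gronwallBound_abs (f := fun t => φ t x - φ t y)
    (f' := fun t => v (φ t x) - v (φ t y)) (K := K) (ε := 0) (T := |t|) (t := t)
    (fun s _ => (hφ.deriv s x).sub (hφ.deriv s y)) (fun s _ => by simpa using hK.norm_sub_le _ _)
    le_rfl
  simpa [hφ.zero, gronwallBound_ε0] using this

theorem norm_sub_le_of_bounded (hφ : IsGlobalFlow v φ) {L : ℝ≥0} (hL : ∀ x, ‖v x‖ ≤ L)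
    (s t : ℝ) (x : E) : ‖φ s x - φ t x‖ ≤ L * |s - t| := by
  simpa using Convex.norm_image_sub_le_of_norm_hasDerivWithin_le (f := fun t => φ t x)
    (f' := fun t => v (φ t x)) (s := univ) (C := L) (x := t) (y := s)
    (fun r _ => (hφ.deriv r x).hasDerivWithinAt) (fun r _ => hL _) convex_univ trivial trivial

/-- Grönwall gives Lipschitz dependence on the initial point, locally uniformly in time; this
combines with continuity in time at one fixed initial point. -/
theorem continuous_uncurry (hφ : IsGlobalFlow v φ) (hK : LipschitzWith K v) :
    Continuous (fun p : ℝ × E => φ p.1 p.2) := by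
  rw [continuous_iff_continuousAt]
  rintro ⟨t₀, x₀⟩
  have h1 : Tendsto (fun p : ℝ × E => φ p.1 x₀) (𝓝 (t₀, x₀)) (𝓝 (φ t₀ x₀)) :=
    ((hφ.deriv t₀ x₀).continuousAt.tendsto).comp continuousAt_fst
  have h2 : Tendsto (fun p : ℝ × E => ‖p.2 - x₀‖ * Real.exp (K * |p.1|)) (𝓝 (t₀, x₀)) (𝓝 0) := by
    have : Continuous (fun p : ℝ × E => ‖p.2 - x₀‖ * Real.exp (K * |p.1|)) := by fun_prop
    simpa using this.tendsto (t₀, x₀)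
  have h3 : Tendsto (fun p : ℝ × E => φ p.1 p.2 - φ p.1 x₀) (𝓝 (t₀, x₀)) (𝓝 0) :=
    squeeze_zero_norm (fun p => hφ.norm_sub_le hK p.1 p.2 x₀) h2
  simpa [ContinuousAt] using h3.add h1

end IsGlobalFlow

end

/-! ### Smooth dependence of flows on initial conditions -/

section Smooth

theorem exists_bound_of_hasCompactSupport {E F : Type*} [TopologicalSpace E]
    [NormedAddCommGroup F] {v : E → F} (hv : Continuous v) (hc : HasCompactSupport v) :
    ∃ L : ℝ≥0, ∀ x, ‖v x‖ ≤ L := by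
  obtain ⟨C, hC⟩ := hc.exists_bound_of_continuous hv
  exact ⟨C.toNNReal, fun x => (hC x).trans (Real.le_coe_toNNReal C)⟩

variable {E : Type u} [NormedAddCommGroup E] [NormedSpace ℝ E]

/-- The variational field `(x, w) ↦ (v x, Dv(x) w)`, cut off in `w`. -/
def variationalField (β : E → ℝ) (v : E → E) (p : E × E) : E × E :=
  β p.2 • (v p.1, fderiv ℝ v p.1 p.2)

theorem contDiff_variationalField {β : E → ℝ} (hβ : ContDiff ℝ ∞ β) {v : E → E}
    (hv : ContDiff ℝ ∞ v) : ContDiff ℝ ∞ (variationalField β v) := by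
  have h1 : ContDiff ℝ ∞ (fderiv ℝ v) := hv.fderiv_right (by simp)
  unfold variationalField
  exact (hβ.comp contDiff_snd).smul ((hv.comp contDiff_fst).prodMk
    ((h1.comp contDiff_fst).clm_apply contDiff_snd))

theorem hasCompactSupport_variationalField {β : E → ℝ} (hβ : HasCompactSupport β) {v : E → E}
    (hv : HasCompactSupport v) : HasCompactSupport (variationalField β v) := by
  refine HasCompactSupport.intro (hv.prod hβ) fun p hp => ?_
  rw [mem_prod, not_and_or] at hp
  rcases hp with hp | hp
  · have h2 : fderiv ℝ v p.1 = 0 := by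
      by_contra h
      exact hp (support_fderiv_subset ℝ h)
    simp [variationalField, image_eq_zero_of_notMem_tsupport hp, h2]
  · simp [variationalField, image_eq_zero_of_notMem_tsupport hp]

variable [FiniteDimensional ℝ E]

/-- The derivative of the flow of a compactly supported smooth field with respect to the initial
condition solves the variational equation, and is expressed by the flow of another such field. -/
theorem exists_fderiv_flow {v : E → E} (hv : ContDiff ℝ ∞ v) (hc : HasCompactSupport v)
    {φ : ℝ → E → E} (hφ : IsGlobalFlow v φ) (T : ℝ) :
    ∃ (L : ℝ → E → E →L[ℝ] E) (w : E × E → E × E) (Ψ : ℝ → E × E → E × E),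
      (∀ t x, |t| ≤ T → HasFDerivAt (φ t) (L t x) x) ∧
      ContDiff ℝ ∞ w ∧ HasCompactSupport w ∧ IsGlobalFlow w Ψ ∧
      ∀ n : WithTop ℕ∞, ContDiff ℝ n (fun p : ℝ × (E × E) => Ψ p.1 p.2) →
        ContDiff ℝ n (fun p : ℝ × E => L p.1 p.2) := by
  obtain ⟨K₀, hK₀⟩ := hv.lipschitzWith_of_hasCompactSupport hc (by simp)
  have hdv : ContDiff ℝ ∞ (fderiv ℝ v) := hv.fderiv_right (by simp)
  obtain ⟨C, hC⟩ := hdv.lipschitzWith_of_hasCompactSupport (hc.fderiv (𝕜 := ℝ)) (by simp)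
  -- The added `1` makes `K` nonzero, as required by the closed form of the Grönwall bound used
  -- below.
  set K : ℝ≥0 := K₀ + 1
  have hK : LipschitzWith K v := hK₀.weaken (by simp [K])
  have hKpos : (0 : ℝ) < K := by simp only [K]; positivity
  have hdvK : ∀ x, ‖fderiv ℝ v x‖ ≤ K := fun x => norm_fderiv_le_of_lipschitz ℝ hK
  let b := Module.finBasis ℝ E
  obtain ⟨B, hB⟩ : ∃ B : ℝ, ∀ i, ‖b i‖ ≤ B := by
    obtain ⟨B, hB⟩ := (Set.finite_range (fun i => ‖b i‖)).bddAbove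
    exact ⟨B, fun i => hB ⟨i, rfl⟩⟩
  -- By Grönwall, solutions of the variational equation started at basis vectors stay below `|B|
  -- e^{K|T|}` up to time `|T|`; hence the cutoff in `w` does not affect them, although it makes the
  -- field compactly supported.
  set R : ℝ := |B| * Real.exp (K * |T|) + 1 with hR
  have hRpos : 0 < R := by positivity
  let β : ContDiffBump (0 : E) := ⟨R, R + 1, hRpos, by linarith⟩
  have hβ : ContDiff ℝ ∞ (β : E → ℝ) := β.contDiff
  have hβc : HasCompactSupport (β : E → ℝ) := β.hasCompactSupport
  have hw := contDiff_variationalField hβ hv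
  have hwc := hasCompactSupport_variationalField hβc hc
  obtain ⟨Kw, hKw⟩ := hw.lipschitzWith_of_hasCompactSupport hwc (by simp)
  obtain ⟨Lw, hLw⟩ := exists_bound_of_hasCompactSupport hw.continuous hwc
  obtain ⟨Ψ, hΨ⟩ := exists_isGlobalFlow hKw hLw
  have hd1 : ∀ t p, HasDerivAt (fun s => (Ψ s p).1) (β (Ψ t p).2 • v (Ψ t p).1) t := fun t p =>
    (ContinuousLinearMap.fst ℝ E E).hasFDerivAt.comp_hasDerivAt t (hΨ.deriv t p)
  have hd2 : ∀ t p, HasDerivAt (fun s => (Ψ s p).2)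
      (β (Ψ t p).2 • fderiv ℝ v (Ψ t p).1 (Ψ t p).2) t := fun t p =>
    (ContinuousLinearMap.snd ℝ E E).hasFDerivAt.comp_hasDerivAt t (hΨ.deriv t p)
  have hbnd : ∀ t x i, |t| ≤ |T| → (Ψ t (x, b i)).2 ∈ closedBall (0 : E) R := by
    intro t x i ht
    have := norm_le_gronwallBound_abs (K := K) (ε := 0) (T := |T|)
      (fun s _ => hd2 s (x, b i)) (fun s _ => by
        rw [norm_smul, add_zero, Real.norm_of_nonneg β.nonneg]
        calc _ ≤ 1 * ‖fderiv ℝ v (Ψ s (x, b i)).1 (Ψ s (x, b i)).2‖ := by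
              gcongr; exact β.le_one
          _ ≤ _ := by
              rw [one_mul]
              exact ((fderiv ℝ v _).le_opNorm _).trans (by gcongr; exact hdvK _)) ht
    rw [mem_closedBall_zero_iff]
    rw [gronwallBound_ε0, hΨ.zero] at this
    refine this.trans ?_
    rw [hR]
    have h1 : ‖b i‖ ≤ |B| := (hB i).trans (le_abs_self B)
    have h2 : Real.exp (K * |t|) ≤ Real.exp (K * |T|) := by gcongr
    have h3 : ‖b i‖ * Real.exp (K * |t|) ≤ |B| * Real.exp (K * |T|) := by gcongr
    simpa using h3.trans (by linarith)
  have hone : ∀ t x i, |t| ≤ |T| → β (Ψ t (x, b i)).2 = 1 := fun t x i ht =>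
    β.one_of_mem_closedBall (hbnd t x i ht)
  have hfst : ∀ t x i, |t| ≤ |T| → (Ψ t (x, b i)).1 = φ t x := by
    intro t x i ht
    have := hφ.eq_of_hasDerivAt hK (γ := fun s => (Ψ s (x, b i)).1) (T := |T|) (fun s hs => by
      have := hd1 s (x, b i)
      rwa [hone s x i hs, one_smul] at this) ht
    simpa [hΨ.zero] using this
  let L : ℝ → E → E →L[ℝ] E := fun t x =>
    ∑ i, (LinearMap.toContinuousLinearMap (b.coord i)).smulRight (Ψ t (x, b i)).2
  have hLapp : ∀ t x h, L t x h = ∑ i, b.coord i h • (Ψ t (x, b i)).2 := fun t x h => by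
    simp [L]
  have hL0 : ∀ x h, L 0 x h = h := fun x h => by
    rw [hLapp]
    simp only [hΨ.zero]
    exact b.sum_repr h
  have hLd : ∀ t x h, |t| ≤ |T| →
      HasDerivAt (fun s => L s x h) (fderiv ℝ v (φ t x) (L t x h)) t := by
    intro t x h ht
    simp only [hLapp, map_sum, map_smul]
    refine HasDerivAt.fun_sum fun i _ => ?_
    have := hd2 t (x, b i)
    rw [hone t x i ht, one_smul, hfst t x i ht] at this
    exact this.const_smul _
  refine ⟨L, variationalField β v, Ψ, fun t x ht => ?_, hw, hwc, hΨ, fun n hn => ?_⟩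
  · have ht' : |t| ≤ |T| := ht.trans (le_abs_self T)
    -- A second-order Taylor remainder: on the ball of radius `‖z - y‖` the derivative varies by at
    -- most `C ‖z - y‖`.
    have hrem : ∀ y z, ‖v z - v y - fderiv ℝ v y (z - y)‖ ≤ C * ‖z - y‖ * ‖z - y‖ := by
      intro y z
      refine Convex.norm_image_sub_le_of_norm_hasFDerivWithin_le' (f' := fderiv ℝ v)
        (s := closedBall y ‖z - y‖)
        (fun q _ => ((hv.differentiable (by simp)) q).hasFDerivAt.hasFDerivWithinAt)
        (fun q hq => ?_) (convex_closedBall _ _) (mem_closedBall_self (norm_nonneg _))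
        (by rw [mem_closedBall, dist_eq_norm])
      refine (hC.norm_sub_le q y).trans ?_
      gcongr
      rw [mem_closedBall, dist_eq_norm] at hq
      exact hq
    set D : ℝ := C * Real.exp (K * |T|) ^ 2 with hD
    -- The linearisation error vanishes at time zero and solves the linear equation up to a source
    -- quadratic in `‖y - x‖`, so Grönwall keeps it quadratic.
    have hest : ∀ y, ‖φ t y - φ t x - L t x (y - x)‖ ≤
        D / K * (Real.exp (K * |t|) - 1) * ‖y - x‖ ^ 2 := by
      intro y
      have := norm_le_gronwallBound_abs (K := K) (ε := D * ‖y - x‖ ^ 2) (T := |T|) (t := t)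
        (f := fun s => φ s y - φ s x - L s x (y - x))
        (fun s hs => ((hφ.deriv s y).sub (hφ.deriv s x)).sub (hLd s x (y - x) hs))
        (fun s hs => by
          have e : v (φ s y) - v (φ s x) - fderiv ℝ v (φ s x) (L s x (y - x)) =
            fderiv ℝ v (φ s x) (φ s y - φ s x - L s x (y - x)) +
            (v (φ s y) - v (φ s x) - fderiv ℝ v (φ s x) (φ s y - φ s x)) := by
            simp only [map_sub]; abel
          rw [e]
          refine (norm_add_le _ _).trans (add_le_add ?_ ((hrem _ _).trans ?_))
          · exact ((fderiv ℝ v _).le_opNorm _).trans (by gcongr; exact hdvK _)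
          · have h1 := hφ.norm_sub_le hK s y x
            have h2 : ‖φ s y - φ s x‖ ≤ ‖y - x‖ * Real.exp (K * |T|) := by
              refine h1.trans ?_
              gcongr
            calc C * ‖φ s y - φ s x‖ * ‖φ s y - φ s x‖
                ≤ C * (‖y - x‖ * Real.exp (K * |T|)) * (‖y - x‖ * Real.exp (K * |T|)) := by gcongr
              _ = D * ‖y - x‖ ^ 2 := by rw [hD]; ring) ht'
      simp only [hφ.zero, hL0, sub_self, norm_zero] at this
      rw [gronwallBound_of_K_ne_0 hKpos.ne'] at this
      refine this.trans (le_of_eq ?_)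
      ring
    rw [hasFDerivAt_iff_isLittleO]
    refine Asymptotics.IsBigO.trans_isLittleO (g := fun y => ‖y - x‖ ^ 2) ?_ ?_
    · refine Asymptotics.IsBigO.of_bound (D / K * (Real.exp (K * |t|) - 1))
        (Eventually.of_forall fun y => ?_)
      rw [Real.norm_of_nonneg (by positivity : (0 : ℝ) ≤ ‖y - x‖ ^ 2)]
      exact hest y
    · have := (Asymptotics.isLittleO_pow_sub_sub x (one_lt_two))
      simpa using this
  · refine ContDiff.sum fun i _ => ?_
    have h1 : ContDiff ℝ n (fun p : ℝ × E => (Ψ p.1 (p.2, b i)).2) :=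
      contDiff_snd.comp (hn.comp (contDiff_fst.prodMk (contDiff_snd.prodMk contDiff_const)))
    exact contDiff_const.smulRight h1

/-- Induction on `n` over all spaces at once: the spatial derivative of a flow on `E` is expressed
by a flow of the same kind on `E × E`, to which the inductive hypothesis applies, and the time
derivative is `v ∘ φ`. -/
theorem IsGlobalFlow.contDiff_nat (n : ℕ) : ∀ {E : Type u} [NormedAddCommGroup E] [NormedSpace ℝ E]
    [FiniteDimensional ℝ E] {v : E → E} (_ : ContDiff ℝ ∞ v) (_ : HasCompactSupport v)
    {φ : ℝ → E → E} (_ : IsGlobalFlow v φ), ContDiff ℝ n (fun p : ℝ × E => φ p.1 p.2) := by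
  induction n with
  | zero =>
    intro E _ _ _ v hv hc φ hφ
    obtain ⟨K, hK⟩ := hv.lipschitzWith_of_hasCompactSupport hc (by simp)
    exact contDiff_zero.2 (hφ.continuous_uncurry hK)
  | succ n ih =>
    intro E _ _ _ v hv hc φ hφ
    obtain ⟨K, hK⟩ := hv.lipschitzWith_of_hasCompactSupport hc (by simp)
    have hcont := hφ.continuous_uncurry hK
    rw [contDiff_iff_contDiffAt]
    rintro ⟨t₀, x₀⟩
    obtain ⟨L, w, Ψ, hL, hw, hwc, hΨ, hreg⟩ := exists_fderiv_flow hv hc hφ (|t₀| + 1)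
    obtain ⟨Kw, hKw⟩ := hw.lipschitzWith_of_hasCompactSupport hwc (by simp)
    have hLn := hreg n (ih hw hwc hΨ)
    have hL0 : Continuous (fun p : ℝ × E => L p.1 p.2) := contDiff_zero.1
      (hreg 0 (contDiff_zero.2 (hΨ.continuous_uncurry hKw)))
    have hnear : ∀ᶠ p : ℝ × E in 𝓝 (t₀, x₀), |p.1| < |t₀| + 1 :=
      (continuous_fst.abs).continuousAt.eventually_lt continuousAt_const (by simp)
    have hvn : ContDiff ℝ n (fun p : ℝ × E => v (φ p.1 p.2)) :=
      (hv.of_le (by exact_mod_cast le_top)).comp (ih hv hc hφ)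
    let f₁ : ℝ → E → ℝ →L[ℝ] E := fun t x => ContinuousLinearMap.toSpanSingleton ℝ (v (φ t x))
    have hf₁ : ContDiff ℝ n (fun p : ℝ × E => f₁ p.1 p.2) :=
      (ContinuousLinearMap.toSpanSingletonCLE (𝕜 := ℝ) (E := E)).contDiff.comp hvn
    rw [Nat.cast_succ, contDiffAt_succ_iff_hasFDerivAt]
    refine ⟨fun p => (f₁ p.1 p.2).coprod (L p.1 p.2), ⟨_, hnear.eventually_nhds, ?_⟩, ?_⟩
    · rintro ⟨t, x⟩ htx
      refine (hasStrictFDerivAt_uncurry_coprod (f := φ) (f₁ := f₁) (f₂ := L) (u := (t, x))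
        ?_ ?_ ?_ ?_).hasFDerivAt
      · exact Eventually.of_forall fun p => (hφ.deriv p.1 p.2).hasFDerivAt
      · have := htx
        simp only [mem_ofPred_eq] at this
        filter_upwards [this] with p hp using hL p.1 p.2 hp.le
      · exact hf₁.continuous.continuousAt
      · exact hL0.continuousAt
    · have h1 : ContDiff ℝ n (fun p : ℝ × E => (f₁ p.1 p.2).coprod (L p.1 p.2)) := by
        have : (fun p : ℝ × E => (f₁ p.1 p.2).coprod (L p.1 p.2)) = fun p : ℝ × E =>
            (f₁ p.1 p.2).comp (ContinuousLinearMap.fst ℝ ℝ E) +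
            (L p.1 p.2).comp (ContinuousLinearMap.snd ℝ ℝ E) := by
          ext p <;> simp
        rw [this]
        exact (hf₁.clm_comp contDiff_const).add (hLn.clm_comp contDiff_const)
      exact h1.contDiffAt

/-- The flow of a smooth, bounded and Lipschitz vector field is jointly smooth. -/
theorem IsGlobalFlow.contDiff {v : E → E} (hv : ContDiff ℝ ∞ v) {L : ℝ≥0}
    (hL : ∀ x, ‖v x‖ ≤ L) {φ : ℝ → E → E} (hφ : IsGlobalFlow v φ) :
    ContDiff ℝ ∞ (fun p : ℝ × E => φ p.1 p.2) := by
  rw [contDiff_iff_contDiffAt]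
  rintro ⟨t₀, x₀⟩
  -- Orbits that start within distance `1` of `x₀` stay in this ball up to time `|t₀| + 1`, so there
  -- they are also orbits of the compactly supported field `w`.
  set R : ℝ := L * (|t₀| + 1) + 1 with hR
  have hRpos : 0 < R := by positivity
  let β : ContDiffBump x₀ := ⟨R, R + 1, hRpos, by linarith⟩
  let w : E → E := fun x => β x • v x
  have hw : ContDiff ℝ ∞ w := β.contDiff.smul hv
  have hwc : HasCompactSupport w := β.hasCompactSupport.smul_right
  obtain ⟨Kw, hKw⟩ := hw.lipschitzWith_of_hasCompactSupport hwc (by simp)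
  obtain ⟨Lw, hLw⟩ := exists_bound_of_hasCompactSupport hw.continuous hwc
  obtain ⟨Ψ, hΨ⟩ := exists_isGlobalFlow hKw hLw
  have hΨs : ContDiff ℝ ∞ (fun p : ℝ × E => Ψ p.1 p.2) :=
    contDiff_infty.2 fun n => IsGlobalFlow.contDiff_nat n hw hwc hΨ
  have hnear : ∀ᶠ p : ℝ × E in 𝓝 (t₀, x₀), |p.1| < |t₀| + 1 ∧ dist p.2 x₀ < 1 :=
    ((continuous_fst.abs).continuousAt.eventually_lt continuousAt_const (by simp)).and
      ((continuous_snd.dist continuous_const).continuousAt.eventually_lt continuousAt_const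
        (by simp))
  refine hΨs.contDiffAt.congr_of_eventuallyEq ?_
  filter_upwards [hnear] with p hp
  have := hΨ.eq_of_hasDerivAt hKw (γ := fun s => φ s p.2) (T := |t₀| + 1) (fun s hs => by
    have hin : φ s p.2 ∈ closedBall x₀ R := by
      have h1 := hφ.norm_sub_le_of_bounded hL s 0 p.2
      rw [hφ.zero, sub_zero] at h1
      rw [mem_closedBall]
      calc dist (φ s p.2) x₀ ≤ dist (φ s p.2) p.2 + dist p.2 x₀ := dist_triangle _ _ _
        _ ≤ L * (|t₀| + 1) + 1 := by
          rw [dist_eq_norm]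
          exact add_le_add (h1.trans (by gcongr)) hp.2.le
    have : w (φ s p.2) = v (φ s p.2) := by
      simp only [w]
      rw [β.one_of_mem_closedBall hin, one_smul]
    rw [this]
    exact hφ.deriv s p.2) hp.1.le
  simpa [hφ.zero] using this

end Smooth

end Flows

/-! ### The frame on the unit circle bundle -/

/-- The rotating combination `cos θ A(x) + sin θ B(x)`. -/
def rotate {F : Type*} [AddCommGroup F] [Module ℝ F] (A B : Plane → F) (p : CircleCoord) : F :=
  Real.cos p.2 • A p.1 + Real.sin p.2 • B p.1

theorem contDiff_rotate {F : Type*} [NormedAddCommGroup F] [NormedSpace ℝ F] {A B : Plane → F}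
    (hA : ContDiff ℝ ∞ A) (hB : ContDiff ℝ ∞ B) : ContDiff ℝ ∞ (rotate A B) :=
  ((Real.contDiff_cos.comp contDiff_snd).smul (hA.comp contDiff_fst)).add
    ((Real.contDiff_sin.comp contDiff_snd).smul (hB.comp contDiff_fst))

theorem fderiv_rotate {F : Type*} [NormedAddCommGroup F] [NormedSpace ℝ F] {A B : Plane → F}
    (hA : Differentiable ℝ A) (hB : Differentiable ℝ B) (p w : CircleCoord) :
    fderiv ℝ (rotate A B) p w =
      Real.cos p.2 • fderiv ℝ A p.1 w.1 + Real.sin p.2 • fderiv ℝ B p.1 w.1 +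
        w.2 • (Real.cos p.2 • B p.1 - Real.sin p.2 • A p.1) := by
  have h1 : HasFDerivAt (fun p : CircleCoord => Real.cos p.2)
      (-Real.sin p.2 • ContinuousLinearMap.snd ℝ Plane ℝ) p :=
    (Real.hasDerivAt_cos p.2).comp_hasFDerivAt p hasFDerivAt_snd
  have h2 : HasFDerivAt (fun p : CircleCoord => Real.sin p.2)
      (Real.cos p.2 • ContinuousLinearMap.snd ℝ Plane ℝ) p :=
    (Real.hasDerivAt_sin p.2).comp_hasFDerivAt p hasFDerivAt_snd
  have h3 : HasFDerivAt (fun p : CircleCoord => A p.1)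
      ((fderiv ℝ A p.1).comp (ContinuousLinearMap.fst ℝ Plane ℝ)) p :=
    (hA p.1).hasFDerivAt.comp p hasFDerivAt_fst
  have h4 : HasFDerivAt (fun p : CircleCoord => B p.1)
      ((fderiv ℝ B p.1).comp (ContinuousLinearMap.fst ℝ Plane ℝ)) p :=
    (hB p.1).hasFDerivAt.comp p hasFDerivAt_fst
  have := ((h1.smul h3).add (h2.smul h4)).fderiv
  unfold rotate
  erw [this]
  simp only [add_apply, smul_apply,
    ContinuousLinearMap.comp_apply, ContinuousLinearMap.coe_fst', ContinuousLinearMap.smulRight_apply,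
    ContinuousLinearMap.coe_snd']
  simp only [smul_eq_mul]
  module

namespace RiemannianSurface

variable (S : RiemannianSurface)

theorem areaDensity_pos (x : Plane) : 0 < S.areaDensity x := Real.sqrt_pos.2 (S.det_pos x)

theorem areaDensity_sq (x : Plane) : S.areaDensity x ^ 2 = S.E x * S.G x - S.F x ^ 2 :=
  Real.sq_sqrt (S.det_pos x).le

theorem sqrt_E_pos (x : Plane) : 0 < √(S.E x) := Real.sqrt_pos.2 (S.E_pos x)

theorem contDiff_areaDensity : ContDiff ℝ ∞ S.areaDensity :=
  ((S.smooth_E.mul S.smooth_G).sub (S.smooth_F.pow 2)).sqrt fun x => (S.det_pos x).ne'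

theorem contDiff_sqrt_E : ContDiff ℝ ∞ fun x => √(S.E x) :=
  S.smooth_E.sqrt fun x => (S.E_pos x).ne'

theorem contDiff_e₁ : ContDiff ℝ ∞ S.e₁ :=
  (contDiff_const.div S.contDiff_sqrt_E fun x => (S.sqrt_E_pos x).ne').prodMk contDiff_const

theorem contDiff_e₂ : ContDiff ℝ ∞ S.e₂ := by
  have h : ∀ x, √(S.E x) * S.areaDensity x ≠ 0 := fun x =>
    (mul_pos (S.sqrt_E_pos x) (S.areaDensity_pos x)).ne'
  exact (S.smooth_F.neg.div (S.contDiff_sqrt_E.mul S.contDiff_areaDensity) h).prodMk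
    (S.smooth_E.div (S.contDiff_sqrt_E.mul S.contDiff_areaDensity) h)

theorem contDiff_metric {E' : Type*} [NormedAddCommGroup E'] [NormedSpace ℝ E'] {n : WithTop ℕ∞}
    (hn : n ≤ ∞) {x v w : E' → Plane} (hx : ContDiff ℝ n x) (hv : ContDiff ℝ n v)
    (hw : ContDiff ℝ n w) : ContDiff ℝ n fun y => S.metric (x y) (v y) (w y) := by
  have hE := (S.smooth_E.of_le hn).comp hx
  have hF := (S.smooth_F.of_le hn).comp hx
  have hG := (S.smooth_G.of_le hn).comp hx
  exact ((hE.mul (hv.fst.mul hw.fst)).add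
    (hF.mul ((hv.fst.mul hw.snd).add (hv.snd.mul hw.fst)))).add (hG.mul (hv.snd.mul hw.snd))

theorem contDiff_lieBracket_frame :
    ContDiff ℝ ∞ (VectorField.lieBracket ℝ S.e₁ S.e₂) :=
  ((S.contDiff_e₂.fderiv_right (by simp)).clm_apply S.contDiff_e₁).sub
    ((S.contDiff_e₁.fderiv_right (by simp)).clm_apply S.contDiff_e₂)

theorem contDiff_c₁ : ContDiff ℝ ∞ S.c₁ :=
  S.contDiff_metric le_rfl contDiff_id S.contDiff_lieBracket_frame S.contDiff_e₁

theorem contDiff_c₂ : ContDiff ℝ ∞ S.c₂ :=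
  S.contDiff_metric le_rfl contDiff_id S.contDiff_lieBracket_frame S.contDiff_e₂

theorem contDiff_curvature : ContDiff ℝ ∞ S.curvature :=
  ((((S.contDiff_c₂.fderiv_right (by simp)).clm_apply S.contDiff_e₁).sub
    ((S.contDiff_c₁.fderiv_right (by simp)).clm_apply S.contDiff_e₂)).sub
    (S.contDiff_c₁.pow 2)).sub (S.contDiff_c₂.pow 2)

theorem metric_e₁_e₁ (x : Plane) : S.metric x (S.e₁ x) (S.e₁ x) = 1 := by
  have h1 := Real.sq_sqrt (S.E_pos x).le
  have h2 := (S.sqrt_E_pos x).ne'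
  simp only [metric, e₁]
  field_simp
  linear_combination -h1

theorem metric_e₁_e₂ (x : Plane) : S.metric x (S.e₁ x) (S.e₂ x) = 0 := by
  have h2 := (S.sqrt_E_pos x).ne'
  have h3 := (S.areaDensity_pos x).ne'
  simp only [metric, e₁, e₂]
  field_simp
  ring

theorem metric_e₂_e₂ (x : Plane) : S.metric x (S.e₂ x) (S.e₂ x) = 1 := by
  have h1 := Real.sq_sqrt (S.E_pos x).le
  have h2 := (S.sqrt_E_pos x).ne'
  have h3 := (S.areaDensity_pos x).ne'
  have h4 := S.areaDensity_sq x
  simp only [metric, e₂]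
  field_simp
  linear_combination (-S.areaDensity x ^ 2) * h1 - S.E x * h4

theorem metric_add_left (x u v w : Plane) :
    S.metric x (u + v) w = S.metric x u w + S.metric x v w := by
  simp only [metric, Prod.fst_add, Prod.snd_add]; ring

theorem metric_smul_left (x : Plane) (r : ℝ) (v w : Plane) :
    S.metric x (r • v) w = r * S.metric x v w := by
  simp only [metric, Prod.smul_fst, Prod.smul_snd, smul_eq_mul]; ring

theorem metric_comm (x v w : Plane) : S.metric x v w = S.metric x w v := by
  simp only [metric]; ring

theorem metric_add_right (x u v w : Plane) :
    S.metric x w (u + v) = S.metric x w u + S.metric x w v := by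
  simp only [metric, Prod.fst_add, Prod.snd_add]; ring

theorem metric_smul_right (x : Plane) (r : ℝ) (v w : Plane) :
    S.metric x w (r • v) = r * S.metric x w v := by
  simp only [metric, Prod.smul_fst, Prod.smul_snd, smul_eq_mul]; ring

/-- Orthonormality of `(e₁, e₂)` in coordinates; it turns the definitions of `c₁`, `c₂` into the
expansion of the bracket `[e₁, e₂]`. -/
theorem frame_expansion (x v : Plane) :
    S.metric x v (S.e₁ x) • S.e₁ x + S.metric x v (S.e₂ x) • S.e₂ x = v := by
  have h1 := Real.sq_sqrt (S.E_pos x).le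
  have h2 := (S.sqrt_E_pos x).ne'
  have h3 := (S.areaDensity_pos x).ne'
  have h4 := S.areaDensity_sq x
  have h5 := (S.E_pos x).ne'
  ext
  · simp only [metric, e₁, e₂, Prod.fst_add, Prod.smul_fst, smul_eq_mul]
    field_simp
    rw [h1, h4]
    ring
  · simp only [metric, e₁, e₂, Prod.snd_add, Prod.smul_snd, smul_eq_mul]
    field_simp
    rw [h1, h4]
    ring

theorem lieBracket_frame (x : Plane) :
    VectorField.lieBracket ℝ S.e₁ S.e₂ x = S.c₁ x • S.e₁ x + S.c₂ x • S.e₂ x :=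
  (S.frame_expansion x _).symm

/-- The horizontal lift of `e₁`. -/
def lift₁ (x : Plane) : CircleCoord := (S.e₁ x, S.c₁ x)

/-- The horizontal lift of `e₂`. -/
def lift₂ (x : Plane) : CircleCoord := (S.e₂ x, S.c₂ x)

theorem contDiff_lift₁ : ContDiff ℝ ∞ S.lift₁ := S.contDiff_e₁.prodMk S.contDiff_c₁

theorem contDiff_lift₂ : ContDiff ℝ ∞ S.lift₂ := S.contDiff_e₂.prodMk S.contDiff_c₂

theorem X_eq_rotate : S.X = rotate S.lift₁ S.lift₂ := by
  funext p
  simp [X, rotate, lift₁, lift₂, mul_comm]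

theorem contDiff_X : ContDiff ℝ ∞ S.X := by
  rw [X_eq_rotate]; exact contDiff_rotate S.contDiff_lift₁ S.contDiff_lift₂

theorem fderiv_X (p w : CircleCoord) : fderiv ℝ S.X p w =
    Real.cos p.2 • fderiv ℝ S.lift₁ p.1 w.1 + Real.sin p.2 • fderiv ℝ S.lift₂ p.1 w.1 +
      w.2 • (Real.cos p.2 • S.lift₂ p.1 - Real.sin p.2 • S.lift₁ p.1) := by
  rw [X_eq_rotate]
  exact fderiv_rotate (S.contDiff_lift₁.differentiable (by simp))
    (S.contDiff_lift₂.differentiable (by simp)) p w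

/-- Since `V` is constant, the bracket `[X, V]` reduces to `-∂_θ X`. -/
theorem Xperp_eq_rotate : S.Xperp = rotate (-S.lift₂) S.lift₁ := by
  funext p
  have hV : fderiv ℝ V p = 0 := fderiv_const_apply _
  simp only [Xperp, VectorField.lieBracket, hV, fderiv_X, V, rotate]
  simp
  abel

theorem contDiff_Xperp : ContDiff ℝ ∞ S.Xperp := by
  rw [Xperp_eq_rotate]; exact contDiff_rotate S.contDiff_lift₂.neg S.contDiff_lift₁

theorem Xperp_apply (p : CircleCoord) : S.Xperp p =
    (Real.sin p.2 • S.e₁ p.1 - Real.cos p.2 • S.e₂ p.1,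
      Real.sin p.2 * S.c₁ p.1 - Real.cos p.2 * S.c₂ p.1) := by
  rw [Xperp_eq_rotate]
  ext <;> simp [rotate, lift₁, lift₂] <;> ring

theorem fderiv_X_V (p : CircleCoord) : fderiv ℝ S.X p (0, 1) = -S.Xperp p := by
  rw [fderiv_X, Xperp_eq_rotate]
  simp [rotate]
  abel

theorem fderiv_Xperp (p w : CircleCoord) : fderiv ℝ S.Xperp p w =
    Real.sin p.2 • fderiv ℝ S.lift₁ p.1 w.1 - Real.cos p.2 • fderiv ℝ S.lift₂ p.1 w.1 +
      w.2 • S.X p := by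
  rw [Xperp_eq_rotate, fderiv_rotate (A := -S.lift₂) (S.contDiff_lift₂.neg.differentiable (by simp))
    (S.contDiff_lift₁.differentiable (by simp)), X_eq_rotate]
  have : fderiv ℝ (-S.lift₂) p.1 = -fderiv ℝ S.lift₂ p.1 := fderiv_neg
  rw [this]
  simp only [rotate, neg_apply, Pi.neg_apply]
  module

/-- The structure equation `[X, X_⊥] = -κ V`. -/
theorem fderiv_Xperp_X (p : CircleCoord) :
    fderiv ℝ S.Xperp p (S.X p) = fderiv ℝ S.X p (S.Xperp p) - (0, S.curvature p.1) := by
  have hb := S.lieBracket_frame p.1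
  simp only [VectorField.lieBracket] at hb
  have hs := Real.sin_sq_add_cos_sq p.2
  have hlift₁ : ∀ v, fderiv ℝ S.lift₁ p.1 v = (fderiv ℝ S.e₁ p.1 v, fderiv ℝ S.c₁ p.1 v) := by
    intro v
    have := ((S.contDiff_e₁.differentiable (by simp) p.1).hasFDerivAt.prodMk
      (S.contDiff_c₁.differentiable (by simp) p.1).hasFDerivAt).fderiv
    unfold lift₁
    rw [this]; rfl
  have hlift₂ : ∀ v, fderiv ℝ S.lift₂ p.1 v = (fderiv ℝ S.e₂ p.1 v, fderiv ℝ S.c₂ p.1 v) := by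
    intro v
    have := ((S.contDiff_e₂.differentiable (by simp) p.1).hasFDerivAt.prodMk
      (S.contDiff_c₂.differentiable (by simp) p.1).hasFDerivAt).fderiv
    unfold lift₂
    rw [this]; rfl
  rw [fderiv_Xperp, fderiv_X, Xperp_apply]
  simp only [hlift₁, hlift₂, X, lift₁, lift₂, map_add, map_sub, map_smul, curvature]
  generalize hA : fderiv ℝ S.e₁ p.1 = A at *
  generalize hB : fderiv ℝ S.e₂ p.1 = B at *
  generalize fderiv ℝ S.c₁ p.1 = a at *
  generalize fderiv ℝ S.c₂ p.1 = b at *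
  generalize Real.sin p.2 = s at *
  generalize Real.cos p.2 = c at *
  have hb1 := congrArg Prod.fst hb
  have hb2 := congrArg Prod.snd hb
  simp only [Prod.fst_sub, Prod.snd_sub, Prod.fst_add, Prod.snd_add, Prod.smul_fst, Prod.smul_snd,
    smul_eq_mul] at hb1 hb2
  ext
  · simp
    linear_combination (-s^2-c^2) * hb1 + (-(S.c₁ p.1 * (S.e₁ p.1).1) - (S.c₂ p.1 * (S.e₂ p.1).1) +(S.c₁ p.1 * (S.e₁ p.1).1) + (S.c₂ p.1 * (S.e₂ p.1).1)) * hs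
  · simp
    linear_combination (-s^2-c^2) * hb2
  · simp
    linear_combination (a (S.e₂ p.1) - b (S.e₁ p.1) + S.c₁ p.1 ^ 2 + S.c₂ p.1 ^ 2) * hs

/-- The coefficient of `X` of a tangent vector `ξ` of the circle bundle at `p`. -/
def coordX (p ξ : CircleCoord) : ℝ := S.metric p.1 ξ.1 (S.X p).1

/-- The coefficient of `X_⊥` of a tangent vector `ξ` of the circle bundle at `p`. -/
def coordY (p ξ : CircleCoord) : ℝ := S.metric p.1 ξ.1 (S.Xperp p).1

/-- The coefficient of `V` of a tangent vector `ξ` of the circle bundle at `p`. -/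
def coordV (p ξ : CircleCoord) : ℝ :=
  ξ.2 - S.coordX p ξ * (S.X p).2 - S.coordY p ξ * (S.Xperp p).2

theorem coord_expansion (p ξ : CircleCoord) :
    ξ = S.coordX p ξ • S.X p + S.coordY p ξ • S.Xperp p + S.coordV p ξ • (0, 1) := by
  have hs := Real.sin_sq_add_cos_sq p.2
  have he := S.frame_expansion p.1 ξ.1
  ext : 1
  · simp only [coordX, coordY, X, Xperp_apply, Prod.fst_add, Prod.smul_fst, smul_zero, add_zero,
      metric_add_right, metric_smul_right, sub_eq_add_neg, ← neg_smul]
    conv_lhs => rw [← he]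
    generalize S.metric p.1 ξ.1 (S.e₁ p.1) = m
    generalize S.metric p.1 ξ.1 (S.e₂ p.1) = n
    ext
    · simp
      linear_combination (-(m * (S.e₁ p.1).1) - n * (S.e₂ p.1).1) * hs
    · simp
      linear_combination (-(m * (S.e₁ p.1).2) - n * (S.e₂ p.1).2) * hs
  · simp [coordV]

theorem metric_X_X (p : CircleCoord) : S.metric p.1 (S.X p).1 (S.X p).1 = 1 := by
  simp only [X, metric_add_right, metric_smul_right, metric_add_left, metric_smul_left,
    metric_e₁_e₁, metric_e₁_e₂, metric_e₂_e₂, S.metric_comm p.1 (S.e₂ p.1) (S.e₁ p.1)]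
  linear_combination Real.sin_sq_add_cos_sq p.2

theorem metric_X_Xperp (p : CircleCoord) : S.metric p.1 (S.X p).1 (S.Xperp p).1 = 0 := by
  simp only [X, Xperp_apply, metric_add_right, metric_smul_right, metric_add_left, metric_smul_left,
    sub_eq_add_neg, ← neg_smul,
    metric_e₁_e₁, metric_e₁_e₂, metric_e₂_e₂, S.metric_comm p.1 (S.e₂ p.1) (S.e₁ p.1)]
  ring

theorem metric_Xperp_Xperp (p : CircleCoord) :
    S.metric p.1 (S.Xperp p).1 (S.Xperp p).1 = 1 := by
  simp only [Xperp_apply, metric_add_right, metric_smul_right, metric_add_left, metric_smul_left,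
    sub_eq_add_neg, ← neg_smul,
    metric_e₁_e₁, metric_e₁_e₂, metric_e₂_e₂, S.metric_comm p.1 (S.e₂ p.1) (S.e₁ p.1)]
  linear_combination Real.sin_sq_add_cos_sq p.2

/-- `V` has no base component, and `X`, `X_⊥` project to an orthonormal basis, so pairing with them
isolates the coefficients. This permits comparing coefficients in `jacobi_system`. -/
theorem coord_unique {p : CircleCoord} {α a b : ℝ}
    (h : α • S.X p + a • S.Xperp p + b • ((0, 1) : CircleCoord) = 0) : α = 0 ∧ a = 0 ∧ b = 0 := by
  have h1 : α • (S.X p).1 + a • (S.Xperp p).1 = 0 := by simpa using congrArg Prod.fst h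
  have hα : α = 0 := by
    have := congrArg (fun v => S.metric p.1 v (S.X p).1) h1
    simpa [metric_add_left, metric_smul_left, metric_X_X, S.metric_comm p.1 (S.Xperp p).1,
      metric_X_Xperp, show S.metric p.1 0 (S.X p).1 = 0 by simp [metric]] using this
  have ha : a = 0 := by
    have := congrArg (fun v => S.metric p.1 v (S.Xperp p).1) h1
    simpa [metric_add_left, metric_smul_left, metric_Xperp_Xperp,
      metric_X_Xperp, show S.metric p.1 0 (S.Xperp p).1 = 0 by simp [metric]] using this
  refine ⟨hα, ha, ?_⟩
  simpa [hα, ha] using congrArg Prod.snd h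

theorem contDiff_coordX {E' : Type*} [NormedAddCommGroup E'] [NormedSpace ℝ E'] {p ξ : E' → CircleCoord}
    (hp : ContDiff ℝ ∞ p) (hξ : ContDiff ℝ ∞ ξ) : ContDiff ℝ ∞ fun y => S.coordX (p y) (ξ y) :=
  S.contDiff_metric le_rfl hp.fst hξ.fst (S.contDiff_X.comp hp).fst

theorem contDiff_coordY {E' : Type*} [NormedAddCommGroup E'] [NormedSpace ℝ E'] {p ξ : E' → CircleCoord}
    (hp : ContDiff ℝ ∞ p) (hξ : ContDiff ℝ ∞ ξ) : ContDiff ℝ ∞ fun y => S.coordY (p y) (ξ y) :=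
  S.contDiff_metric le_rfl hp.fst hξ.fst (S.contDiff_Xperp.comp hp).fst

theorem contDiff_coordV {E' : Type*} [NormedAddCommGroup E'] [NormedSpace ℝ E'] {p ξ : E' → CircleCoord}
    (hp : ContDiff ℝ ∞ p) (hξ : ContDiff ℝ ∞ ξ) : ContDiff ℝ ∞ fun y => S.coordV (p y) (ξ y) :=
  (hξ.snd.sub ((S.contDiff_coordX hp hξ).mul (S.contDiff_X.comp hp).snd)).sub
    ((S.contDiff_coordY hp hξ).mul (S.contDiff_Xperp.comp hp).snd)

/-- The derivative of `κ` in the direction of `X_⊥` is controlled by `|∇κ|`. -/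
theorem abs_fderiv_curvature_Xperp_le (p : CircleCoord) :
    |fderiv ℝ S.curvature p.1 (S.Xperp p).1| ≤ S.gradCurvature p.1 := by
  rw [gradCurvature, Xperp_apply]
  simp only [map_sub, map_smul, smul_eq_mul]
  refine Real.le_sqrt_of_sq_le ?_
  rw [sq_abs]
  nlinarith [sq_nonneg (Real.cos p.2 * fderiv ℝ S.curvature p.1 (S.e₁ p.1) +
    Real.sin p.2 * fderiv ℝ S.curvature p.1 (S.e₂ p.1)), Real.sin_sq_add_cos_sq p.2,
    sq_nonneg (fderiv ℝ S.curvature p.1 (S.e₁ p.1)), sq_nonneg (fderiv ℝ S.curvature p.1 (S.e₂ p.1))]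

end RiemannianSurface

/-! ### The geodesic flow, extended to the plane -/

-- The angle enters only through cosine and sine, so compact support in `x` alone makes the field
-- bounded with bounded derivative, although it is not compactly supported in `θ`.
open scoped NNReal in
theorem rotate_bounded_lipschitz {F : Type*} [NormedAddCommGroup F] [NormedSpace ℝ F]
    {A B : Plane → F} (hA : ContDiff ℝ ∞ A) (hB : ContDiff ℝ ∞ B) (hAc : HasCompactSupport A)
    (hBc : HasCompactSupport B) :
    ∃ K L : ℝ≥0, LipschitzWith K (rotate A B) ∧ ∀ p, ‖rotate A B p‖ ≤ L := by
  obtain ⟨a, ha⟩ := exists_bound_of_hasCompactSupport hA.continuous hAc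
  obtain ⟨b, hb⟩ := exists_bound_of_hasCompactSupport hB.continuous hBc
  obtain ⟨a', ha'⟩ := exists_bound_of_hasCompactSupport (hA.continuous_fderiv (by simp))
    (hAc.fderiv (𝕜 := ℝ))
  obtain ⟨b', hb'⟩ := exists_bound_of_hasCompactSupport (hB.continuous_fderiv (by simp))
    (hBc.fderiv (𝕜 := ℝ))
  have hc : ∀ (r : ℝ) (v : F), ‖Real.cos r • v‖ ≤ ‖v‖ := fun r v => by
    rw [norm_smul]
    exact mul_le_of_le_one_left (norm_nonneg _) (Real.abs_cos_le_one r)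
  have hs : ∀ (r : ℝ) (v : F), ‖Real.sin r • v‖ ≤ ‖v‖ := fun r v => by
    rw [norm_smul]
    exact mul_le_of_le_one_left (norm_nonneg _) (Real.abs_sin_le_one r)
  refine ⟨a' + b' + (a + b), a + b, ?_, fun p => ?_⟩
  · refine lipschitzWith_of_nnnorm_fderiv_le ((contDiff_rotate hA hB).differentiable (by simp))
      fun p => ?_
    rw [← NNReal.coe_le_coe, coe_nnnorm]
    refine ContinuousLinearMap.opNorm_le_bound _ (by positivity) fun w => ?_
    rw [fderiv_rotate (hA.differentiable (by simp)) (hB.differentiable (by simp))]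
    have h1 : ‖fderiv ℝ A p.1 w.1‖ ≤ a' * ‖w‖ :=
      ((fderiv ℝ A p.1).le_opNorm _).trans (by gcongr; exacts [ha' _, norm_fst_le w])
    have h2 : ‖fderiv ℝ B p.1 w.1‖ ≤ b' * ‖w‖ :=
      ((fderiv ℝ B p.1).le_opNorm _).trans (by gcongr; exacts [hb' _, norm_fst_le w])
    have h3 : ‖w.2 • (Real.cos p.2 • B p.1 - Real.sin p.2 • A p.1)‖ ≤ (a + b) * ‖w‖ := by
      rw [norm_smul, mul_comm]
      gcongr
      · refine (norm_sub_le _ _).trans ?_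
        linarith [(hc p.2 (B p.1)).trans (hb _), (hs p.2 (A p.1)).trans (ha _)]
      · exact norm_snd_le w
    push_cast
    refine (norm_add₃_le).trans ?_
    linarith [(hc p.2 _).trans h1, (hs p.2 _).trans h2]
  · push_cast
    exact (norm_add_le _ _).trans
      (add_le_add ((hc _ _).trans (ha _)) ((hs _ _).trans (hb _)))

namespace RiemannianSurface

variable (S : RiemannianSurface)

/-- The radius of a ball that contains `M`. -/
def radius : ℝ := (S.isCompact.isBounded.subset_ball_lt 0 0).choose

theorem radius_pos : 0 < S.radius := (S.isCompact.isBounded.subset_ball_lt 0 0).choose_spec.1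

theorem subset_ball : S.M ⊆ Metric.ball 0 S.radius :=
  (S.isCompact.isBounded.subset_ball_lt 0 0).choose_spec.2

/-- A cutoff function that is `1` near `M`. -/
def cutoff : ContDiffBump (0 : Plane) := ⟨S.radius, S.radius + 1, S.radius_pos, by linarith⟩

/-- The generator of the geodesic flow, cut off away from `M`. -/
def cutX (p : CircleCoord) : CircleCoord := S.cutoff p.1 • S.X p

theorem cutX_eq_rotate : S.cutX =
    rotate (fun x => S.cutoff x • S.lift₁ x) (fun x => S.cutoff x • S.lift₂ x) := by
  funext p
  simp only [cutX, X_eq_rotate, rotate, smul_add, smul_comm (S.cutoff p.1)]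

theorem contDiff_cutX : ContDiff ℝ ∞ S.cutX :=
  (S.cutoff.contDiff.comp contDiff_fst).smul S.contDiff_X

theorem exists_bounds_cutX : ∃ K L : NNReal, LipschitzWith K S.cutX ∧ ∀ p, ‖S.cutX p‖ ≤ L := by
  rw [cutX_eq_rotate]
  exact rotate_bounded_lipschitz (S.cutoff.contDiff.smul S.contDiff_lift₁)
    (S.cutoff.contDiff.smul S.contDiff_lift₂) S.cutoff.hasCompactSupport.smul_right
    S.cutoff.hasCompactSupport.smul_right

/-- A Lipschitz constant of the cut-off field. -/
def lip : NNReal := S.exists_bounds_cutX.choose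

/-- A bound for the cut-off field. -/
def speed : NNReal := S.exists_bounds_cutX.choose_spec.choose

theorem lipschitz_cutX : LipschitzWith S.lip S.cutX :=
  S.exists_bounds_cutX.choose_spec.choose_spec.1

theorem norm_cutX_le (p : CircleCoord) : ‖S.cutX p‖ ≤ S.speed :=
  S.exists_bounds_cutX.choose_spec.choose_spec.2 p

/-- The flow of the cut-off field: it extends the geodesic flow of `M` to all times. -/
def Φ : ℝ → CircleCoord → CircleCoord :=
  (exists_isGlobalFlow S.lipschitz_cutX S.norm_cutX_le).choose

theorem isGlobalFlow_Φ : IsGlobalFlow S.cutX S.Φ :=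
  (exists_isGlobalFlow S.lipschitz_cutX S.norm_cutX_le).choose_spec

theorem contDiff_Φ : ContDiff ℝ ∞ (fun q : ℝ × CircleCoord => S.Φ q.1 q.2) :=
  S.isGlobalFlow_Φ.contDiff S.contDiff_cutX S.norm_cutX_le

theorem continuous_Φ : Continuous (fun q : ℝ × CircleCoord => S.Φ q.1 q.2) :=
  S.contDiff_Φ.continuous

theorem contDiff_Φ_right (t : ℝ) : ContDiff ℝ ∞ (S.Φ t) :=
  S.contDiff_Φ.comp (contDiff_const.prodMk contDiff_id)

theorem Φ_zero (p : CircleCoord) : S.Φ 0 p = p := S.isGlobalFlow_Φ.zero p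

/-- The open neighbourhood of the circle bundle where the extended flow is geodesic. -/
def geodesicRegion : Set CircleCoord := {p | p.1 ∈ Metric.ball (0 : Plane) S.radius}

theorem isOpen_geodesicRegion : IsOpen S.geodesicRegion :=
  Metric.isOpen_ball.preimage continuous_fst

theorem mem_geodesicRegion {p : CircleCoord} (hp : p.1 ∈ S.M) : p ∈ S.geodesicRegion :=
  S.subset_ball hp

theorem cutX_eq {p : CircleCoord} (hp : p ∈ S.geodesicRegion) : S.cutX p = S.X p := by
  have : S.cutoff p.1 = 1 := S.cutoff.one_of_mem_closedBall (Metric.ball_subset_closedBall hp)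
  rw [cutX, this, one_smul]

theorem X_periodic (p : CircleCoord) (n : ℤ) : S.X (p + (0, n * (2 * Real.pi))) = S.X p := by
  simp [X, Real.cos_add_int_mul_two_pi, Real.sin_add_int_mul_two_pi]

/-- The field is periodic in the angle, so a shifted orbit is an orbit and uniqueness applies. This
reduces compactness arguments to one period. -/
theorem Φ_periodic (t : ℝ) (p : CircleCoord) (n : ℤ) :
    S.Φ t (p + (0, n * (2 * Real.pi))) = S.Φ t p + (0, n * (2 * Real.pi)) := by
  have := S.isGlobalFlow_Φ.eq_of_hasDerivAt S.lipschitz_cutX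
    (γ := fun s => S.Φ s p + (0, n * (2 * Real.pi))) (T := |t|) (fun s _ => by
      have h : S.cutX (S.Φ s p + (0, n * (2 * Real.pi))) = S.cutX (S.Φ s p) := by
        simp only [cutX, X_periodic]
        simp
      rw [h]
      exact (S.isGlobalFlow_Φ.deriv s p).add_const _) le_rfl
  simpa [Φ_zero] using this.symm

/-- The geodesic with initial condition `p` stays in `M` up to time `t`. -/
def Stays (p : CircleCoord) (t : ℝ) : Prop := ∀ s ∈ Icc 0 t, (S.Φ s p).1 ∈ S.M

/-! ### Time spent in `M` and the exit time -/

variable {S}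

theorem Stays.mono {p : CircleCoord} {s t : ℝ} (h : S.Stays p t) (hst : s ≤ t) : S.Stays p s :=
  fun r hr => h r ⟨hr.1, hr.2.trans hst⟩

theorem Stays.mem {p : CircleCoord} {t : ℝ} (h : S.Stays p t) (ht : 0 ≤ t) : p.1 ∈ S.M := by
  simpa [Φ_zero] using h 0 ⟨le_rfl, ht⟩

theorem IsOrbit.eq_Φ {p : CircleCoord} {t : ℝ} {c : ℝ → CircleCoord} (hc : S.IsOrbit p t c)
    {s : ℝ} (hs : s ∈ Icc 0 t) : c s = S.Φ s p := by
  have := S.isGlobalFlow_Φ.eq_of_hasDerivWithinAt S.lipschitz_cutX (γ := c) (T := t)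
    (fun r hr => by
      rw [S.cutX_eq (S.mem_geodesicRegion (hc.2 r hr).1)]
      exact (hc.2 r hr).2) hs
  rw [this, hc.1]

theorem Stays.isOrbit {p : CircleCoord} {t : ℝ} (h : S.Stays p t) :
    S.IsOrbit p t (fun s => S.Φ s p) :=
  ⟨S.Φ_zero p, fun s hs => ⟨h s hs, by
    rw [← S.cutX_eq (S.mem_geodesicRegion (h s hs))]
    exact (S.isGlobalFlow_Φ.deriv s p).hasDerivWithinAt⟩⟩

theorem exists_isOrbit_iff {p : CircleCoord} {t : ℝ} :
    (∃ c, S.IsOrbit p t c) ↔ S.Stays p t := by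
  refine ⟨fun ⟨c, hc⟩ s hs => ?_, fun h => ⟨_, h.isOrbit⟩⟩
  rw [← hc.eq_Φ hs]
  exact (hc.2 s hs).1

theorem Stays.flow_eq {p : CircleCoord} {t : ℝ} (h : S.Stays p t) (ht : 0 ≤ t) :
    S.flow p t = S.Φ t p := by
  have h' : ∃ c, S.IsOrbit p t c := ⟨_, h.isOrbit⟩
  rw [flow, dif_pos h']
  exact h'.choose_spec.eq_Φ ⟨ht, le_rfl⟩

theorem stays_add_period {p : CircleCoord} {t : ℝ} (n : ℤ) :
    S.Stays (p + (0, n * (2 * Real.pi))) t ↔ S.Stays p t := by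
  simp [Stays, Φ_periodic]

/-- Rescaling time to `[0, 1]` removes the dependence of the quantifier's range on `t`, so that
`Stays` can be handled as a closed condition, and its interior version as an open one, in `(t, p)`.
-/
theorem stays_iff_scaled {p : CircleCoord} {t : ℝ} (ht : 0 ≤ t) :
    S.Stays p t ↔ ∀ r ∈ Icc (0 : ℝ) 1, (S.Φ (r * t) p).1 ∈ S.M := by
  refine ⟨fun h r hr => h _ ⟨mul_nonneg hr.1 ht, mul_le_of_le_one_left ht hr.2⟩, fun h s hs => ?_⟩
  rcases ht.eq_or_lt with rfl | ht
  · have : s = 0 := le_antisymm hs.2 hs.1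
    simpa [this] using h 0 (by simp)
  · have := h (s / t) ⟨div_nonneg hs.1 ht.le, (div_le_one ht).2 hs.2⟩
    rwa [div_mul_cancel₀ _ ht.ne'] at this

theorem isClosed_stays :
    IsClosed {q : ℝ × CircleCoord | 0 ≤ q.1 ∧ S.Stays q.2 q.1} := by
  have : {q : ℝ × CircleCoord | 0 ≤ q.1 ∧ S.Stays q.2 q.1} =
      {q | 0 ≤ q.1} ∩ ⋂ r ∈ Icc (0 : ℝ) 1, {q | (S.Φ (r * q.1) q.2).1 ∈ S.M} := by
    ext q
    simp only [mem_ofPred_eq, mem_inter_iff, mem_iInter]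
    exact and_congr_right fun h => stays_iff_scaled h
  rw [this]
  refine (isClosed_le continuous_const continuous_fst).inter
    (isClosed_biInter fun r _ => S.isCompact.isClosed.preimage ?_)
  exact (S.continuous_Φ.comp ((continuous_fst.const_mul r).prodMk continuous_snd)).fst

open Filter Topology in
theorem eventually_stays_interior {p : CircleCoord} {t : ℝ}
    (h : ∀ s ∈ Icc 0 t, (S.Φ s p).1 ∈ interior S.M) (ht : 0 ≤ t) :
    ∀ᶠ q : ℝ × CircleCoord in 𝓝 (t, p), 0 ≤ q.1 → ∀ s ∈ Icc 0 q.1, (S.Φ s q.2).1 ∈ interior S.M := by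
  have h1 : ∀ᶠ q : ℝ × CircleCoord in 𝓝 (t, p), ∀ r ∈ Icc (0 : ℝ) 1,
      (S.Φ (r * q.1) q.2).1 ∈ interior S.M := by
    refine isCompact_Icc.eventually_forall_of_forall_eventually fun r hr => ?_
    have hc : Continuous fun z : (ℝ × CircleCoord) × ℝ => (S.Φ (z.2 * z.1.1) z.1.2).1 :=
      (S.continuous_Φ.comp (by fun_prop :
        Continuous fun z : (ℝ × CircleCoord) × ℝ => (z.2 * z.1.1, z.1.2))).fst
    exact hc.continuousAt.eventually (isOpen_interior.mem_nhds
      (h _ ⟨mul_nonneg hr.1 ht, mul_le_of_le_one_left ht hr.2⟩))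
  filter_upwards [h1] with q hq h0 s hs
  rcases h0.eq_or_lt with h0 | h0
  · have : s = 0 := le_antisymm (hs.2.trans h0.ge) hs.1
    simpa [this] using hq 0 (by simp)
  · have := hq (s / q.1) ⟨div_nonneg hs.1 h0.le, (div_le_one h0).2 hs.2⟩
    rwa [div_mul_cancel₀ _ h0.ne'] at this

/-- The exponential map is written with the principal argument, whereas angles here are arbitrary
reals; they differ by a period. -/
theorem exists_arg_eq (θ : ℝ) {t : ℝ} (ht : 0 < t) :
    ∃ n : ℤ, (t * Complex.exp (Complex.I * θ)).arg = θ + n * (2 * Real.pi) := by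
  rw [mul_comm Complex.I, Complex.exp_mul_I, Complex.arg_mul_cos_add_sin_mul_I_eq_toIocMod ht]
  refine ⟨-toIocDiv Real.two_pi_pos (-Real.pi) θ, ?_⟩
  rw [toIocMod, zsmul_eq_mul]
  push_cast
  ring

theorem norm_polar (θ : ℝ) {t : ℝ} (ht : 0 ≤ t) : ‖(t * Complex.exp (Complex.I * θ) : ℂ)‖ = t := by
  rw [norm_mul, mul_comm Complex.I, Complex.norm_exp_ofReal_mul_I, mul_one, Complex.norm_real,
    Real.norm_of_nonneg ht]

theorem Stays.polar_mem {x : Plane} {θ t : ℝ} (h : S.Stays (x, θ) t) (ht : 0 < t) :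
    (t * Complex.exp (Complex.I * θ) : ℂ) ∈ S.expDomain x ∧
      S.expMap x (t * Complex.exp (Complex.I * θ)) = (S.Φ t (x, θ)).1 := by
  obtain ⟨n, hn⟩ := exists_arg_eq θ ht
  have hp : ((x, θ + n * (2 * Real.pi)) : CircleCoord) = (x, θ) + (0, n * (2 * Real.pi)) := by simp
  have h' : S.Stays (x, θ + n * (2 * Real.pi)) t := by rwa [hp, stays_add_period]
  constructor
  · rw [expDomain, mem_ofPred_eq, norm_polar θ ht.le, hn]
    exact ⟨_, h'.isOrbit⟩
  · rw [expMap, norm_polar θ ht.le, hn, h'.flow_eq ht.le, hp, Φ_periodic]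
    simp

/-- The time is the norm of a vector in the domain of the exponential map, hence the norm of a value
of the inverse map, which is continuous on the compact set `M`. Nonpositive times satisfy the bound
because of the maximum with `0`. -/
theorem IsSimple.exists_time_bound_at (hS : S.IsSimple) {x : Plane} (hx : x ∈ S.M) :
    ∃ C, ∀ θ t, S.Stays (x, θ) t → t ≤ C := by
  obtain ⟨hb, -, L, hL, hLe⟩ := hS.2 x hx
  obtain ⟨C, hC⟩ := S.isCompact.exists_bound_of_continuousOn hL.continuousOn
  refine ⟨max C 0, fun θ t h => ?_⟩
  rcases le_or_gt t 0 with ht | ht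
  · exact ht.trans (le_max_right _ _)
  · have hm := (h.polar_mem ht).1
    have := hC _ (hb.mapsTo hm)
    rw [hLe _ hm, norm_polar θ ht.le] at this
    exact this.trans (le_max_left _ _)

/-- The fundamental part of the circle bundle over `M`. -/
def fundamentalSM (S : RiemannianSurface) : Set CircleCoord := S.M ×ˢ Icc 0 (2 * Real.pi)

theorem isCompact_fundamentalSM : IsCompact S.fundamentalSM := S.isCompact.prod isCompact_Icc

theorem exists_mem_fundamentalSM {p : CircleCoord} (hp : p.1 ∈ S.M) :
    ∃ n : ℤ, p + (0, n * (2 * Real.pi)) ∈ S.fundamentalSM := by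
  refine ⟨-toIcoDiv Real.two_pi_pos 0 p.2, by simpa using hp, ?_⟩
  have := toIcoMod_mem_Ico Real.two_pi_pos 0 p.2
  rw [toIcoMod, zsmul_eq_mul, zero_add] at this
  have h2 : (p + (0, ((-toIcoDiv Real.two_pi_pos 0 p.2 : ℤ) : ℝ) * (2 * Real.pi))).2 =
    p.2 - (toIcoDiv Real.two_pi_pos 0 p.2) * (2 * Real.pi) := by
    rw [Prod.snd_add]
    push_cast
    ring
  rw [h2]
  exact Ico_subset_Icc_self this

/-- Cantor's intersection theorem: geodesics of unbounded length would produce, in a decreasing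
sequence of compact sets, one initial condition whose geodesic never leaves `M`, against the bound
at its base point. -/
theorem IsSimple.exists_time_bound (hS : S.IsSimple) :
    ∃ T : ℝ, 0 < T ∧ ∀ p t, S.Stays p t → t ≤ T := by
  by_contra! hcon
  let A : ℕ → Set CircleCoord := fun m => S.fundamentalSM ∩ {p | S.Stays p m}
  have hcl : ∀ m : ℕ, IsClosed {p : CircleCoord | S.Stays p m} := fun m => by
    have := (isClosed_stays (S := S)).preimage
      (f := fun p : CircleCoord => ((m : ℝ), p)) (by fun_prop)
    convert this using 1
    ext p; simp
  have hne : ∀ m, (A m).Nonempty := fun m => by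
    obtain ⟨p, t, h, ht⟩ := hcon (m + 1) (by positivity)
    have hm : (m : ℝ) ≤ t := by linarith
    have h1 := h.mono hm
    obtain ⟨n, hn⟩ := exists_mem_fundamentalSM (h1.mem m.cast_nonneg)
    exact ⟨_, hn, (stays_add_period n).2 h1⟩
  obtain ⟨p, hp⟩ := IsCompact.nonempty_iInter_of_sequence_nonempty_isCompact_isClosed A
    (fun m => inter_subset_inter_right _ fun p (hp : S.Stays p _) => hp.mono (by push_cast; linarith))
    hne (isCompact_fundamentalSM.inter_right (hcl 0))
    (fun m => isCompact_fundamentalSM.isClosed.inter (hcl m))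
  rw [mem_iInter] at hp
  obtain ⟨C, hC⟩ := hS.exists_time_bound_at (x := p.1) (hp 0).1.1
  obtain ⟨m, hm⟩ := exists_nat_gt C
  exact absurd (hC p.2 m (hp m).2) (not_le.2 hm)

theorem IsSimple.bddAbove_stays (hS : S.IsSimple) (p : CircleCoord) :
    BddAbove {t | 0 ≤ t ∧ S.Stays p t} := by
  obtain ⟨T, -, hT⟩ := hS.exists_time_bound
  exact ⟨T, fun t ht => hT p t ht.2⟩

theorem exitTime_eq (p : CircleCoord) : S.exitTime p = sSup {t | 0 ≤ t ∧ S.Stays p t} := by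
  simp only [exitTime, exists_isOrbit_iff]

theorem stays_zero {p : CircleCoord} (hp : p.1 ∈ S.M) : S.Stays p 0 := fun s hs => by
  have : s = 0 := le_antisymm hs.2 hs.1
  simpa [this, Φ_zero] using hp

/-- The set of admissible times is closed, bounded and nonempty, so the supremum that defines the
exit time is attained. -/
theorem IsSimple.stays_iff (hS : S.IsSimple) {p : CircleCoord} (hp : p.1 ∈ S.M) {t : ℝ}
    (ht : 0 ≤ t) : S.Stays p t ↔ t ≤ S.exitTime p := by
  rw [exitTime_eq]
  refine ⟨fun h => le_csSup (hS.bddAbove_stays p) ⟨ht, h⟩, fun h => ?_⟩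
  have hcl : IsClosed {t : ℝ | 0 ≤ t ∧ S.Stays p t} :=
    (isClosed_stays (S := S)).preimage (f := fun t : ℝ => (t, p)) (by fun_prop)
  exact (hcl.csSup_mem ⟨0, le_rfl, stays_zero hp⟩ (hS.bddAbove_stays p)).2.mono h

theorem exitTime_nonneg (p : CircleCoord) : 0 ≤ S.exitTime p :=
  Real.sSup_nonneg fun _ ht => ht.1

theorem exitTime_add_period (p : CircleCoord) (n : ℤ) :
    S.exitTime (p + (0, n * (2 * Real.pi))) = S.exitTime p := by
  simp only [exitTime_eq, stays_add_period]

end RiemannianSurface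

/-! ### Geodesics near the boundary -/

-- A point that is also a local minimum by the second derivative test has the function constant
-- around it, contradicting a positive second derivative.
open Filter Topology in
theorem not_isLocalMax_of_deriv_deriv_pos {g : ℝ → ℝ} {s : ℝ} (hc : ContinuousAt g s)
    (h2 : 0 < deriv (deriv g) s) : ¬ IsLocalMax g s := by
  intro hmax
  have h1 := hmax.deriv_eq_zero
  have hmin := isLocalMin_of_deriv_deriv_pos h2 h1 hc
  have heq : g =ᶠ[𝓝 s] fun _ => g s := by
    filter_upwards [hmax, hmin] with r h1 h2 using le_antisymm h1 h2
  have : deriv g =ᶠ[𝓝 s] fun _ => 0 := by simpa using heq.deriv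
  rw [this.deriv_eq] at h2
  simp at h2

namespace RiemannianSurface

variable {S : RiemannianSurface} {ρ : Plane → ℝ}

theorem mem_iff_of_isDefiningFunction (hρ : IsDefiningFunction S.M ρ) {x : Plane} :
    x ∈ S.M ↔ ρ x ≤ 0 := by
  rw [hρ.2.1]; rfl

/-- An interior zero of `ρ` would be a local maximum, hence critical, which regularity of the value
`0` forbids. -/
theorem mem_interior_iff (hρ : IsDefiningFunction S.M ρ) {x : Plane} :
    x ∈ interior S.M ↔ ρ x < 0 := by
  constructor
  · intro hx
    refine lt_of_le_of_ne ((mem_iff_of_isDefiningFunction hρ).1 (interior_subset hx)) fun h0 => ?_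
    refine hρ.2.2 x h0 (IsLocalMax.fderiv_eq_zero ?_)
    filter_upwards [isOpen_interior.mem_nhds hx] with y hy
    rw [h0]
    exact (mem_iff_of_isDefiningFunction hρ).1 (interior_subset hy)
  · intro hx
    refine mem_interior.2 ⟨{y | ρ y < 0}, fun y hy => ?_,
      isOpen_lt hρ.1.continuous continuous_const, hx⟩
    exact (mem_iff_of_isDefiningFunction hρ).2 (le_of_lt hy)

/-- The derivative of the defining function along the geodesic flow. -/
def normalSpeed (S : RiemannianSurface) (ρ : Plane → ℝ) (p : CircleCoord) : ℝ :=
  fderiv ℝ ρ p.1 (S.X p).1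

theorem contDiff_normalSpeed (hρ : ContDiff ℝ ∞ ρ) : ContDiff ℝ ∞ (S.normalSpeed ρ) :=
  ((hρ.fderiv_right (m := ∞) (by simp)).comp contDiff_fst).clm_apply S.contDiff_X.fst

theorem hasDerivAt_defining (hρ : ContDiff ℝ ∞ ρ) {p : CircleCoord} {s : ℝ}
    (hs : S.Φ s p ∈ S.geodesicRegion) :
    HasDerivAt (fun s => ρ (S.Φ s p).1) (S.normalSpeed ρ (S.Φ s p)) s := by
  have h1 := S.isGlobalFlow_Φ.deriv s p
  rw [S.cutX_eq hs] at h1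
  have h2 := (ContinuousLinearMap.fst ℝ Plane ℝ).hasFDerivAt.comp_hasDerivAt s h1
  exact ((hρ.differentiable (by simp)) _).hasFDerivAt.comp_hasDerivAt s h2

theorem eventually_mem_geodesicRegion {p : CircleCoord} {s : ℝ} (hs : S.Φ s p ∈ S.geodesicRegion) :
    ∀ᶠ r in nhds s, S.Φ r p ∈ S.geodesicRegion :=
  (S.isGlobalFlow_Φ.deriv s p).continuousAt.eventually
    (S.isOpen_geodesicRegion.mem_nhds hs)

theorem deriv_deriv_defining (hρ : ContDiff ℝ ∞ ρ) {p : CircleCoord} {s : ℝ}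
    (hs : S.Φ s p ∈ S.geodesicRegion) :
    deriv (deriv fun s => ρ (S.Φ s p).1) s =
      fderiv ℝ (S.normalSpeed ρ) (S.Φ s p) (S.X (S.Φ s p)) := by
  have h : (deriv fun s => ρ (S.Φ s p).1) =ᶠ[nhds s] fun r => S.normalSpeed ρ (S.Φ r p) := by
    filter_upwards [eventually_mem_geodesicRegion hs] with r hr
    exact (hasDerivAt_defining hρ hr).deriv
  rw [h.deriv_eq]
  have h1 := S.isGlobalFlow_Φ.deriv s p
  rw [S.cutX_eq hs] at h1
  exact ((((contDiff_normalSpeed hρ).differentiable (by simp)) _).hasFDerivAt.comp_hasDerivAt s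
    h1).deriv

/-- The convexity inequality in the definition of `StrictlyConvexBoundary`. -/
def IsConvexDefining (S : RiemannianSurface) (ρ : Plane → ℝ) : Prop :=
  IsDefiningFunction S.M ρ ∧ ∀ p : CircleCoord, ρ p.1 = 0 → S.normalSpeed ρ p = 0 →
    0 < fderiv ℝ (S.normalSpeed ρ) p (S.X p)

theorem IsSimple.exists_isConvexDefining (hS : S.IsSimple) : ∃ ρ, S.IsConvexDefining ρ := hS.1

open Filter Topology

/-- Touching the boundary at an intermediate time would be a local maximum of `ρ` along the
geodesic, thus a tangency, where convexity makes the second derivative positive. -/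
theorem Stays.interior_of_mem_Ioo (hρ : S.IsConvexDefining ρ) {p : CircleCoord} {t s : ℝ}
    (h : S.Stays p t) (hs : s ∈ Ioo 0 t) : (S.Φ s p).1 ∈ interior S.M := by
  have hM := h s (Ioo_subset_Icc_self hs)
  have hreg := S.mem_geodesicRegion hM
  rw [mem_interior_iff hρ.1]
  refine lt_of_le_of_ne ((mem_iff_of_isDefiningFunction hρ.1).1 hM) fun h0 => ?_
  have hmax : IsLocalMax (fun s => ρ (S.Φ s p).1) s := by
    filter_upwards [Icc_mem_nhds hs.1 hs.2] with r hr
    rw [h0]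
    exact (mem_iff_of_isDefiningFunction hρ.1).1 (h r hr)
  have hd := hasDerivAt_defining hρ.1.1 hreg
  have h1 := hmax.hasDerivAt_eq_zero hd
  refine not_isLocalMax_of_deriv_deriv_pos hd.continuousAt ?_ hmax
  rw [deriv_deriv_defining hρ.1.1 hreg]
  exact hρ.2 _ h0 h1

/-- A geodesic that starts on the boundary and remains in `M` enters transversally: `ρ` is negative
right afterwards, which excludes a positive speed, and by convexity also a tangency. -/
theorem Stays.normalSpeed_neg (hρ : S.IsConvexDefining ρ) {p : CircleCoord} {t : ℝ}
    (h : S.Stays p t) (ht : 0 < t) (h0 : ρ p.1 = 0) : S.normalSpeed ρ p < 0 := by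
  have hM := h.mem ht.le
  have hreg : S.Φ 0 p ∈ S.geodesicRegion := by rw [Φ_zero]; exact S.mem_geodesicRegion hM
  have hd := hasDerivAt_defining hρ.1.1 hreg
  have hneg : ∀ s ∈ Ioo 0 t, ρ (S.Φ s p).1 < 0 := fun s hs =>
    (mem_interior_iff hρ.1).1 (h.interior_of_mem_Ioo hρ hs)
  by_contra! hcon
  rcases hcon.eq_or_lt with hz | hpos
  · have h2 : 0 < deriv (deriv fun s => ρ (S.Φ s p).1) 0 := by
      rw [deriv_deriv_defining hρ.1.1 hreg, Φ_zero]
      exact hρ.2 _ h0 hz.symm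
    have hmin := isLocalMin_of_deriv_deriv_pos h2 (by rw [hd.deriv, Φ_zero, ← hz]) hd.continuousAt
    have h3 : ∀ᶠ s in 𝓝[>] (0 : ℝ), ρ (S.Φ 0 p).1 ≤ ρ (S.Φ s p).1 := hmin.filter_mono
      nhdsWithin_le_nhds
    obtain ⟨s, hs1, hs2⟩ := (h3.and (Ioo_mem_nhdsGT ht)).exists
    rw [Φ_zero, h0] at hs1
    exact absurd (hneg s hs2) (not_lt.2 hs1)
  · rw [Φ_zero] at hd
    have h3 := (hasDerivAt_iff_tendsto_slope.1 hd).eventually (lt_mem_nhds hpos)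
    have h4 : ∀ᶠ s in 𝓝[>] (0 : ℝ), 0 < slope (fun s => ρ (S.Φ s p).1) 0 s :=
      h3.filter_mono (nhdsWithin_mono _ fun s hs => ne_of_gt hs)
    obtain ⟨s, hs1, hs2⟩ := (h4.and (Ioo_mem_nhdsGT ht)).exists
    rw [slope_def_field, Φ_zero, h0, sub_zero, sub_zero] at hs1
    have := hneg s hs2
    exact absurd (div_neg_of_neg_of_pos this hs2.1) (not_lt.2 hs1.le)

/-- Geodesics issued from the same point in a nearby direction stay in `M` almost as long. -/
theorem Stays.eventually_angle (hρ : S.IsConvexDefining ρ) {x : Plane} {θ t s : ℝ}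
    (h : S.Stays (x, θ) t) (hs : s ∈ Ioo 0 t) : ∀ᶠ θ' in 𝓝 θ, S.Stays (x, θ') s := by
  have ht : 0 < t := hs.1.trans hs.2
  have hx : x ∈ S.M := h.mem ht.le
  have hint : ∀ r ∈ Ioc 0 s, (S.Φ r (x, θ)).1 ∈ interior S.M := fun r hr =>
    h.interior_of_mem_Ioo hρ ⟨hr.1, hr.2.trans_lt hs.2⟩
  -- Short times are separate because `x` may lie on the boundary. There, transversality persists
  -- for nearby directions and makes `ρ` decrease from `0`.
  have hstart : ∃ ε > 0, ∀ᶠ θ' in 𝓝 θ, ∀ r ∈ Icc 0 ε, (S.Φ r (x, θ')).1 ∈ S.M := by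
    rcases ((mem_iff_of_isDefiningFunction hρ.1).1 hx).lt_or_eq with hlt | h0
    · have hev : ∀ᶠ q : ℝ × ℝ in 𝓝 (0, θ), ρ (S.Φ q.1 (x, q.2)).1 < 0 := by
        have hc : Continuous fun q : ℝ × ℝ => ρ (S.Φ q.1 (x, q.2)).1 :=
          hρ.1.1.continuous.comp (S.continuous_Φ.comp
            (by fun_prop : Continuous fun q : ℝ × ℝ => (q.1, (x, q.2)))).fst
        exact hc.continuousAt.eventually_lt continuousAt_const (by simpa [Φ_zero] using hlt)
      obtain ⟨ε, hε, hball⟩ := Metric.eventually_nhds_iff.1 hev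
      refine ⟨ε / 2, by positivity, Metric.eventually_nhds_iff.2 ⟨ε, hε, fun θ' hθ' r hr => ?_⟩⟩
      refine (mem_iff_of_isDefiningFunction hρ.1).2 (hball (y := (r, θ')) ?_).le
      rw [Prod.dist_eq, max_lt_iff]
      refine ⟨?_, hθ'⟩
      rw [Real.dist_eq, sub_zero, abs_of_nonneg hr.1]
      linarith [hr.2]
    · have hneg := h.normalSpeed_neg hρ ht h0
      have hev : ∀ᶠ q : ℝ × ℝ in 𝓝 (0, θ), S.normalSpeed ρ (S.Φ q.1 (x, q.2)) < 0 ∧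
          S.Φ q.1 (x, q.2) ∈ S.geodesicRegion := by
        have hc : Continuous fun q : ℝ × ℝ => S.Φ q.1 (x, q.2) :=
          S.continuous_Φ.comp (by fun_prop : Continuous fun q : ℝ × ℝ => (q.1, (x, q.2)))
        refine (((contDiff_normalSpeed hρ.1.1).continuous.comp hc).continuousAt.eventually_lt
          continuousAt_const (by simpa [Φ_zero] using hneg)).and
          (hc.continuousAt.eventually (S.isOpen_geodesicRegion.mem_nhds ?_))
        change S.Φ 0 (x, θ) ∈ _
        rw [Φ_zero]
        exact S.mem_geodesicRegion hx
      obtain ⟨ε, hε, hball⟩ := Metric.eventually_nhds_iff.1 hev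
      refine ⟨ε / 2, by positivity, Metric.eventually_nhds_iff.2 ⟨ε, hε, fun θ' hθ' r hr => ?_⟩⟩
      have hin : ∀ r ∈ Icc 0 (ε / 2), S.normalSpeed ρ (S.Φ r (x, θ')) < 0 ∧
          S.Φ r (x, θ') ∈ S.geodesicRegion := fun r hr => by
        refine hball (y := (r, θ')) ?_
        rw [Prod.dist_eq, max_lt_iff]
        refine ⟨?_, hθ'⟩
        rw [Real.dist_eq, sub_zero, abs_of_nonneg hr.1]
        linarith [hr.2]
      have hanti : AntitoneOn (fun r => ρ (S.Φ r (x, θ')).1) (Icc 0 (ε / 2)) := by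
        refine antitoneOn_of_deriv_nonpos (convex_Icc _ _)
          (fun r hr => (hasDerivAt_defining hρ.1.1 (hin r hr).2).continuousAt.continuousWithinAt)
          (fun r hr => (hasDerivAt_defining hρ.1.1
            (hin r (interior_subset hr)).2).differentiableAt.differentiableWithinAt)
          (fun r hr => ?_)
        rw [(hasDerivAt_defining hρ.1.1 (hin r (interior_subset hr)).2).deriv]
        exact (hin r (interior_subset hr)).1.le
      have := hanti ⟨le_rfl, by positivity⟩ hr hr.1
      simp only [Φ_zero, h0] at this
      exact (mem_iff_of_isDefiningFunction hρ.1).2 this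
  obtain ⟨ε, hε, hstart⟩ := hstart
  -- From time `ε` to `s < t` the original geodesic lies in the open interior, so compactness of the
  -- time interval suffices.
  have hrest : ∀ᶠ θ' in 𝓝 θ, ∀ r ∈ Icc ε s, (S.Φ r (x, θ')).1 ∈ interior S.M := by
    refine isCompact_Icc.eventually_forall_of_forall_eventually fun r hr => ?_
    have hc : Continuous fun z : ℝ × ℝ => (S.Φ z.2 (x, z.1)).1 :=
      (S.continuous_Φ.comp (by fun_prop : Continuous fun z : ℝ × ℝ => (z.2, (x, z.1)))).fst
    exact hc.continuousAt.eventually (isOpen_interior.mem_nhds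
      (hint r ⟨hε.trans_le hr.1, hr.2⟩))
  filter_upwards [hstart, hrest] with θ' h1 h2 r hr
  rcases le_total r ε with h3 | h3
  · exact h1 r ⟨hr.1, h3⟩
  · exact interior_subset (h2 r ⟨h3, hr.2⟩)

theorem IsSimple.exists_leaves (hS : S.IsSimple) {p : CircleCoord} (hp : p.1 ∈ S.M) {t : ℝ}
    (ht : S.exitTime p < t) : ∃ s ∈ Ioo (S.exitTime p) t, (S.Φ s p).1 ∉ S.M := by
  by_contra! hcon
  have h0 := exitTime_nonneg (S := S) p
  have h1 := (hS.stays_iff hp h0).2 le_rfl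
  have h2 : S.Stays p ((S.exitTime p + t) / 2) := fun s hs => by
    rcases le_or_gt s (S.exitTime p) with h | h
    · exact h1 s ⟨hs.1, h⟩
    · exact hcon s ⟨h, by linarith [hs.2]⟩
  have := (hS.stays_iff hp (by linarith)).1 h2
  linarith

end RiemannianSurface

/-! ### Jacobi fields -/

namespace RiemannianSurface

variable (S : RiemannianSurface)

/-- The flow as a function of time and initial condition. -/
def flowMap (q : ℝ × CircleCoord) : CircleCoord := S.Φ q.1 q.2

theorem contDiff_flowMap : ContDiff ℝ ∞ S.flowMap := S.contDiff_Φ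

/-- The differential of the flow at time `q.1`, applied to a vector field at the initial point. -/
def flowDeriv (w : CircleCoord → CircleCoord) (q : ℝ × CircleCoord) : CircleCoord :=
  fderiv ℝ S.flowMap q (0, w q.2)

theorem contDiff_flowDeriv {w : CircleCoord → CircleCoord} (hw : ContDiff ℝ ∞ w) :
    ContDiff ℝ ∞ (S.flowDeriv w) :=
  (S.contDiff_flowMap.fderiv_right (by simp)).clm_apply
    (contDiff_const.prodMk (hw.comp contDiff_snd))

theorem hasFDerivAt_Φ (t : ℝ) (p : CircleCoord) : HasFDerivAt (S.Φ t)
    ((fderiv ℝ S.flowMap (t, p)).comp (ContinuousLinearMap.inr ℝ ℝ CircleCoord)) p :=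
  ((S.contDiff_flowMap.differentiable (by simp)) (t, p)).hasFDerivAt.comp p
    (hasFDerivAt_prodMk_right t p)

theorem flowDeriv_eq (w : CircleCoord → CircleCoord) (t : ℝ) (p : CircleCoord) :
    S.flowDeriv w (t, p) = fderiv ℝ (S.Φ t) p (w p) := by
  rw [(S.hasFDerivAt_Φ t p).fderiv]
  simp [flowDeriv]

theorem flowDeriv_zero (w : CircleCoord → CircleCoord) (p : CircleCoord) :
    S.flowDeriv w (0, p) = w p := by
  rw [flowDeriv_eq]
  have : S.Φ 0 = id := funext S.Φ_zero
  rw [this, fderiv_id]; rfl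

theorem fderiv_flowMap_time (q : ℝ × CircleCoord) :
    fderiv ℝ S.flowMap q (1, 0) = S.cutX (S.flowMap q) := by
  have h1 := ((S.contDiff_flowMap.differentiable (by simp)) q).hasFDerivAt.comp_hasDerivAt
    (f := fun t : ℝ => (t, q.2)) q.1
    ((hasDerivAt_id q.1).prodMk (hasDerivAt_const q.1 q.2))
  exact h1.unique (S.isGlobalFlow_Φ.deriv q.1 q.2)

theorem hasDerivAt_time {F : Type*} [NormedAddCommGroup F] [NormedSpace ℝ F]
    {f : ℝ × CircleCoord → F} (hf : Differentiable ℝ f) (t : ℝ) (p : CircleCoord) :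
    HasDerivAt (fun s => f (s, p)) (fderiv ℝ f (t, p) (1, 0)) t :=
  (hf (t, p)).hasFDerivAt.comp_hasDerivAt (f := fun s : ℝ => (s, p)) t
    ((hasDerivAt_id t).prodMk (hasDerivAt_const t p))

/-- The variational equation, obtained by exchanging the time and space derivatives of the jointly
smooth flow. -/
theorem hasDerivAt_flowDeriv (w : CircleCoord → CircleCoord) (t : ℝ)
    (p : CircleCoord) : HasDerivAt (fun s => S.flowDeriv w (s, p))
      (fderiv ℝ S.cutX (S.Φ t p) (S.flowDeriv w (t, p))) t := by
  have hd : ContDiff ℝ ∞ (fderiv ℝ S.flowMap) := S.contDiff_flowMap.fderiv_right (by simp)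
  have h1 := (hasDerivAt_time (hd.differentiable (by simp)) t p).clm_apply
    (hasDerivAt_const t ((0, w p) : ℝ × CircleCoord))
  have hsymm : IsSymmSndFDerivAt ℝ S.flowMap (t, p) :=
    S.contDiff_flowMap.contDiffAt.isSymmSndFDerivAt (by
      simpa using WithTop.coe_le_coe.2 (le_top (a := (2 : ℕ∞))))
  have h2 : HasFDerivAt (fun q => fderiv ℝ S.flowMap q (1, 0))
      ((fderiv ℝ S.cutX (S.flowMap (t, p))).comp (fderiv ℝ S.flowMap (t, p))) (t, p) := by
    simp only [fderiv_flowMap_time]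
    exact ((S.contDiff_cutX.differentiable (by simp)) _).hasFDerivAt.comp _
      ((S.contDiff_flowMap.differentiable (by simp)) _).hasFDerivAt
  have h3 : HasFDerivAt (fun q => fderiv ℝ S.flowMap q (1, 0))
      ((fderiv ℝ (fderiv ℝ S.flowMap) (t, p)).flip (1, 0)) (t, p) := by
    have := ((hd.differentiable (by simp)) (t, p)).hasFDerivAt.clm_apply
      (hasFDerivAt_const ((1, 0) : ℝ × CircleCoord) (t, p))
    simpa using this
  have h4 := congrArg (fun A : (ℝ × CircleCoord) →L[ℝ] CircleCoord => A (0, w p)) (h2.unique h3)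
  simp only [ContinuousLinearMap.comp_apply, ContinuousLinearMap.flip_apply] at h4
  rw [hsymm.eq] at h4
  simpa [flowDeriv, ← h4, flowMap] using h1

theorem fderiv_cutX_eq {p : CircleCoord} (hp : p ∈ S.geodesicRegion) :
    fderiv ℝ S.cutX p = fderiv ℝ S.X p := by
  refine Filter.EventuallyEq.fderiv_eq ?_
  filter_upwards [S.isOpen_geodesicRegion.mem_nhds hp] with q hq using S.cutX_eq hq

/-- The components of the differential of the flow in the frame `(X, X_⊥, V)` solve the Jacobi
system. -/
theorem jacobi_system {w : CircleCoord → CircleCoord} (hw : ContDiff ℝ ∞ w) {t : ℝ}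
    {p : CircleCoord} (ht : S.Φ t p ∈ S.geodesicRegion) :
    HasDerivAt (fun s => S.coordX (S.Φ s p) (S.flowDeriv w (s, p))) 0 t ∧
    HasDerivAt (fun s => S.coordY (S.Φ s p) (S.flowDeriv w (s, p)))
      (-S.coordV (S.Φ t p) (S.flowDeriv w (t, p))) t ∧
    HasDerivAt (fun s => S.coordV (S.Φ s p) (S.flowDeriv w (s, p)))
      (S.curvature (S.Φ t p).1 * S.coordY (S.Φ t p) (S.flowDeriv w (t, p))) t := by
  have hΦ : ContDiff ℝ ∞ (fun s : ℝ => S.Φ s p) :=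
    S.contDiff_Φ.comp (contDiff_id.prodMk contDiff_const)
  have hξ : ContDiff ℝ ∞ (fun s : ℝ => S.flowDeriv w (s, p)) :=
    (S.contDiff_flowDeriv hw).comp (contDiff_id.prodMk contDiff_const)
  have hα := ((S.contDiff_coordX hΦ hξ).differentiable (by simp) t).hasDerivAt
  have ha := ((S.contDiff_coordY hΦ hξ).differentiable (by simp) t).hasDerivAt
  have hB := ((S.contDiff_coordV hΦ hξ).differentiable (by simp) t).hasDerivAt
  set α' := deriv (fun s => S.coordX (S.Φ s p) (S.flowDeriv w (s, p))) t
  set a' := deriv (fun s => S.coordY (S.Φ s p) (S.flowDeriv w (s, p))) t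
  set B' := deriv (fun s => S.coordV (S.Φ s p) (S.flowDeriv w (s, p))) t
  have hd := S.isGlobalFlow_Φ.deriv t p
  rw [S.cutX_eq ht] at hd
  have hX := ((S.contDiff_X.differentiable (by simp)) _).hasFDerivAt.comp_hasDerivAt t hd
  have hY := ((S.contDiff_Xperp.differentiable (by simp)) _).hasFDerivAt.comp_hasDerivAt t hd
  have h1 := S.hasDerivAt_flowDeriv w t p
  rw [S.fderiv_cutX_eq ht] at h1
  have h2 := ((hα.smul hX).add (ha.smul hY)).add
    (hB.smul_const ((0, 1) : CircleCoord))
  have h3 : HasDerivAt (fun s => S.flowDeriv w (s, p)) _ t :=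
    h2.congr_of_eventuallyEq (Filter.Eventually.of_forall fun s => S.coord_expansion _ _)
  have h4 := h1.unique h3
  have h5 := congrArg (fderiv ℝ S.X (S.Φ t p)) (S.coord_expansion (S.Φ t p) (S.flowDeriv w (t, p)))
  rw [h4] at h5
  set α := S.coordX (S.Φ t p) (S.flowDeriv w (t, p))
  set a := S.coordY (S.Φ t p) (S.flowDeriv w (t, p))
  set B := S.coordV (S.Φ t p) (S.flowDeriv w (t, p))
  -- Two expressions for the time derivative are compared: the variational equation and the product
  -- rule in the moving frame. The brackets `[X, V] = X_⊥` and `[X, X_⊥] = -κ V` are what remains.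
  have h6 : α' • S.X (S.Φ t p) + (a' + B) • S.Xperp (S.Φ t p) +
      (B' - S.curvature (S.Φ t p).1 * a) • ((0, 1) : CircleCoord) = 0 := by
    simp only [map_add, map_smul, fderiv_X_V, fderiv_Xperp_X, Function.comp] at h5
    have h7 : ((0, S.curvature (S.Φ t p).1) : CircleCoord) =
      S.curvature (S.Φ t p).1 • ((0, 1) : CircleCoord) := by simp
    rw [h7] at h5
    rw [← sub_eq_zero] at h5
    rw [← h5]
    module
  obtain ⟨e1, e2, e3⟩ := S.coord_unique h6
  refine ⟨?_, ?_, ?_⟩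
  · rw [← e1]; exact hα
  · rw [← eq_neg_of_add_eq_zero_left e2]; exact ha
  · rw [← sub_eq_zero.1 e3]; exact hB

end RiemannianSurface

/-! ### The Jacobi functions and their angle derivatives -/

namespace RiemannianSurface

variable (S : RiemannianSurface)

/-- The Jacobi function `a`: `a'' + κ a = 0`, `a(0) = 1`, `a'(0) = 0`. -/
def jacA (q : ℝ × CircleCoord) : ℝ := S.coordY (S.flowMap q) (S.flowDeriv S.Xperp q)

/-- The time derivative of `jacA`. -/
def jacA' (q : ℝ × CircleCoord) : ℝ := -S.coordV (S.flowMap q) (S.flowDeriv S.Xperp q)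

/-- The Jacobi function `b`: `b'' + κ b = 0`, `b(0) = 0`, `b'(0) = 1`. -/
def jacB (q : ℝ × CircleCoord) : ℝ := -S.coordY (S.flowMap q) (S.flowDeriv V q)

/-- The time derivative of `jacB`. -/
def jacB' (q : ℝ × CircleCoord) : ℝ := S.coordV (S.flowMap q) (S.flowDeriv V q)

theorem contDiff_V : ContDiff ℝ ∞ V := contDiff_const

theorem contDiff_jacA : ContDiff ℝ ∞ S.jacA :=
  S.contDiff_coordY S.contDiff_flowMap (S.contDiff_flowDeriv S.contDiff_Xperp)

theorem contDiff_jacA' : ContDiff ℝ ∞ S.jacA' :=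
  (S.contDiff_coordV S.contDiff_flowMap (S.contDiff_flowDeriv S.contDiff_Xperp)).neg

theorem contDiff_jacB : ContDiff ℝ ∞ S.jacB :=
  (S.contDiff_coordY S.contDiff_flowMap (S.contDiff_flowDeriv contDiff_V)).neg

theorem contDiff_jacB' : ContDiff ℝ ∞ S.jacB' :=
  S.contDiff_coordV S.contDiff_flowMap (S.contDiff_flowDeriv contDiff_V)

theorem coordX_Xperp (p : CircleCoord) : S.coordX p (S.Xperp p) = 0 := by
  rw [coordX, S.metric_comm, metric_X_Xperp]

theorem coordY_Xperp (p : CircleCoord) : S.coordY p (S.Xperp p) = 1 := S.metric_Xperp_Xperp p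

theorem coordV_Xperp (p : CircleCoord) : S.coordV p (S.Xperp p) = 0 := by
  simp [coordV, coordX_Xperp, coordY_Xperp]

theorem coordX_V (p q : CircleCoord) : S.coordX p (V q) = 0 := by simp [coordX, V, metric]

theorem coordY_V (p q : CircleCoord) : S.coordY p (V q) = 0 := by simp [coordY, V, metric]

theorem coordV_V (p q : CircleCoord) : S.coordV p (V q) = 1 := by
  rw [coordV, coordX_V, coordY_V]; simp [V]

theorem jacA_zero (p : CircleCoord) : S.jacA (0, p) = 1 := by
  simp [jacA, flowMap, flowDeriv_zero, Φ_zero, coordY_Xperp]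

theorem jacA'_zero (p : CircleCoord) : S.jacA' (0, p) = 0 := by
  simp [jacA', flowMap, flowDeriv_zero, Φ_zero, coordV_Xperp]

theorem jacB_zero (p : CircleCoord) : S.jacB (0, p) = 0 := by
  simp [jacB, flowMap, flowDeriv_zero, Φ_zero, coordY_V]

theorem jacB'_zero (p : CircleCoord) : S.jacB' (0, p) = 1 := by
  simp [jacB', flowMap, flowDeriv_zero, Φ_zero, coordV_V]

section

variable {S} {t : ℝ} {p : CircleCoord}

theorem hasDerivAt_jacA (h : S.Φ t p ∈ S.geodesicRegion) :
    HasDerivAt (fun s => S.jacA (s, p)) (S.jacA' (t, p)) t :=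
  (S.jacobi_system S.contDiff_Xperp h).2.1

theorem hasDerivAt_jacA' (h : S.Φ t p ∈ S.geodesicRegion) :
    HasDerivAt (fun s => S.jacA' (s, p)) (-(S.curvature (S.Φ t p).1 * S.jacA (t, p))) t :=
  (S.jacobi_system S.contDiff_Xperp h).2.2.neg

theorem hasDerivAt_jacB (h : S.Φ t p ∈ S.geodesicRegion) :
    HasDerivAt (fun s => S.jacB (s, p)) (S.jacB' (t, p)) t := by
  have := (S.jacobi_system contDiff_V h).2.1.fun_neg
  rwa [neg_neg] at this

theorem hasDerivAt_jacB' (h : S.Φ t p ∈ S.geodesicRegion) :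
    HasDerivAt (fun s => S.jacB' (s, p)) (-(S.curvature (S.Φ t p).1 * S.jacB (t, p))) t := by
  refine (S.jacobi_system contDiff_V h).2.2.congr_deriv ?_
  simp [jacB, flowMap]

theorem Stays.region (h : S.Stays p t) {s : ℝ} (hs : s ∈ Icc 0 t) :
    S.Φ s p ∈ S.geodesicRegion := S.mem_geodesicRegion (h s hs)

theorem eq_of_hasDerivAt_zero {f : ℝ → ℝ} (ht : 0 ≤ t)
    (hf : ∀ s ∈ Icc 0 t, HasDerivAt f 0 s) : f t = f 0 :=
  constant_of_has_deriv_right_zero (fun s hs => (hf s hs).continuousAt.continuousWithinAt)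
    (fun s hs => (hf s (Ico_subset_Icc_self hs)).hasDerivWithinAt) t ⟨ht, le_rfl⟩

theorem abs_sub_le_of_hasDerivAt {f f' : ℝ → ℝ} {C : ℝ} (ht : 0 ≤ t)
    (hf : ∀ s ∈ Icc 0 t, HasDerivAt f (f' s) s) (hC : ∀ s ∈ Icc 0 t, |f' s| ≤ C) :
    |f t - f 0| ≤ C * t := by
  have := Convex.norm_image_sub_le_of_norm_hasDerivWithin_le (s := Icc 0 t)
    (fun s hs => (hf s hs).hasDerivWithinAt) hC (convex_Icc 0 t) ⟨le_rfl, ht⟩ ⟨ht, le_rfl⟩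
  simpa [abs_of_nonneg ht] using this

theorem Stays.flowDeriv_Xperp (h : S.Stays p t) (ht : 0 ≤ t) : S.flowDeriv S.Xperp (t, p) =
    S.jacA (t, p) • S.Xperp (S.Φ t p) - S.jacA' (t, p) • V p := by
  have h0 : S.coordX (S.Φ t p) (S.flowDeriv S.Xperp (t, p)) = 0 := by
    have := eq_of_hasDerivAt_zero ht
      (fun s hs => (S.jacobi_system S.contDiff_Xperp (h.region hs)).1)
    rw [this, flowDeriv_zero, Φ_zero, coordX_Xperp]
  conv_lhs => rw [S.coord_expansion (S.Φ t p) (S.flowDeriv S.Xperp (t, p))]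
  rw [h0, jacA, jacA', V, flowMap]
  module

theorem Stays.flowDeriv_V (h : S.Stays p t) (ht : 0 ≤ t) : S.flowDeriv V (t, p) =
    S.jacB' (t, p) • V p - S.jacB (t, p) • S.Xperp (S.Φ t p) := by
  have h0 : S.coordX (S.Φ t p) (S.flowDeriv V (t, p)) = 0 := by
    have := eq_of_hasDerivAt_zero ht
      (fun s hs => (S.jacobi_system contDiff_V (h.region hs)).1)
    rw [this, flowDeriv_zero, Φ_zero, coordX_V]
  conv_lhs => rw [S.coord_expansion (S.Φ t p) (S.flowDeriv V (t, p))]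
  rw [h0, jacB, jacB', flowMap]
  simp only [V]
  module

/-- Both factors solve the same equation `y'' + κ y = 0`, so their Wronskian keeps its initial
value. -/
theorem Stays.wronskian (h : S.Stays p t) (ht : 0 ≤ t) :
    S.jacA (t, p) * S.jacB' (t, p) - S.jacA' (t, p) * S.jacB (t, p) = 1 := by
  have := eq_of_hasDerivAt_zero (f := fun s => S.jacA (s, p) * S.jacB' (s, p) -
    S.jacA' (s, p) * S.jacB (s, p)) ht (fun s hs => by
      have hr := h.region hs
      have := ((hasDerivAt_jacA hr).mul (hasDerivAt_jacB' hr)).sub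
        ((hasDerivAt_jacA' hr).mul (hasDerivAt_jacB hr))
      refine this.congr_deriv ?_
      ring)
  simpa [jacA_zero, jacA'_zero, jacB_zero, jacB'_zero] using this

end

/-- The derivative with respect to the initial angle. -/
def angleDeriv (f : ℝ × CircleCoord → ℝ) (q : ℝ × CircleCoord) : ℝ := fderiv ℝ f q (0, (0, 1))

/-- Symmetry of the second derivative of `f`. The equation is required near `(t, p)` since it is
differentiated in the angle. -/
theorem hasDerivAt_angleDeriv {f g : ℝ × CircleCoord → ℝ} (hf : ContDiff ℝ ∞ f)
    (hg : Differentiable ℝ g) {t : ℝ} {p : CircleCoord}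
    (h : ∀ᶠ q in nhds (t, p), HasDerivAt (fun s => f (s, q.2)) (g q) q.1) :
    HasDerivAt (fun s => angleDeriv f (s, p)) (angleDeriv g (t, p)) t := by
  have hd : ContDiff ℝ ∞ (fderiv ℝ f) := hf.fderiv_right (by simp)
  have h1 := (hasDerivAt_time (hd.differentiable (by simp)) t p).clm_apply
    (hasDerivAt_const t ((0, (0, 1)) : ℝ × CircleCoord))
  have hsymm : IsSymmSndFDerivAt ℝ f (t, p) := hf.contDiffAt.isSymmSndFDerivAt (by
      simpa using WithTop.coe_le_coe.2 (le_top (a := (2 : ℕ∞))))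
  have h2 : HasFDerivAt (fun q => fderiv ℝ f q (1, 0)) (fderiv ℝ g (t, p)) (t, p) := by
    refine (hg (t, p)).hasFDerivAt.congr_of_eventuallyEq ?_
    filter_upwards [h] with q hq
    exact (hasDerivAt_time (hf.differentiable (by simp)) q.1 q.2).unique hq
  have h3 : HasFDerivAt (fun q => fderiv ℝ f q (1, 0))
      ((fderiv ℝ (fderiv ℝ f) (t, p)).flip (1, 0)) (t, p) := by
    have := ((hd.differentiable (by simp)) (t, p)).hasFDerivAt.clm_apply
      (hasFDerivAt_const ((1, 0) : ℝ × CircleCoord) (t, p))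
    simpa using this
  have h4 := congrArg (fun A : (ℝ × CircleCoord) →L[ℝ] ℝ => A (0, (0, 1))) (h2.unique h3)
  simp only [ContinuousLinearMap.flip_apply] at h4
  rw [hsymm.eq] at h4
  simpa [angleDeriv, h4] using h1

theorem hasDerivAt_angle {f : ℝ × CircleCoord → ℝ} (hf : Differentiable ℝ f) (t : ℝ) (x : Plane)
    (θ : ℝ) : HasDerivAt (fun θ => f (t, (x, θ))) (angleDeriv f (t, (x, θ))) θ :=
  (hf (t, (x, θ))).hasFDerivAt.comp_hasDerivAt (f := fun θ : ℝ => (t, (x, θ))) θ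
    ((hasDerivAt_const θ t).prodMk ((hasDerivAt_const θ x).prodMk (hasDerivAt_id θ)))

theorem angleDeriv_eq_zero {f : ℝ × CircleCoord → ℝ} (hf : Differentiable ℝ f) {t c : ℝ}
    (h : ∀ p, f (t, p) = c) (p : CircleCoord) : angleDeriv f (t, p) = 0 := by
  have h1 := hasDerivAt_angle hf t p.1 p.2
  simp only [h] at h1
  exact h1.unique (hasDerivAt_const _ _)

theorem eventually_flowMap_region {S : RiemannianSurface} {t : ℝ} {p : CircleCoord}
    (h : S.Φ t p ∈ S.geodesicRegion) :
    ∀ᶠ q : ℝ × CircleCoord in nhds (t, p), S.Φ q.1 q.2 ∈ S.geodesicRegion :=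
  S.continuous_Φ.continuousAt.eventually (S.isOpen_geodesicRegion.mem_nhds h)

section

variable {S} {t : ℝ} {p : CircleCoord}

/-- The differentiated Jacobi equation, for a Jacobi function `f` with derivative `f'`. -/
theorem Stays.hasDerivAt_angleDeriv_jacobi (h : S.Stays p t) (ht : 0 ≤ t)
    {f f' : ℝ × CircleCoord → ℝ} (hf : ContDiff ℝ ∞ f) (hf' : ContDiff ℝ ∞ f')
    (hd : ∀ q : ℝ × CircleCoord, S.Φ q.1 q.2 ∈ S.geodesicRegion →
      HasDerivAt (fun s => f' (s, q.2)) (-(S.curvature (S.Φ q.1 q.2).1 * f q)) q.1) :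
    HasDerivAt (fun s => angleDeriv f' (s, p)) (-(S.curvature (S.Φ t p).1 * angleDeriv f (t, p)) +
      S.jacB (t, p) * fderiv ℝ S.curvature (S.Φ t p).1 (S.Xperp (S.Φ t p)).1 * f (t, p)) t := by
  have hκ : ContDiff ℝ ∞ fun q : ℝ × CircleCoord => S.curvature (S.flowMap q).1 :=
    S.contDiff_curvature.comp S.contDiff_flowMap.fst
  have h1 := hasDerivAt_angleDeriv (t := t) (p := p) hf'
    (g := fun q => -(S.curvature (S.flowMap q).1 * f q))
    ((hκ.mul hf).neg.differentiable (by simp))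
    (by filter_upwards [eventually_flowMap_region (h.region ⟨ht, le_rfl⟩)] with q hq using hd q hq)
  refine h1.congr_deriv ?_
  have hk : HasFDerivAt (fun q : ℝ × CircleCoord => S.curvature (S.flowMap q).1)
      ((fderiv ℝ S.curvature (S.flowMap (t, p)).1).comp
        ((ContinuousLinearMap.fst ℝ Plane ℝ).comp (fderiv ℝ S.flowMap (t, p)))) (t, p) :=
    ((S.contDiff_curvature.differentiable (by simp)) _).hasFDerivAt.comp _
      (hasFDerivAt_fst.comp _ ((S.contDiff_flowMap.differentiable (by simp)) (t, p)).hasFDerivAt)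
  have h2 := (hk.fun_mul ((hf.differentiable (by simp)) (t, p)).hasFDerivAt).fun_neg.fderiv
  -- The flow sends `V` to `b' V - b X_⊥`, and the curvature sees only the base component. This
  -- produces the source term with `X_⊥ κ`.
  have h3 : fderiv ℝ S.flowMap (t, p) (0, (0, 1)) = S.flowDeriv V (t, p) := rfl
  rw [angleDeriv, h2]
  simp only [neg_apply, add_apply, smul_apply, ContinuousLinearMap.comp_apply, h3,
    h.flowDeriv_V ht]
  simp [V, flowMap, angleDeriv]
  ring

theorem hasDerivAt_angleDeriv_region (h : S.Φ t p ∈ S.geodesicRegion)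
    {f f' : ℝ × CircleCoord → ℝ} (hf : ContDiff ℝ ∞ f) (hf' : ContDiff ℝ ∞ f')
    (hd : ∀ q : ℝ × CircleCoord, S.Φ q.1 q.2 ∈ S.geodesicRegion →
      HasDerivAt (fun s => f (s, q.2)) (f' q) q.1) :
    HasDerivAt (fun s => angleDeriv f (s, p)) (angleDeriv f' (t, p)) t :=
  hasDerivAt_angleDeriv hf (hf'.differentiable (by simp))
    (by filter_upwards [eventually_flowMap_region h] with q hq using hd q hq)

end

/-- Compactness of `M` makes the supremum genuine; for an unbounded family the real `⨆` would be
`0`. -/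
theorem bddAbove_abs_curvature : BddAbove (range fun x : S.M => |S.curvature x|) := by
  have := S.isCompact.bddAbove_image (f := fun x => |S.curvature x|)
    S.contDiff_curvature.continuous.abs.continuousOn
  rwa [image_eq_range] at this

theorem abs_curvature_le {x : Plane} (hx : x ∈ S.M) : |S.curvature x| ≤ S.curvatureSup :=
  le_ciSup S.bddAbove_abs_curvature ⟨x, hx⟩

theorem continuous_gradCurvature : Continuous S.gradCurvature := by
  have h := S.contDiff_curvature.continuous_fderiv (by simp)
  exact (((h.clm_apply S.contDiff_e₁.continuous).pow 2).add
    ((h.clm_apply S.contDiff_e₂.continuous).pow 2)).sqrt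

theorem gradCurvature_le {x : Plane} (hx : x ∈ S.M) : S.gradCurvature x ≤ S.gradCurvatureSup := by
  have := S.isCompact.bddAbove_image (f := S.gradCurvature) S.continuous_gradCurvature.continuousOn
  rw [image_eq_range] at this
  exact le_ciSup this ⟨x, hx⟩

theorem curvatureSup_nonneg : 0 ≤ S.curvatureSup := Real.iSup_nonneg fun _ => abs_nonneg _

theorem gradCurvatureSup_nonneg : 0 ≤ S.gradCurvatureSup :=
  Real.iSup_nonneg fun _ => Real.sqrt_nonneg _

/-! ### Curvature estimates and absence of conjugate points -/

variable {S} {t : ℝ} {p : CircleCoord}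

/-- The estimates on the Jacobi functions in terms of the curvature. -/
theorem Stays.jacobi_estimates (h : S.Stays p t) (ht : 0 ≤ t) {C : ℝ}
    (hA : ∀ s ∈ Icc 0 t, |S.jacA (s, p)| ≤ C) (hB' : ∀ s ∈ Icc 0 t, |S.jacB' (s, p)| ≤ C) :
    |S.jacA (t, p) - 1| ≤ S.curvatureSup * C * t ^ 2 ∧
    |S.jacB (t, p) * angleDeriv S.jacA (t, p) - S.jacA (t, p) * angleDeriv S.jacB (t, p)| ≤
      4 * C ^ 5 * S.gradCurvatureSup * t ^ 4 := by
  have hC : 0 ≤ C := (abs_nonneg _).trans (hA 0 ⟨le_rfl, ht⟩)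
  have hκ : ∀ s ∈ Icc 0 t, |S.curvature (S.Φ s p).1| ≤ S.curvatureSup := fun s hs =>
    S.abs_curvature_le (h s hs)
  have hg : ∀ s ∈ Icc 0 t, |fderiv ℝ S.curvature (S.Φ s p).1 (S.Xperp (S.Φ s p)).1| ≤
      S.gradCurvatureSup := fun s hs =>
    (S.abs_fderiv_curvature_Xperp_le _).trans (S.gradCurvature_le (h s hs))
  have hs0 : ∀ s ∈ Icc 0 t, ∀ r ∈ Icc 0 s, r ∈ Icc 0 t := fun s hs r hr =>
    ⟨hr.1, hr.2.trans hs.2⟩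
  have hB : ∀ s ∈ Icc 0 t, |S.jacB (s, p)| ≤ C * t := by
    intro s hs
    have := abs_sub_le_of_hasDerivAt hs.1
      (fun r hr => hasDerivAt_jacB (h.region (hs0 s hs r hr))) (fun r hr => hB' r (hs0 s hs r hr))
    rw [jacB_zero, sub_zero] at this
    exact this.trans (mul_le_mul_of_nonneg_left hs.2 hC)
  have hκ0 := S.curvatureSup_nonneg
  have hg0 := S.gradCurvatureSup_nonneg
  constructor
  · have h1 : ∀ s ∈ Icc 0 t, |S.jacA' (s, p)| ≤ S.curvatureSup * C * t := by
      intro s hs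
      have := abs_sub_le_of_hasDerivAt (C := S.curvatureSup * C) hs.1
        (fun r hr => hasDerivAt_jacA' (h.region (hs0 s hs r hr))) (fun r hr => by
          rw [abs_neg, abs_mul]
          have := hs0 s hs r hr
          exact mul_le_mul (hκ r this) (hA r this) (abs_nonneg _) hκ0)
      rw [jacA'_zero, sub_zero] at this
      exact this.trans (mul_le_mul_of_nonneg_left hs.2 (by positivity))
    have := abs_sub_le_of_hasDerivAt ht (fun r hr => hasDerivAt_jacA (h.region hr)) h1
    rw [jacA_zero] at this
    refine this.trans (le_of_eq ?_)
    ring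
  · set κ' : ℝ → ℝ := fun s => fderiv ℝ S.curvature (S.Φ s p).1 (S.Xperp (S.Φ s p)).1 with hκ'
    have dA := fun s (hs : s ∈ Icc 0 t) => hasDerivAt_jacA (h.region hs)
    have dA' := fun s (hs : s ∈ Icc 0 t) => hasDerivAt_jacA' (h.region hs)
    have dB := fun s (hs : s ∈ Icc 0 t) => hasDerivAt_jacB (h.region hs)
    have dB' := fun s (hs : s ∈ Icc 0 t) => hasDerivAt_jacB' (h.region hs)
    have dA₁ := fun s (hs : s ∈ Icc 0 t) => hasDerivAt_angleDeriv_region (h.region hs)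
      S.contDiff_jacA S.contDiff_jacA' (fun q hq => hasDerivAt_jacA hq)
    have dB₁ := fun s (hs : s ∈ Icc 0 t) => hasDerivAt_angleDeriv_region (h.region hs)
      S.contDiff_jacB S.contDiff_jacB' (fun q hq => hasDerivAt_jacB hq)
    have dA₁' := fun s (hs : s ∈ Icc 0 t) => (h.mono hs.2).hasDerivAt_angleDeriv_jacobi hs.1
      S.contDiff_jacA S.contDiff_jacA' (fun q hq => hasDerivAt_jacA' hq)
    have dB₁' := fun s (hs : s ∈ Icc 0 t) => (h.mono hs.2).hasDerivAt_angleDeriv_jacobi hs.1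
      S.contDiff_jacB S.contDiff_jacB' (fun q hq => hasDerivAt_jacB' hq)
    have zA := angleDeriv_eq_zero (S.contDiff_jacA.differentiable (by simp)) S.jacA_zero p
    have zA' := angleDeriv_eq_zero (S.contDiff_jacA'.differentiable (by simp)) S.jacA'_zero p
    have zB := angleDeriv_eq_zero (S.contDiff_jacB.differentiable (by simp)) S.jacB_zero p
    have zB' := angleDeriv_eq_zero (S.contDiff_jacB'.differentiable (by simp)) S.jacB'_zero p
    have hj : ∀ s ∈ Icc 0 t, |S.jacB (s, p) * κ' s| ≤ C * t * S.gradCurvatureSup := fun s hs => by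
      rw [abs_mul]
      exact mul_le_mul (hB s hs) (hg s hs) (abs_nonneg _) (by positivity)
    -- Each of the four Wronskians of an angle derivative with a Jacobi function vanishes at time
    -- zero; the curvature terms cancel in its derivative and leave the source `b κ'` times two
    -- Jacobi functions, where `κ'` is `X_⊥ κ` along the geodesic.
    have hP := abs_sub_le_of_hasDerivAt
      (f := fun s => angleDeriv S.jacB' (s, p) * S.jacA (s, p) -
        angleDeriv S.jacB (s, p) * S.jacA' (s, p))
      (f' := fun s => S.jacB (s, p) * κ' s * S.jacB (s, p) * S.jacA (s, p))
      (C := C * t * S.gradCurvatureSup * (C * t) * C) ht (fun s hs => by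
        refine (((dB₁' s hs).mul (dA s hs)).sub ((dB₁ s hs).mul (dA' s hs))).congr_deriv ?_
        simp only [hκ']; ring)
      (fun s hs => by
        rw [abs_mul, abs_mul]
        exact mul_le_mul (mul_le_mul (hj s hs) (hB s hs) (abs_nonneg _) (by positivity))
          (hA s hs) (abs_nonneg _) (by positivity))
    have hQ := abs_sub_le_of_hasDerivAt
      (f := fun s => angleDeriv S.jacB' (s, p) * S.jacB (s, p) -
        angleDeriv S.jacB (s, p) * S.jacB' (s, p))
      (f' := fun s => S.jacB (s, p) * κ' s * S.jacB (s, p) * S.jacB (s, p))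
      (C := C * t * S.gradCurvatureSup * (C * t) * (C * t)) ht (fun s hs => by
        refine (((dB₁' s hs).mul (dB s hs)).sub ((dB₁ s hs).mul (dB' s hs))).congr_deriv ?_
        simp only [hκ']; ring)
      (fun s hs => by
        rw [abs_mul, abs_mul]
        exact mul_le_mul (mul_le_mul (hj s hs) (hB s hs) (abs_nonneg _) (by positivity))
          (hB s hs) (abs_nonneg _) (by positivity))
    have hP₂ := abs_sub_le_of_hasDerivAt
      (f := fun s => angleDeriv S.jacA' (s, p) * S.jacA (s, p) -
        angleDeriv S.jacA (s, p) * S.jacA' (s, p))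
      (f' := fun s => S.jacB (s, p) * κ' s * S.jacA (s, p) * S.jacA (s, p))
      (C := C * t * S.gradCurvatureSup * C * C) ht (fun s hs => by
        refine (((dA₁' s hs).mul (dA s hs)).sub ((dA₁ s hs).mul (dA' s hs))).congr_deriv ?_
        simp only [hκ']; ring)
      (fun s hs => by
        rw [abs_mul, abs_mul]
        exact mul_le_mul (mul_le_mul (hj s hs) (hA s hs) (abs_nonneg _) (by positivity))
          (hA s hs) (abs_nonneg _) (by positivity))
    have hQ₂ := abs_sub_le_of_hasDerivAt
      (f := fun s => angleDeriv S.jacA' (s, p) * S.jacB (s, p) -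
        angleDeriv S.jacA (s, p) * S.jacB' (s, p))
      (f' := fun s => S.jacB (s, p) * κ' s * S.jacA (s, p) * S.jacB (s, p))
      (C := C * t * S.gradCurvatureSup * C * (C * t)) ht (fun s hs => by
        refine (((dA₁' s hs).mul (dB s hs)).sub ((dA₁ s hs).mul (dB' s hs))).congr_deriv ?_
        simp only [hκ']; ring)
      (fun s hs => by
        rw [abs_mul, abs_mul]
        exact mul_le_mul (mul_le_mul (hj s hs) (hA s hs) (abs_nonneg _) (by positivity))
          (hB s hs) (abs_nonneg _) (by positivity))
    simp only [zA, zA', zB, zB', zero_mul, sub_zero] at hP hQ hP₂ hQ₂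
    have hw := h.wronskian ht
    have hAt := hA t ⟨ht, le_rfl⟩
    have hBt := hB t ⟨ht, le_rfl⟩
    generalize S.jacA (t, p) = a at *
    generalize S.jacA' (t, p) = a' at *
    generalize S.jacB (t, p) = b at *
    generalize S.jacB' (t, p) = b' at *
    generalize angleDeriv S.jacA (t, p) = a₁ at *
    generalize angleDeriv S.jacA' (t, p) = a₁' at *
    generalize angleDeriv S.jacB (t, p) = b₁ at *
    generalize angleDeriv S.jacB' (t, p) = b₁' at *
    -- Variation of constants: as the Wronskian of `a` and `b` is `1`, `a₁` and `b₁` are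
    -- combinations of the four quantities just estimated. Each of the four resulting products is at
    -- most `C⁵ ‖∇κ‖ t⁴`.
    have key : b * a₁ - a * b₁ = b * b * (a₁' * a - a₁ * a') - a * b * (a₁' * b - a₁ * b') -
        a * b * (b₁' * a - b₁ * a') + a * a * (b₁' * b - b₁ * b') := by
      linear_combination (a * b₁ - b * a₁) * hw
    rw [key]
    have hbb : |b * b| ≤ C * t * (C * t) := by
      rw [abs_mul]; exact mul_le_mul hBt hBt (abs_nonneg _) (by positivity)
    have hab : |a * b| ≤ C * (C * t) := by
      rw [abs_mul]; exact mul_le_mul hAt hBt (abs_nonneg _) (by positivity)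
    have haa : |a * a| ≤ C * C := by
      rw [abs_mul]; exact mul_le_mul hAt hAt (abs_nonneg _) (by positivity)
    have e1 := mul_le_mul hbb hP₂ (abs_nonneg _) (by positivity)
    have e2 := mul_le_mul hab hQ₂ (abs_nonneg _) (by positivity)
    have e3 := mul_le_mul hab hP (abs_nonneg _) (by positivity)
    have e4 := mul_le_mul haa hQ (abs_nonneg _) (by positivity)
    rw [← abs_mul] at e1 e2 e3 e4
    refine (abs_add_le _ _).trans ((add_le_add ((abs_sub _ _).trans (add_le_add
      ((abs_sub _ _).trans (add_le_add e1 e2)) e3)) e4).trans (le_of_eq ?_))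
    ring

open Filter Topology in
/-- There are no conjugate points on a simple surface. -/
theorem IsSimple.jacB_ne_zero (hS : S.IsSimple) (h : S.Stays p t) (ht : 0 < t) :
    S.jacB (t, p) ≠ 0 := by
  obtain ⟨ρ, hρ⟩ := hS.exists_isConvexDefining
  obtain ⟨x, θ⟩ := p
  have hx : x ∈ S.M := h.mem ht.le
  obtain ⟨hbij, -, L, hL, hLe⟩ := hS.2 x hx
  have hyt := h t ⟨ht.le, le_rfl⟩
  -- The endpoint may lie on the boundary, where the inverse `L` is regular only relative to `M`.
  -- Its derivative is therefore used at earlier times `s < t`, in the interior, with a bound `C`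
  -- uniform as `s → t`.
  have hL1 : ContDiffWithinAt ℝ (0 + 1) L S.M (S.Φ t (x, θ)).1 :=
    (hL _ hyt).of_le (by simp)
  obtain ⟨u, hu, -, L', hL', hL'c⟩ :=
    (contDiffWithinAt_succ_iff_hasFDerivWithinAt (by simp)).1 hL1
  rw [insert_eq_of_mem hyt] at hu
  have hyu : (S.Φ t (x, θ)).1 ∈ u := mem_of_mem_nhdsWithin hyt hu
  set C := ‖L' (S.Φ t (x, θ)).1‖ + 1
  have hbound : ∀ᶠ y in 𝓝[u] (S.Φ t (x, θ)).1, ‖L' y‖ < C :=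
    hL'c.continuousWithinAt.norm.eventually_lt continuousWithinAt_const (by simp [C])
  have hgood : ∀ᶠ y in 𝓝[S.M] (S.Φ t (x, θ)).1, y ∈ interior S.M →
      HasFDerivAt L (L' y) y ∧ ‖L' y‖ < C := by
    obtain ⟨O, hO, hyO, hOu⟩ := mem_nhdsWithin.1 hu
    filter_upwards [nhdsWithin_le_of_mem hu hbound, mem_nhdsWithin_of_mem_nhds (hO.mem_nhds hyO)]
      with y hy1 hy2 hy3
    have hyu : u ∈ 𝓝 y := mem_of_superset ((hO.inter isOpen_interior).mem_nhds ⟨hy2, hy3⟩)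
      ((inter_subset_inter_right _ interior_subset).trans hOu)
    exact ⟨(hL' y (mem_of_mem_nhds hyu)).hasFDerivAt hyu, hy1⟩
  have hΦt : Continuous fun s => S.Φ s (x, θ) :=
    S.continuous_Φ.comp (by fun_prop : Continuous fun s : ℝ => (s, ((x, θ) : CircleCoord)))
  -- Differentiating `L(exp(s e^{iθ})) = s e^{iθ}` in the angle gives `DL(-b X_⊥)` on the left and a
  -- number of modulus `s` on the right.
  have hest : ∀ᶠ s in 𝓝[<] t, s ≤ |S.jacB (s, (x, θ))| *
      (C * ‖(S.Xperp (S.Φ s (x, θ))).1‖) := by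
    have htend : Tendsto (fun s => (S.Φ s (x, θ)).1) (𝓝[<] t) (𝓝[S.M] (S.Φ t (x, θ)).1) := by
      refine tendsto_nhdsWithin_iff.2 ⟨(hΦt.fst.tendsto t).mono_left nhdsWithin_le_nhds, ?_⟩
      filter_upwards [Ioo_mem_nhdsLT ht] with s hs using h s (Ioo_subset_Icc_self hs)
    filter_upwards [htend.eventually hgood, Ioo_mem_nhdsLT ht] with s hs1 hs2
    obtain ⟨hd, hC⟩ := hs1 (h.interior_of_mem_Ioo hρ hs2)
    have h1 : HasDerivAt (fun θ' => S.Φ s (x, θ')) (S.flowDeriv V (s, (x, θ))) θ :=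
      ((S.contDiff_flowMap.differentiable (by simp)) (s, (x, θ))).hasFDerivAt.comp_hasDerivAt
        (f := fun θ' : ℝ => (s, ((x, θ') : CircleCoord))) θ
        ((hasDerivAt_const θ s).prodMk ((hasDerivAt_const θ x).prodMk (hasDerivAt_id θ)))
    have h2 := hd.comp_hasDerivAt θ
      ((ContinuousLinearMap.fst ℝ Plane ℝ).hasFDerivAt.comp_hasDerivAt θ h1)
    have h3 : HasDerivAt (fun θ' : ℝ => (s * Complex.exp (Complex.I * θ') : ℂ))
        (s * (Complex.exp (Complex.I * θ) * Complex.I)) θ := by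
      have := (((hasDerivAt_id θ).ofReal_comp.const_mul Complex.I).cexp).const_mul (s : ℂ)
      simpa using this
    have h4 := h2.unique (h3.congr_of_eventuallyEq (by
      filter_upwards [h.eventually_angle hρ hs2] with θ' hθ'
      obtain ⟨h5, h6⟩ := hθ'.polar_mem hs2.1
      have h7 := hLe _ h5
      rw [h6] at h7
      exact h7))
    rw [(h.mono hs2.2.le).flowDeriv_V hs2.1.le] at h4
    have h5 := congrArg norm h4
    simp only [ContinuousLinearMap.coe_fst', Prod.fst_sub, Prod.smul_fst, V, smul_zero, zero_sub,
      map_neg, map_smul, norm_neg, norm_smul, norm_mul, Complex.norm_I, mul_one,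
      Complex.norm_real, Real.norm_of_nonneg hs2.1.le] at h5
    rw [mul_comm Complex.I, Complex.norm_exp_ofReal_mul_I, mul_one] at h5
    refine h5.symm.le.trans ?_
    rw [Real.norm_eq_abs]
    exact mul_le_mul_of_nonneg_left
      (((L' _).le_opNorm _).trans (mul_le_mul_of_nonneg_right hC.le (norm_nonneg _))) (abs_nonneg _)
  have hlim : Tendsto (fun s => |S.jacB (s, (x, θ))| * (C * ‖(S.Xperp (S.Φ s (x, θ))).1‖)) (𝓝[<] t)
      (𝓝 (|S.jacB (t, (x, θ))| * (C * ‖(S.Xperp (S.Φ t (x, θ))).1‖))) := by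
    have hc : Continuous fun s => |S.jacB (s, (x, θ))| * (C * ‖(S.Xperp (S.Φ s (x, θ))).1‖) := by
      have h1 : Continuous fun s : ℝ => S.jacB (s, (x, θ)) :=
        S.contDiff_jacB.continuous.comp (by fun_prop)
      have h2 := (S.contDiff_Xperp.continuous.comp hΦt).fst
      exact h1.abs.mul (continuous_const.mul h2.norm)
    exact (hc.tendsto t).mono_left nhdsWithin_le_nhds
  have hid : Tendsto (fun s : ℝ => s) (𝓝[<] t) (𝓝 t) := tendsto_id.mono_left nhdsWithin_le_nhds
  intro h0
  -- In the limit, `b(t) = 0` would force `t ≤ 0`.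
  have := le_of_tendsto_of_tendsto hid hlim hest
  rw [h0, abs_zero, zero_mul] at this
  exact absurd ht (not_lt.2 this)

/-- The compact set of times and initial conditions of geodesics within `M`. -/
def geodesicDomain (S : RiemannianSurface) : Set (ℝ × CircleCoord) :=
  {q | q.2 ∈ S.fundamentalSM ∧ 0 ≤ q.1 ∧ S.Stays q.2 q.1}

theorem IsSimple.isCompact_geodesicDomain (hS : S.IsSimple) : IsCompact S.geodesicDomain := by
  obtain ⟨T, -, hT⟩ := hS.exists_time_bound
  refine ((isCompact_Icc (a := (0 : ℝ)) (b := T)).prod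
    (isCompact_fundamentalSM (S := S))).of_isClosed_subset
    ((isCompact_fundamentalSM.isClosed.preimage continuous_snd).inter isClosed_stays) ?_
  rintro q ⟨h1, h2, h3⟩
  exact ⟨⟨h2, hT _ _ h3⟩, h1⟩

open Filter Topology in
/-- A quantitative version of the absence of conjugate points. -/
theorem IsSimple.exists_le_abs_jacB (hS : S.IsSimple) :
    ∃ c > 0, ∀ q ∈ S.geodesicDomain, c * q.1 ≤ |S.jacB q| := by
  obtain ⟨T, hT0, hT⟩ := hS.exists_time_bound
  -- For short times `b' > 1/2` yields `b ≥ t/2`. For longer ones `|b|` has a positive minimum `m`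
  -- on a compact set, and `t ≤ T`; the constant is the smaller of `1/2` and `m/T`.
  have hev : ∀ᶠ t in 𝓝 (0 : ℝ), ∀ p ∈ S.fundamentalSM, 1 / 2 < S.jacB' (t, p) := by
    refine isCompact_fundamentalSM.eventually_forall_of_forall_eventually fun p _ => ?_
    have hc : Continuous fun z : ℝ × CircleCoord => S.jacB' (z.1, z.2) := S.contDiff_jacB'.continuous
    exact continuousAt_const.eventually_lt hc.continuousAt (by simp [jacB'_zero]; norm_num)
  obtain ⟨δ, hδ, hball⟩ := Metric.eventually_nhds_iff.1 hev
  have hK : IsCompact (S.geodesicDomain ∩ {q | δ / 2 ≤ q.1}) :=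
    hS.isCompact_geodesicDomain.inter_right (isClosed_le continuous_const continuous_fst)
  obtain ⟨m, hm0, hm⟩ := hK.exists_forall_le' (a := 0) S.contDiff_jacB.continuous.abs.continuousOn
    (fun q hq => abs_pos.2 (hS.jacB_ne_zero hq.1.2.2
      (lt_of_lt_of_le (by positivity) (show δ / 2 ≤ q.1 from hq.2))))
  refine ⟨min (1 / 2) (m / T), lt_min (by norm_num) (by positivity), ?_⟩
  rintro ⟨t, p⟩ ⟨hp, ht, h⟩
  simp only at hp ht h ⊢
  rcases le_or_gt (δ / 2) t with hlt | hlt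
  · have h1 := hm (t, p) ⟨⟨hp, ht, h⟩, hlt⟩
    calc min (1 / 2) (m / T) * t ≤ m / T * T := by
          gcongr
          · exact min_le_right _ _
          · exact hT p t h
      _ = m := by field_simp
      _ ≤ _ := h1
  · have hmono : MonotoneOn (fun s => S.jacB (s, p) - 1 / 2 * s) (Icc 0 t) := by
      have hd : ∀ s ∈ Icc 0 t, HasDerivAt (fun s => S.jacB (s, p) - 1 / 2 * s)
          (S.jacB' (s, p) - 1 / 2 * 1) s := fun s hs =>
        (hasDerivAt_jacB (h.region hs)).sub ((hasDerivAt_id s).const_mul (1 / 2))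
      refine monotoneOn_of_deriv_nonneg (convex_Icc _ _)
        (fun s hs => (hd s hs).continuousAt.continuousWithinAt)
        (fun s hs => (hd s (interior_subset hs)).differentiableAt.differentiableWithinAt)
        (fun s hs => ?_)
      have hs' := interior_subset hs
      rw [(hd s hs').deriv]
      have := hball (y := s) (by
        rw [Real.dist_eq, sub_zero, abs_of_nonneg hs'.1]; linarith [hs'.2]) p hp
      linarith
    have := hmono ⟨le_rfl, ht⟩ ⟨ht, le_rfl⟩ ht
    simp only [jacB_zero] at this
    calc min (1 / 2) (m / T) * t ≤ 1 / 2 * t := by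
          gcongr; exact min_le_left _ _
      _ ≤ S.jacB (t, p) := by linarith
      _ ≤ _ := le_abs_self _

/-- The bounds on the kernel of `W_k`. -/
theorem IsSimple.exists_kernel_bounds (hS : S.IsSimple) :
    ∃ C > 0, ∀ p ∈ S.fundamentalSM, ∀ t, 0 < t → S.Stays p t → S.jacB (t, p) ≠ 0 ∧
      |S.jacB (t, p) * angleDeriv S.jacA (t, p) - S.jacA (t, p) * angleDeriv S.jacB (t, p)| ≤
        C * S.gradCurvatureSup * S.jacB (t, p) ^ 2 ∧
      |S.jacA (t, p) - 1| ≤ C * S.curvatureSup * |S.jacB (t, p)| := by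
  obtain ⟨T, hT0, hT⟩ := hS.exists_time_bound
  obtain ⟨c, hc0, hc⟩ := hS.exists_le_abs_jacB
  obtain ⟨C₁, hC₁⟩ := hS.isCompact_geodesicDomain.exists_bound_of_continuousOn
    S.contDiff_jacA.continuous.continuousOn
  obtain ⟨C₂, hC₂⟩ := hS.isCompact_geodesicDomain.exists_bound_of_continuousOn
    S.contDiff_jacB'.continuous.continuousOn
  set C := max (max C₁ C₂) 1
  have hC0 : 0 < C := lt_of_lt_of_le one_pos (le_max_right _ _)
  have hκ0 := S.curvatureSup_nonneg
  have hg0 := S.gradCurvatureSup_nonneg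
  -- The two summands serve the two bounds: `t⁴ ≤ T² (c t)² / c²` for the angle derivatives, and `t²
  -- ≤ T (c t) / c` for `a - 1`.
  refine ⟨4 * C ^ 5 * T ^ 2 / c ^ 2 + C * T / c, by positivity, fun p hp t ht h => ?_⟩
  obtain ⟨h1, h2⟩ := h.jacobi_estimates (C := C) ht.le
    (fun s hs => (hC₁ (s, p) ⟨hp, hs.1, h.mono hs.2⟩).trans
      ((le_max_left _ _).trans (le_max_left _ _)))
    (fun s hs => (hC₂ (s, p) ⟨hp, hs.1, h.mono hs.2⟩).trans
      ((le_max_right _ _).trans (le_max_left _ _)))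
  have h3 : c * t ≤ |S.jacB (t, p)| := hc (t, p) ⟨hp, ht.le, h⟩
  have h4 : t ≤ T := hT p t h
  refine ⟨hS.jacB_ne_zero h ht, h2.trans ?_, h1.trans ?_⟩
  · have h5 : (c * t) ^ 2 ≤ S.jacB (t, p) ^ 2 := by
      rw [← sq_abs (S.jacB (t, p))]; gcongr
    calc 4 * C ^ 5 * S.gradCurvatureSup * t ^ 4
        = 4 * C ^ 5 * t ^ 2 / c ^ 2 * S.gradCurvatureSup * (c * t) ^ 2 := by field_simp
      _ ≤ (4 * C ^ 5 * T ^ 2 / c ^ 2 + C * T / c) * S.gradCurvatureSup * S.jacB (t, p) ^ 2 := by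
          gcongr
          have : 4 * C ^ 5 * t ^ 2 / c ^ 2 ≤ 4 * C ^ 5 * T ^ 2 / c ^ 2 := by gcongr
          have : 0 < C * T / c := by positivity
          linarith
  · calc S.curvatureSup * C * t ^ 2 = C * t / c * S.curvatureSup * (c * t) := by field_simp
      _ ≤ (4 * C ^ 5 * T ^ 2 / c ^ 2 + C * T / c) * S.curvatureSup * |S.jacB (t, p)| := by
          gcongr
          have : C * t / c ≤ C * T / c := by gcongr
          have : 0 < 4 * C ^ 5 * T ^ 2 / c ^ 2 := by positivity
          linarith

end RiemannianSurface

/-! ### Differentiation under the integral sign -/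

section Parametric

open Filter Topology

variable {E F : Type*} [NormedAddCommGroup E] [NormedSpace ℝ E]
  [NormedAddCommGroup F] [NormedSpace ℝ F]

/-- The partial derivative of `h(t, p)` in `p`. -/
def partialFDeriv (h : ℝ × E → F) (t : ℝ) (p : E) : E →L[ℝ] F :=
  (fderiv ℝ h (t, p)).comp (ContinuousLinearMap.inr ℝ ℝ E)

/-- A tube argument: continuity at the points of the compact slice over `p` bounds `g` on all nearby
slices, which supplies the dominating constant below. -/
theorem eventually_norm_le_of_continuousAt {E G : Type*} [TopologicalSpace E] [NormedAddCommGroup G]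
    {g : ℝ × E → G} {T : ℝ} {p : E} (hg : ∀ t ∈ Icc 0 T, ContinuousAt g (t, p)) :
    ∃ C, ∀ᶠ p' in 𝓝 p, ∀ t ∈ Icc 0 T, ‖g (t, p')‖ ≤ C := by
  have hc : ContinuousOn (fun t => g (t, p)) (Icc 0 T) := fun t ht =>
    ((hg t ht).comp (f := fun t : ℝ => (t, p)) (by fun_prop)).continuousWithinAt
  obtain ⟨C, hC⟩ := isCompact_Icc.exists_bound_of_continuousOn hc
  refine ⟨C + 1, isCompact_Icc.eventually_forall_of_forall_eventually fun t ht => ?_⟩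
  have h1 : ContinuousAt (fun z : E × ℝ => ‖g (z.2, z.1)‖) (p, t) :=
    (ContinuousAt.comp (g := g) (f := fun z : E × ℝ => (z.2, z.1)) (hg t ht) (by fun_prop)).norm
  have h2 := h1.eventually_lt (continuousAt_const (y := C + 1)) (by 
    simpa using (hC t ht).trans_lt (by linarith))
  exact h2.mono fun z hz => le_of_lt hz

theorem aestronglyMeasurable_of_continuousAt_Icc {G : Type*} [NormedAddCommGroup G]
    {T : ℝ} (hT : 0 ≤ T) {g : ℝ → G} (hg : ∀ t ∈ Icc 0 T, ContinuousAt g t) :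
    AEStronglyMeasurable g (volume.restrict (uIoc 0 T)) := by
  rw [uIoc_of_le hT]
  have : ContinuousOn g (Icc 0 T) := fun t ht => (hg t ht).continuousWithinAt
  exact (this.mono Ioc_subset_Icc_self).aestronglyMeasurable measurableSet_Ioc

theorem continuousAt_parametric_integral {E G : Type*} [NormedAddCommGroup E] [NormedAddCommGroup G] [NormedSpace ℝ G]
    {g : ℝ × E → G} {T : ℝ} (hT : 0 ≤ T) {O : Set E} (hO : IsOpen O)
    (hg : ∀ t ∈ Icc 0 T, ∀ p ∈ O, ContinuousAt g (t, p)) {p : E} (hp : p ∈ O) :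
    ContinuousAt (fun p => ∫ t in (0 : ℝ)..T, g (t, p)) p := by
  obtain ⟨C, hC⟩ := eventually_norm_le_of_continuousAt (fun t ht => hg t ht p hp)
  refine intervalIntegral.continuousAt_of_dominated_interval (bound := fun _ => C) ?_ ?_
    intervalIntegrable_const ?_
  · filter_upwards [hO.mem_nhds hp] with p' hp'
    exact aestronglyMeasurable_of_continuousAt_Icc hT fun t ht =>
      (hg t ht p' hp').comp (f := fun t : ℝ => (t, p')) (by fun_prop)
  · filter_upwards [hC] with p' hp'
    refine Eventually.of_forall fun t ht => hp' t ?_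
    rw [uIoc_of_le hT] at ht
    exact Ioc_subset_Icc_self ht
  · refine Eventually.of_forall fun t ht => ?_
    rw [uIoc_of_le hT] at ht
    exact (hg t (Ioc_subset_Icc_self ht) p hp).comp (f := fun p : E => (t, p)) (by fun_prop)

theorem hasFDerivAt_parametric_integral {h : ℝ × E → F} {T : ℝ} (hT : 0 ≤ T) {O : Set E}
    (hO : IsOpen O) (hh : ∀ t ∈ Icc 0 T, ∀ p ∈ O, ContDiffAt ℝ 1 h (t, p)) {p : E} (hp : p ∈ O) :
    HasFDerivAt (fun p => ∫ t in (0 : ℝ)..T, h (t, p))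
      (∫ t in (0 : ℝ)..T, partialFDeriv h t p) p := by
  have hc : ∀ t ∈ Icc 0 T, ∀ p ∈ O, ContinuousAt (fun q : ℝ × E => partialFDeriv h q.1 q.2) (t, p) :=
    fun t ht p hp => ((hh t ht p hp).continuousAt_fderiv (by simp)).clm_comp continuousAt_const
  have hmeas : ∀ p' ∈ O, AEStronglyMeasurable (fun t => h (t, p')) (volume.restrict (uIoc 0 T)) :=
    fun p' hp' => aestronglyMeasurable_of_continuousAt_Icc hT fun t ht =>
      ContinuousAt.comp (g := h) (f := fun t : ℝ => (t, p')) (hh t ht p' hp').continuousAt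
        (by fun_prop)
  obtain ⟨C, hC⟩ := eventually_norm_le_of_continuousAt (fun t ht => hc t ht p hp)
  have hint : IntervalIntegrable (fun t => h (t, p)) volume 0 T := by
    refine ContinuousOn.intervalIntegrable fun t ht => ?_
    rw [uIcc_of_le hT] at ht
    exact (ContinuousAt.comp (g := h) (f := fun t : ℝ => (t, p)) (hh t ht p hp).continuousAt
        (by fun_prop)).continuousWithinAt
  refine intervalIntegral.hasFDerivAt_integral_of_dominated_of_fderiv_le
    (F := fun p t => h (t, p)) (F' := fun p t => partialFDeriv h t p)
    (bound := fun _ => C) (inter_mem hC (hO.mem_nhds hp)) ?_ hint ?_ ?_ intervalIntegrable_const ?_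
  · filter_upwards [hO.mem_nhds hp] with p' hp' using hmeas p' hp'
  · exact aestronglyMeasurable_of_continuousAt_Icc hT fun t ht =>
      ContinuousAt.comp (g := fun q : ℝ × E => partialFDeriv h q.1 q.2) (f := fun t : ℝ => (t, p))
        (hc t ht p hp) (by fun_prop)
  · refine Eventually.of_forall fun t ht p' hp' => hp'.1 t ?_
    rw [uIoc_of_le hT] at ht
    exact Ioc_subset_Icc_self ht
  · refine Eventually.of_forall fun t ht p' hp' => ?_
    rw [uIoc_of_le hT] at ht
    exact ((hh t (Ioc_subset_Icc_self ht) p' hp'.2).differentiableAt (by simp)).hasFDerivAt.comp p'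
      (hasFDerivAt_prodMk_right t p')

theorem contDiffOn_parametric_integral {h : ℝ × E → F} {T : ℝ} (hT : 0 ≤ T) {O : Set E}
    (hO : IsOpen O) (hh : ∀ t ∈ Icc 0 T, ∀ p ∈ O, ContDiffAt ℝ 1 h (t, p)) :
    ContDiffOn ℝ 1 (fun p => ∫ t in (0 : ℝ)..T, h (t, p)) O := by
  have hc : ∀ t ∈ Icc 0 T, ∀ p ∈ O, ContinuousAt (fun q : ℝ × E => partialFDeriv h q.1 q.2) (t, p) :=
    fun t ht p hp => ((hh t ht p hp).continuousAt_fderiv (by simp)).clm_comp continuousAt_const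
  rw [show (1 : WithTop ℕ∞) = 0 + 1 by simp,
    contDiffOn_succ_iff_hasFDerivWithinAt_of_uniqueDiffOn hO.uniqueDiffOn]
  refine ⟨by simp, fun p => ∫ t in (0 : ℝ)..T, partialFDeriv h t p, ?_, fun p hp =>
    (hasFDerivAt_parametric_integral hT hO hh hp).hasFDerivWithinAt⟩
  rw [contDiffOn_zero]
  exact fun p hp => (continuousAt_parametric_integral (g := fun q : ℝ × E => partialFDeriv h q.1 q.2)
    hT hO hc hp).continuousWithinAt

end Parametric

namespace RiemannianSurface

open Filter Topology

variable {S : RiemannianSurface}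

/-! ### The transport solution -/

open Classical in
/-- The function `F` transported along the geodesic flow, extended by zero after the exit time. -/
def pull (S : RiemannianSurface) (F : CircleCoord → ℂ) (q : ℝ × CircleCoord) : ℂ :=
  if q.1 ≤ S.exitTime q.2 then F (S.flowMap q) else 0

theorem IsSimple.exitTime_le (hS : S.IsSimple) {T : ℝ} (hT : ∀ p t, S.Stays p t → t ≤ T)
    {p : CircleCoord} (hp : p.1 ∈ S.M) : S.exitTime p ≤ T :=
  hT p _ ((hS.stays_iff hp (exitTime_nonneg p)).2 le_rfl)

/-- The moving limit of integration is absorbed into the extension by zero, so that differentiation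
never touches the exit time. -/
theorem IsSimple.transport_eq (hS : S.IsSimple) {T : ℝ} (hT : ∀ p t, S.Stays p t → t ≤ T)
    {F : CircleCoord → ℂ} (hF : Continuous F) {p : CircleCoord} (hp : p.1 ∈ S.M) :
    S.transport F p = ∫ t in (0 : ℝ)..T, S.pull F (t, p) := by
  have h0 := exitTime_nonneg (S := S) p
  have h1 := hS.exitTime_le hT hp
  have hst := (hS.stays_iff hp h0).2 le_rfl
  have hc : Continuous fun t => F (S.flowMap (t, p)) :=
    hF.comp (S.contDiff_flowMap.continuous.comp (by fun_prop))
  have e1 : EqOn (fun t => F (S.flow p t)) (fun t => S.pull F (t, p)) (uIcc 0 (S.exitTime p)) := by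
    intro t ht
    rw [uIcc_of_le h0] at ht
    simp only [pull, if_pos ht.2]
    rw [(hst.mono ht.2).flow_eq ht.1]
    rfl
  have e2 : ∀ t ∈ uIoc (S.exitTime p) T, S.pull F (t, p) = 0 := by
    intro t ht
    rw [uIoc_of_le h1] at ht
    simp only [pull, if_neg (not_le.2 ht.1)]
  have i1 : IntervalIntegrable (fun t => S.pull F (t, p)) volume 0 (S.exitTime p) := by
    refine (hc.intervalIntegrable 0 (S.exitTime p)).congr fun t ht => ?_
    rw [uIoc_of_le h0] at ht
    simp only [pull, if_pos ht.2]
  have i2 : IntervalIntegrable (fun t => S.pull F (t, p)) volume (S.exitTime p) T := by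
    refine (intervalIntegrable_const (c := (0 : ℂ))).congr fun t ht => (e2 t ht).symm
  rw [transport, intervalIntegral.integral_congr e1,
    ← intervalIntegral.integral_add_adjacent_intervals i1 i2,
    intervalIntegral.integral_zero_ae (Eventually.of_forall e2), add_zero]

/-- Near a point before the exit time the transported function is `F ∘ Φ`. -/
theorem IsSimple.eventually_le_exitTime (hS : S.IsSimple) {t : ℝ} {p : CircleCoord}
    (hp : p.1 ∈ interior S.M) (ht : t < S.exitTime p) :
    ∀ᶠ q : ℝ × CircleCoord in 𝓝 (t, p), q.1 ≤ S.exitTime q.2 := by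
  obtain ⟨ρ, hρ⟩ := hS.exists_isConvexDefining
  have hpM := interior_subset hp
  have hst := (hS.stays_iff hpM (exitTime_nonneg p)).2 le_rfl
  rcases lt_or_ge t 0 with h0 | h0
  · filter_upwards [continuous_fst.continuousAt.eventually_lt (continuousAt_const (y := (0 : ℝ))) h0]
      with q hq using hq.le.trans (exitTime_nonneg _)
  have hint : ∀ s ∈ Icc 0 t, (S.Φ s p).1 ∈ interior S.M := fun s hs => by
    rcases hs.1.eq_or_lt with rfl | h
    · rwa [Φ_zero]
    · exact hst.interior_of_mem_Ioo hρ ⟨h, hs.2.trans_lt ht⟩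
  filter_upwards [eventually_stays_interior hint h0] with q hq
  rcases lt_or_ge q.1 0 with h1 | h1
  · exact h1.le.trans (exitTime_nonneg _)
  · have h2 : S.Stays q.2 q.1 := fun s hs => interior_subset (hq h1 s hs)
    exact (hS.stays_iff (h2.mem h1) h1).1 h2

/-- A function with support in the interior is not seen after the exit time. -/
theorem IsSimple.eventually_pull_eq_zero (hS : S.IsSimple) {F : CircleCoord → ℂ}
    (hF : ∀ p, p.1 ∈ S.M → p.1 ∉ interior S.M → ∀ᶠ q in 𝓝 p, F q = 0) {t : ℝ} {p : CircleCoord}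
    (hp : p.1 ∈ interior S.M) (ht : S.exitTime p ≤ t) :
    ∀ᶠ q : ℝ × CircleCoord in 𝓝 (t, p), S.pull F q = 0 := by
  obtain ⟨ρ, hρ⟩ := hS.exists_isConvexDefining
  have hpM := interior_subset hp
  have h0 := exitTime_nonneg (S := S) p
  have hst := (hS.stays_iff hpM h0).2 le_rfl
  rcases ht.eq_or_lt with rfl | ht
  · have hM := hst (S.exitTime p) ⟨h0, le_rfl⟩
    -- The exit point lies on the boundary, as otherwise the geodesic would remain in `M` for
    -- longer; `F` vanishes near it, whichever branch of `pull` applies.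
    have hnot : (S.Φ (S.exitTime p) p).1 ∉ interior S.M := by
      intro hcon
      have hint : ∀ s ∈ Icc 0 (S.exitTime p), (S.Φ s p).1 ∈ interior S.M := fun s hs => by
        rcases hs.1.eq_or_lt with rfl | h
        · rwa [Φ_zero]
        · rcases hs.2.eq_or_lt with rfl | h'
          · exact hcon
          · exact hst.interior_of_mem_Ioo hρ ⟨h, h'⟩
      have hev := eventually_stays_interior hint h0
      have hev2 : ∀ᶠ t in 𝓝[>] (S.exitTime p), 0 ≤ t → ∀ s ∈ Icc 0 t,
          (S.Φ s p).1 ∈ interior S.M := by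
        have hc : ContinuousAt (fun t : ℝ => (t, p)) (S.exitTime p) := by fun_prop
        exact (hc.eventually hev).filter_mono nhdsWithin_le_nhds
      obtain ⟨t, h1, h2⟩ := (hev2.and self_mem_nhdsWithin).exists
      have h3 : S.exitTime p < t := h2
      have h4 : S.Stays p t := fun s hs => interior_subset (h1 (h0.trans h3.le) s hs)
      exact absurd ((hS.stays_iff hpM (h0.trans h3.le)).1 h4) (not_le.2 h3)
    have := (S.contDiff_flowMap.continuous.continuousAt (x := (S.exitTime p, p))).eventually
      (hF _ hM hnot)
    filter_upwards [this] with q hq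
    simp [pull, hq]
  -- Being outside `M` at some time `s < t` is an open condition, so nearby geodesics have exited
  -- before `t` too.
  · obtain ⟨s, hs, hsM⟩ := hS.exists_leaves hpM ht
    have h1 : ∀ᶠ q : ℝ × CircleCoord in 𝓝 (t, p), (S.Φ s q.2).1 ∉ S.M := by
      have hc : Continuous fun q : ℝ × CircleCoord => (S.Φ s q.2).1 :=
        ((S.contDiff_Φ_right s).continuous.comp continuous_snd).fst
      exact hc.continuousAt (x := (t, p)) |>.eventually
        (S.isCompact.isClosed.isOpen_compl.mem_nhds hsM)
    have h2 : ∀ᶠ q : ℝ × CircleCoord in 𝓝 (t, p), s < q.1 :=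
      continuousAt_const.eventually_lt continuous_fst.continuousAt hs.2
    have h3 : ∀ᶠ q : ℝ × CircleCoord in 𝓝 (t, p), q.2.1 ∈ S.M := by
      have hc : Continuous fun q : ℝ × CircleCoord => q.2.1 := continuous_snd.fst
      filter_upwards [hc.continuousAt.eventually (isOpen_interior.mem_nhds hp)] with q hq
        using interior_subset hq
    filter_upwards [h1, h2, h3] with q h1 h2 h3
    have : ¬ q.1 ≤ S.exitTime q.2 := fun hle => by
      have hs0 : 0 ≤ s := h0.trans hs.1.le
      have h4 := (hS.stays_iff h3 (hs0.trans h2.le)).2 hle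
      exact h1 (h4 s ⟨hs0, h2.le⟩)
    simp [pull, this]

/-- Near `(t, p)` the function is either `F ∘ Φ`, before the exit, or identically zero; the
vanishing of `F` near the boundary hides the discontinuity at the exit time. -/
theorem IsSimple.contDiffAt_pull (hS : S.IsSimple) {F : CircleCoord → ℂ} (hFs : ContDiff ℝ ∞ F)
    (hF : ∀ p, p.1 ∈ S.M → p.1 ∉ interior S.M → ∀ᶠ q in 𝓝 p, F q = 0) (t : ℝ) {p : CircleCoord}
    (hp : p.1 ∈ interior S.M) : ContDiffAt ℝ ∞ (S.pull F) (t, p) := by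
  rcases lt_or_ge t (S.exitTime p) with h | h
  · have : S.pull F =ᶠ[𝓝 (t, p)] fun q => F (S.flowMap q) := by
      filter_upwards [hS.eventually_le_exitTime hp h] with q hq
      simp [pull, hq]
    exact (hFs.comp S.contDiff_flowMap).contDiffAt.congr_of_eventuallyEq this
  · have : S.pull F =ᶠ[𝓝 (t, p)] fun _ => 0 := hS.eventually_pull_eq_zero hF hp h
    exact contDiffAt_const.congr_of_eventuallyEq this

theorem contDiff_mode {f : Plane → ℂ} (hf : ContDiff ℝ ∞ f) (k : ℤ) : ContDiff ℝ ∞ (mode k f) := by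
  have h : ContDiff ℝ ∞ fun p : CircleCoord => ((p.2 : ℝ) : ℂ) :=
    Complex.ofRealCLM.contDiff.comp contDiff_snd
  exact (hf.comp contDiff_fst).mul (contDiff_const.mul h).cexp

theorem IsTestFunction.eventually_mode_eq_zero {f : Plane → ℂ} (hf : S.IsTestFunction f) (k : ℤ)
    (p : CircleCoord) (hp : p.1 ∉ interior S.M) : ∀ᶠ q in 𝓝 p, mode k f q = 0 := by
  have h1 : p.1 ∉ tsupport f := fun h => hp (hf.2.2 h)
  have h2 := (continuous_fst (X := Plane) (Y := ℝ)).continuousAt (x := p) |>.eventually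
    (notMem_tsupport_iff_eventuallyEq.1 h1)
  filter_upwards [h2] with q hq
  rw [mode, hq]
  simp

end RiemannianSurface

namespace RiemannianSurface

open Filter Topology

variable {S : RiemannianSurface}

/-! ### Integration by parts on the circle -/

theorem fderiv_mode_V {f : Plane → ℂ} (hf : ContDiff ℝ ∞ f) (k : ℤ) (p q : CircleCoord) :
    fderiv ℝ (mode k f) p (V q) = Complex.I * k * mode k f p := by
  have h1 := (((contDiff_mode hf k).differentiable (by simp)) p).hasFDerivAt.comp_hasDerivAt
    (f := fun θ : ℝ => (p.1, θ)) p.2 ((hasDerivAt_const p.2 p.1).prodMk (hasDerivAt_id p.2))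
  have h2 : HasDerivAt (fun θ : ℝ => f p.1 * Complex.exp (Complex.I * k * θ))
      (f p.1 * (Complex.exp (Complex.I * k * p.2) * (Complex.I * k))) p.2 := by
    have := (((hasDerivAt_id p.2).ofReal_comp.const_mul (Complex.I * k)).cexp).const_mul (f p.1)
    simpa using this
  have h3 := h1.unique h2
  rw [V, h3, mode]
  ring

/-- The derivative of the transported function in the direction `X_⊥`. -/
def perpPull (S : RiemannianSurface) (F : CircleCoord → ℂ) (q : ℝ × CircleCoord) : ℂ :=
  partialFDeriv (S.pull F) q.1 q.2 (S.Xperp q.2)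

theorem IsSimple.partialFDeriv_pull (hS : S.IsSimple) {F : CircleCoord → ℂ} (hF : ContDiff ℝ ∞ F)
    (w : CircleCoord → CircleCoord) {t : ℝ} {p : CircleCoord} (hp : p.1 ∈ interior S.M)
    (ht : t < S.exitTime p) : partialFDeriv (S.pull F) t p (w p) =
      fderiv ℝ F (S.Φ t p) (S.flowDeriv w (t, p)) := by
  have h : S.pull F =ᶠ[𝓝 (t, p)] fun q => F (S.flowMap q) := by
    filter_upwards [hS.eventually_le_exitTime hp ht] with q hq
    simp [pull, hq]
  have h2 := ((hF.differentiable (by simp)) (S.flowMap (t, p))).hasFDerivAt.comp (t, p)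
    ((S.contDiff_flowMap.differentiable (by simp)) (t, p)).hasFDerivAt
  have h3 : fderiv ℝ (S.pull F) (t, p) = _ := h.fderiv_eq.trans h2.fderiv
  rw [partialFDeriv, h3]
  rfl

/-- The pulled-back derivatives along `X_⊥` and `V` are `a X_⊥f - a' Vf` and `b' Vf - b X_⊥f`.
Adding `b` times the first to `a` times the second cancels `X_⊥ f` and leaves the Wronskian times `V
f = ik f`. -/
theorem IsSimple.jacB_mul_perpPull (hS : S.IsSimple) {f : Plane → ℂ} (hf : ContDiff ℝ ∞ f) (k : ℤ)
    {t : ℝ} {p : CircleCoord} (hp : p.1 ∈ interior S.M) (h0 : 0 ≤ t) (ht : t < S.exitTime p) :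
    (S.jacB (t, p) : ℂ) * S.perpPull (mode k f) (t, p) =
      -(S.jacA (t, p) : ℂ) * partialFDeriv (S.pull (mode k f)) t p (V p) +
        Complex.I * k * S.pull (mode k f) (t, p) := by
  have hst := (hS.stays_iff (interior_subset hp) h0).2 ht.le
  have hw : (S.jacA (t, p) : ℂ) * S.jacB' (t, p) - S.jacA' (t, p) * S.jacB (t, p) = 1 := by
    exact_mod_cast hst.wronskian h0
  have hpull : S.pull (mode k f) (t, p) = mode k f (S.Φ t p) := by
    simp [pull, ht.le, flowMap]
  rw [perpPull, hS.partialFDeriv_pull (contDiff_mode hf k) S.Xperp hp ht,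
    hS.partialFDeriv_pull (contDiff_mode hf k) V hp ht, hst.flowDeriv_Xperp h0, hst.flowDeriv_V h0,
    hpull]
  simp only [map_sub, map_smul, fderiv_mode_V hf, Complex.real_smul]
  linear_combination (Complex.I * k * mode k f (S.Φ t p)) * hw

theorem flowMap_add_period (q : ℝ × CircleCoord) (n : ℤ) :
    S.flowMap (q + (0, (0, n * (2 * Real.pi)))) = S.flowMap q + (0, n * (2 * Real.pi)) := by
  simp [flowMap, Φ_periodic]

theorem Xperp_add_period (p : CircleCoord) (n : ℤ) :
    S.Xperp (p + (0, n * (2 * Real.pi))) = S.Xperp p := by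
  simp [Xperp_apply, Real.cos_add_int_mul_two_pi, Real.sin_add_int_mul_two_pi]

theorem fderiv_flowMap_add_period (q : ℝ × CircleCoord) (n : ℤ) :
    fderiv ℝ S.flowMap (q + (0, (0, n * (2 * Real.pi)))) = fderiv ℝ S.flowMap q := by
  rw [← fderiv_comp_add_right]
  simp only [flowMap_add_period]
  exact fderiv_add_const _

theorem jacA_add_period (q : ℝ × CircleCoord) (n : ℤ) :
    S.jacA (q + (0, (0, n * (2 * Real.pi)))) = S.jacA q := by
  simp only [jacA, flowDeriv, fderiv_flowMap_add_period, flowMap_add_period, coordY,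
    Xperp_add_period, Prod.snd_add]
  simp

theorem jacB_add_period (q : ℝ × CircleCoord) (n : ℤ) :
    S.jacB (q + (0, (0, n * (2 * Real.pi)))) = S.jacB q := by
  simp only [jacB, flowDeriv, fderiv_flowMap_add_period, flowMap_add_period, coordY,
    Xperp_add_period, V]
  simp

theorem exp_period (k n : ℤ) (θ : ℂ) :
    Complex.exp (Complex.I * k * (θ + n * (2 * Real.pi))) = Complex.exp (Complex.I * k * θ) := by
  have : Complex.I * k * (θ + n * (2 * Real.pi)) =
      Complex.I * k * θ + ((k * n : ℤ) : ℂ) * (2 * Real.pi * Complex.I) := by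
    push_cast; ring
  rw [this, Complex.exp_add, Complex.exp_int_mul_two_pi_mul_I, mul_one]

theorem mode_add_period (k : ℤ) (f : Plane → ℂ) (p : CircleCoord) (n : ℤ) :
    mode k f (p + (0, n * (2 * Real.pi))) = mode k f p := by
  simp only [mode, Prod.fst_add, Prod.snd_add, add_zero]
  push_cast
  rw [exp_period]

theorem pull_mode_add_period (k : ℤ) (f : Plane → ℂ) (q : ℝ × CircleCoord) (n : ℤ) :
    S.pull (mode k f) (q + (0, (0, n * (2 * Real.pi)))) = S.pull (mode k f) q := by
  simp only [pull, flowMap_add_period, mode_add_period, Prod.fst_add, Prod.snd_add,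
    exitTime_add_period, add_zero]

/-- The factor that multiplies the transported function after integration by parts. -/
def kernelFactor (S : RiemannianSurface) (k : ℤ) (q : ℝ × CircleCoord) : ℂ :=
  ((S.jacB q * angleDeriv S.jacA q - S.jacA q * angleDeriv S.jacB q) / S.jacB q ^ 2 : ℝ) -
    Complex.I * k * ((S.jacA q - 1) / S.jacB q : ℝ)

/-- The periodic function whose derivative gives the integration by parts. -/
def boundaryTerm (S : RiemannianSurface) (k : ℤ) (f : Plane → ℂ) (t : ℝ) (x : Plane) (s : ℝ) : ℂ :=
  Complex.exp (-(Complex.I * k * s)) * (S.jacA (t, (x, s)) / S.jacB (t, (x, s)) : ℝ) *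
    S.pull (mode k f) (t, (x, s))

theorem hasDerivAt_exp_neg (k : ℤ) (s : ℝ) :
    HasDerivAt (fun s : ℝ => Complex.exp (-(Complex.I * k * s)))
      (Complex.exp (-(Complex.I * k * s)) * (-(Complex.I * k))) s := by
  have := ((hasDerivAt_id s).ofReal_comp.const_mul (Complex.I * k)).fun_neg.cexp
  simpa using this

theorem contDiff_exp_neg (k : ℤ) : ContDiff ℝ ∞ (fun s : ℝ => Complex.exp (-(Complex.I * k * s))) :=
  (contDiff_const.mul Complex.ofRealCLM.contDiff).neg.cexp

section

variable {f : Plane → ℂ} {k : ℤ} {t : ℝ} {x : Plane} {s : ℝ}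

/-- Before the exit time `b ≠ 0`, and this is the product rule with the vertical derivative
eliminated by `jacB_mul_perpPull`. From the exit time on all terms vanish locally, so zeros of `b`
there are harmless. -/
theorem IsSimple.hasDerivAt_boundaryTerm (hS : S.IsSimple) (hf : S.IsTestFunction f) (k : ℤ)
    (hx : x ∈ interior S.M) (ht : 0 < t) (s : ℝ) :
    HasDerivAt (S.boundaryTerm k f t x)
      (Complex.exp (-(Complex.I * k * s)) * S.kernelFactor k (t, (x, s)) *
        S.pull (mode k f) (t, (x, s)) -
      S.perpPull (mode k f) (t, (x, s)) * Complex.exp (-(Complex.I * k * s))) s := by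
  rcases lt_or_ge t (S.exitTime (x, s)) with h | h
  · have hst := (hS.stays_iff (p := (x, s)) (interior_subset hx) ht.le).2 h.le
    have hb := hS.jacB_ne_zero hst ht
    have hbc : (S.jacB (t, (x, s)) : ℂ) ≠ 0 := by exact_mod_cast hb
    have dA := hasDerivAt_angle (S.contDiff_jacA.differentiable (by simp)) t x s
    have dB := hasDerivAt_angle (S.contDiff_jacB.differentiable (by simp)) t x s
    have dh : HasDerivAt (fun s => S.pull (mode k f) (t, (x, s)))
        (partialFDeriv (S.pull (mode k f)) t (x, s) (V (x, s))) s :=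
      ((hS.contDiffAt_pull (contDiff_mode hf.1 k) (fun p _ hp => hf.eventually_mode_eq_zero k p hp)
        t (p := (x, s)) hx).differentiableAt (by simp)).hasFDerivAt.comp_hasDerivAt
        (f := fun s : ℝ => (t, ((x, s) : CircleCoord))) s
        ((hasDerivAt_const s t).prodMk ((hasDerivAt_const s x).prodMk (hasDerivAt_id s)))
    have hkey := hS.jacB_mul_perpPull hf.1 k (p := (x, s)) hx ht.le h
    have := ((hasDerivAt_exp_neg k s).mul (dA.div dB hb).ofReal_comp).mul dh
    refine this.congr_deriv ?_
    rw [← sub_eq_zero]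
    have hY : S.perpPull (mode k f) (t, (x, s)) =
      (-(S.jacA (t, (x, s)) : ℂ) * partialFDeriv (S.pull (mode k f)) t (x, s) (V (x, s)) +
        Complex.I * k * S.pull (mode k f) (t, (x, s))) / S.jacB (t, (x, s)) := by
      rw [eq_div_iff hbc, ← hkey]; ring
    rw [hY, kernelFactor]
    simp only [Pi.mul_apply, Pi.div_apply]
    push_cast
    field_simp
    ring
  · have hz := hS.eventually_pull_eq_zero
      (fun p _ hp => hf.eventually_mode_eq_zero k p hp) (p := (x, s)) hx h
    have h1 : fderiv ℝ (S.pull (mode k f)) (t, (x, s)) = 0 := by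
      have : S.pull (mode k f) =ᶠ[𝓝 (t, (x, s))] fun _ => 0 := hz
      rw [this.fderiv_eq]; simp
    have h2 : S.perpPull (mode k f) (t, (x, s)) = 0 := by
      simp [perpPull, partialFDeriv, h1]
    rw [h2, hz.self_of_nhds]
    have hc : ContinuousAt (fun s : ℝ => (t, ((x, s) : CircleCoord))) s := by fun_prop
    have h3 : S.boundaryTerm k f t x =ᶠ[𝓝 s] fun _ => 0 := by
      filter_upwards [hc.eventually hz] with r hr
      simp [boundaryTerm, hr]
    simpa using (hasDerivAt_const s (0 : ℂ)).congr_of_eventuallyEq h3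

theorem IsSimple.contDiff_boundaryTerm (hS : S.IsSimple) (hf : S.IsTestFunction f) (k : ℤ)
    (hx : x ∈ interior S.M) (ht : 0 < t) : ContDiff ℝ ∞ (S.boundaryTerm k f t x) := by
  rw [contDiff_iff_contDiffAt]
  intro s
  have hcurve : ContDiff ℝ ∞ (fun s : ℝ => (t, ((x, s) : CircleCoord))) := by fun_prop
  rcases lt_or_ge t (S.exitTime (x, s)) with h | h
  · have hst := (hS.stays_iff (p := (x, s)) (interior_subset hx) ht.le).2 h.le
    have hb := hS.jacB_ne_zero hst ht
    have h1 : ContDiffAt ℝ ∞ (fun s : ℝ => S.jacA (t, (x, s)) / S.jacB (t, (x, s))) s :=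
      (S.contDiff_jacA.comp hcurve).contDiffAt.div (S.contDiff_jacB.comp hcurve).contDiffAt hb
    have h2 : ContDiffAt ℝ ∞ (fun s => S.pull (mode k f) (t, (x, s))) s :=
      ContDiffAt.comp (g := S.pull (mode k f)) (f := fun s : ℝ => (t, ((x, s) : CircleCoord))) s
        (hS.contDiffAt_pull (contDiff_mode hf.1 k)
          (fun p _ hp => hf.eventually_mode_eq_zero k p hp) t (p := (x, s)) hx) hcurve.contDiffAt
    exact ((contDiff_exp_neg k).contDiffAt.mul (Complex.ofRealCLM.contDiff.contDiffAt.comp s h1)).mul h2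
  · have hz := hS.eventually_pull_eq_zero
      (fun p _ hp => hf.eventually_mode_eq_zero k p hp) (p := (x, s)) hx h
    have h3 : S.boundaryTerm k f t x =ᶠ[𝓝 s] fun _ => 0 := by
      filter_upwards [hcurve.continuous.continuousAt.eventually hz] with r hr
      simp [boundaryTerm, hr]
    exact contDiffAt_const.congr_of_eventuallyEq h3

theorem boundaryTerm_periodic : S.boundaryTerm k f t x (2 * Real.pi) = S.boundaryTerm k f t x 0 := by
  have e : ((t, (x, 2 * Real.pi)) : ℝ × CircleCoord) =
      (t, (x, 0)) + (0, (0, ((1 : ℤ) : ℝ) * (2 * Real.pi))) := by simp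
  have e2 : Complex.exp (-(Complex.I * k * ((2 * Real.pi : ℝ) : ℂ))) =
      Complex.exp (-(Complex.I * k * ((0 : ℝ) : ℂ))) := by
    have := exp_period (-k) 1 0
    push_cast at this ⊢
    simpa using this
  rw [boundaryTerm, e, jacA_add_period, jacB_add_period, pull_mode_add_period, e2, boundaryTerm]

theorem IsSimple.continuousAt_perpPull (hS : S.IsSimple) (hf : S.IsTestFunction f) (k : ℤ) (t : ℝ)
    {p : CircleCoord} (hp : p.1 ∈ interior S.M) : ContinuousAt (S.perpPull (mode k f)) (t, p) := by
  have h := (hS.contDiffAt_pull (contDiff_mode hf.1 k)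
    (fun p _ hp => hf.eventually_mode_eq_zero k p hp) t hp).continuousAt_fderiv (by simp)
  have h1 : ContinuousAt (fun q : ℝ × CircleCoord => partialFDeriv (S.pull (mode k f)) q.1 q.2) (t, p) :=
    h.clm_comp continuousAt_const
  exact h1.clm_apply (S.contDiff_Xperp.continuous.comp continuous_snd).continuousAt

/-- The derivative of the periodic boundary term integrates to zero. The time is fixed and positive
because `a/b` is singular at `t = 0`; only the combined kernel is bounded there. -/
theorem IsSimple.integral_perpPull (hS : S.IsSimple) (hf : S.IsTestFunction f) (k : ℤ)
    (hx : x ∈ interior S.M) (ht : 0 < t) :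
    ∫ s in (0 : ℝ)..(2 * Real.pi), S.perpPull (mode k f) (t, (x, s)) *
      Complex.exp (-(Complex.I * k * s)) =
    ∫ s in (0 : ℝ)..(2 * Real.pi), Complex.exp (-(Complex.I * k * s)) *
      S.kernelFactor k (t, (x, s)) * S.pull (mode k f) (t, (x, s)) := by
  have hd := hS.hasDerivAt_boundaryTerm hf k hx ht
  have hcont : Continuous (deriv (S.boundaryTerm k f t x)) :=
    (hS.contDiff_boundaryTerm hf k hx ht).continuous_deriv (by simp)
  have hY : Continuous fun s : ℝ => S.perpPull (mode k f) (t, (x, s)) *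
      Complex.exp (-(Complex.I * k * s)) := by
    refine Continuous.mul (continuous_iff_continuousAt.2 fun s => ?_) (contDiff_exp_neg k).continuous
    exact ContinuousAt.comp (f := fun s : ℝ => (t, ((x, s) : CircleCoord)))
      (hS.continuousAt_perpPull hf k t (p := (x, s)) hx) (by fun_prop)
  have h1 := intervalIntegral.integral_eq_sub_of_hasDerivAt (a := 0) (b := 2 * Real.pi)
    (f := S.boundaryTerm k f t x) (f' := deriv (S.boundaryTerm k f t x))
    (fun s _ => (hd s).differentiableAt.hasDerivAt) (hcont.intervalIntegrable _ _)
  rw [boundaryTerm_periodic, sub_self] at h1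
  have h2 : (fun s : ℝ => Complex.exp (-(Complex.I * k * s)) *
      S.kernelFactor k (t, (x, s)) * S.pull (mode k f) (t, (x, s))) =
      fun s => deriv (S.boundaryTerm k f t x) s + S.perpPull (mode k f) (t, (x, s)) *
      Complex.exp (-(Complex.I * k * s)) := by
    funext s
    rw [(hd s).deriv]; ring
  rw [h2, intervalIntegral.integral_add (hcont.intervalIntegrable _ _) (hY.intervalIntegrable _ _),
    h1, zero_add]

/-- The constant in the kernel bounds. -/
def IsSimple.kernelConst (hS : S.IsSimple) : ℝ := hS.exists_kernel_bounds.choose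

theorem IsSimple.kernelConst_pos (hS : S.IsSimple) : 0 < hS.kernelConst :=
  hS.exists_kernel_bounds.choose_spec.1

/-- The bound of the kernel factor. -/
def IsSimple.kernelBound (hS : S.IsSimple) (k : ℤ) : ℝ :=
  hS.kernelConst * (S.gradCurvatureSup + |(k : ℝ)| * S.curvatureSup)

theorem IsSimple.norm_kernelFactor_le (hS : S.IsSimple) (k : ℤ) {p : CircleCoord}
    (hp : p ∈ S.fundamentalSM) (ht : 0 < t) (h : S.Stays p t) :
    ‖S.kernelFactor k (t, p)‖ ≤ hS.kernelBound k := by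
  obtain ⟨hb, h1, h2⟩ := hS.exists_kernel_bounds.choose_spec.2 p hp t ht h
  rw [kernelFactor]
  refine (norm_sub_le _ _).trans ?_
  rw [norm_mul, norm_mul, Complex.norm_I, one_mul, Complex.norm_intCast, Complex.norm_real,
    Complex.norm_real, Real.norm_eq_abs, Real.norm_eq_abs, abs_div, abs_div, abs_pow, sq_abs]
  have e1 : |S.jacB (t, p) * angleDeriv S.jacA (t, p) - S.jacA (t, p) * angleDeriv S.jacB (t, p)| /
      S.jacB (t, p) ^ 2 ≤ hS.kernelConst * S.gradCurvatureSup := by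
    rw [div_le_iff₀ (by positivity)]; exact h1
  have e2 : |S.jacA (t, p) - 1| / |S.jacB (t, p)| ≤ hS.kernelConst * S.curvatureSup := by
    rw [div_le_iff₀ (by positivity)]; exact h2
  have e3 := mul_le_mul_of_nonneg_left e2 (abs_nonneg (k : ℝ))
  rw [kernelBound]
  linarith

theorem IsSimple.enorm_integral_perpPull_le (hS : S.IsSimple) (hf : S.IsTestFunction f) (k : ℤ)
    (hx : x ∈ interior S.M) (ht : 0 < t) :
    ‖∫ s in (0 : ℝ)..(2 * Real.pi), S.perpPull (mode k f) (t, (x, s)) *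
      Complex.exp (-(Complex.I * k * s))‖ₑ ≤
    ∫⁻ s in Ioc 0 (2 * Real.pi), ENNReal.ofReal (hS.kernelBound k) *
      ‖S.pull (mode k f) (t, (x, s))‖ₑ := by
  rw [hS.integral_perpPull hf k hx ht, intervalIntegral.integral_of_le Real.two_pi_pos.le]
  refine (enorm_integral_le_lintegral_enorm _).trans
    (setLIntegral_mono_ae' measurableSet_Ioc (Eventually.of_forall fun s hs => ?_))
  rw [enorm_mul, enorm_mul]
  have h1 : ‖Complex.exp (-(Complex.I * k * s))‖ₑ = 1 := by
    rw [← ofReal_norm, Complex.norm_exp]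
    simp
  rw [h1, one_mul]
  rcases le_or_gt t (S.exitTime (x, s)) with h | h
  · have hst := (hS.stays_iff (p := (x, s)) (interior_subset hx) ht.le).2 h
    gcongr
    rw [← ofReal_norm]
    exact ENNReal.ofReal_le_ofReal (hS.norm_kernelFactor_le k
      ⟨interior_subset hx, Ioc_subset_Icc_self hs⟩ ht hst)
  · simp [pull, not_le.2 h]

end

/-- The coefficient of the `k`-th fibrewise Fourier component. -/
def fourierCoeff (k : ℤ) (u : CircleCoord → ℂ) (x : Plane) : ℂ :=
  (1 / (2 * Real.pi) : ℂ) *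
    ∫ s in (0 : ℝ)..(2 * Real.pi), u (x, s) * Complex.exp (-(Complex.I * k * s))

/-! ### The pointwise bound of `W_k f` -/

section

variable {f : Plane → ℂ}

theorem IsSimple.contDiffOn_transport (hS : S.IsSimple) (hf : S.IsTestFunction f) (k : ℤ) :
    ContDiffOn ℝ 1 (S.transport (mode k f)) (interior S.M ×ˢ univ) := by
  obtain ⟨T, hT0, hT⟩ := hS.exists_time_bound
  have hO : IsOpen (interior S.M ×ˢ (univ : Set ℝ)) := isOpen_interior.prod isOpen_univ
  refine (contDiffOn_parametric_integral (h := S.pull (mode k f)) hT0.le hO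
    (fun t _ p hp => (hS.contDiffAt_pull (contDiff_mode hf.1 k)
    (fun p _ hp => hf.eventually_mode_eq_zero k p hp) t hp.1).of_le (by simp))).congr fun p hp => ?_
  exact hS.transport_eq hT (contDiff_mode hf.1 k).continuous (interior_subset hp.1)

theorem IsSimple.XperpDeriv_transport (hS : S.IsSimple) (hf : S.IsTestFunction f) (k : ℤ)
    {T : ℝ} (hT0 : 0 < T) (hT : ∀ p t, S.Stays p t → t ≤ T) {p : CircleCoord}
    (hp : p.1 ∈ interior S.M) :
    S.XperpDeriv (S.transport (mode k f)) p = ∫ t in (0 : ℝ)..T, S.perpPull (mode k f) (t, p) := by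
  have hO : IsOpen (interior S.M ×ˢ (univ : Set ℝ)) := isOpen_interior.prod isOpen_univ
  have hh : ∀ t ∈ Icc 0 T, ∀ p ∈ interior S.M ×ˢ (univ : Set ℝ),
      ContDiffAt ℝ 1 (S.pull (mode k f)) (t, p) := fun t _ p hp =>
    (hS.contDiffAt_pull (contDiff_mode hf.1 k)
      (fun p _ hp => hf.eventually_mode_eq_zero k p hp) t hp.1).of_le (by simp)
  have hd := hasFDerivAt_parametric_integral hT0.le hO hh (p := p) ⟨hp, trivial⟩
  have heq : S.transport (mode k f) =ᶠ[𝓝 p] fun p => ∫ t in (0 : ℝ)..T, S.pull (mode k f) (t, p) := by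
    filter_upwards [hO.mem_nhds (show p ∈ interior S.M ×ˢ (univ : Set ℝ) from ⟨hp, trivial⟩)]
      with q hq using hS.transport_eq hT (contDiff_mode hf.1 k).continuous (interior_subset hq.1)
  rw [XperpDeriv, heq.fderiv_eq, hd.fderiv, ContinuousLinearMap.intervalIntegral_apply]
  · rfl
  · refine ContinuousOn.intervalIntegrable fun t ht => ?_
    rw [uIcc_of_le hT0.le] at ht
    have h1 := ((hh t ht p ⟨hp, trivial⟩).continuousAt_fderiv (by simp)).clm_comp
      (continuousAt_const (y := ContinuousLinearMap.inr ℝ ℝ CircleCoord))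
    exact (ContinuousAt.comp (f := fun t : ℝ => (t, p)) h1 (by fun_prop)).continuousWithinAt

/-- The pointwise bound of `W_k f`. -/
theorem IsSimple.enorm_fourierCoeff_le (hS : S.IsSimple) (hf : S.IsTestFunction f) (k : ℤ)
    {T : ℝ} (hT0 : 0 < T) (hT : ∀ p t, S.Stays p t → t ≤ T) {x : Plane} (hx : x ∈ interior S.M) :
    ‖fourierCoeff k (S.XperpDeriv (S.transport (mode k f))) x‖ₑ ≤
      ∫⁻ t in Ioc 0 T, ∫⁻ s in Ioc 0 (2 * Real.pi), ENNReal.ofReal (hS.kernelBound k) *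
        ‖S.pull (mode k f) (t, (x, s))‖ₑ := by
  have hcont : Continuous fun q : ℝ × ℝ => S.perpPull (mode k f) (q.2, (x, q.1)) *
      Complex.exp (-(Complex.I * k * q.1)) := by
    refine Continuous.mul (continuous_iff_continuousAt.2 fun q => ?_)
      ((contDiff_exp_neg k).continuous.comp continuous_fst)
    exact ContinuousAt.comp (f := fun q : ℝ × ℝ => (q.2, ((x, q.1) : CircleCoord)))
      (hS.continuousAt_perpPull hf k q.2 (p := (x, q.1)) hx) (by fun_prop)
  -- Fubini puts the angular integral inside, so that the integration by parts applies at each time.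
  -- The unintegrated derivative is continuous, hence integrable on the rectangle.
  have e1 : ∫ s in (0 : ℝ)..(2 * Real.pi), S.XperpDeriv (S.transport (mode k f)) (x, s) *
      Complex.exp (-(Complex.I * k * s)) = ∫ t in (0 : ℝ)..T, ∫ s in (0 : ℝ)..(2 * Real.pi),
        S.perpPull (mode k f) (t, (x, s)) * Complex.exp (-(Complex.I * k * s)) := by
    rw [← intervalIntegral_intervalIntegral_swap (F := fun s t => S.perpPull (mode k f) (t, (x, s)) *
      Complex.exp (-(Complex.I * k * s)))]
    · refine intervalIntegral.integral_congr fun s _ => ?_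
      rw [hS.XperpDeriv_transport hf k hT0 hT (p := (x, s)) hx, intervalIntegral.integral_mul_const]
    · refine (hcont.continuousOn.integrableOn_compact
        ((isCompact_uIcc (a := (0 : ℝ)) (b := 2 * Real.pi)).prod
          (isCompact_uIcc (a := (0 : ℝ)) (b := T)))).mono_set
        (prod_mono uIoc_subset_uIcc uIoc_subset_uIcc)
  rw [fourierCoeff, e1, enorm_mul, intervalIntegral.integral_of_le hT0.le]
  have h1 : ‖(1 / (2 * Real.pi) : ℂ)‖ₑ ≤ 1 := by
    rw [← ofReal_norm, ← ENNReal.ofReal_one]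
    refine ENNReal.ofReal_le_ofReal ?_
    have : (1 / (2 * Real.pi) : ℂ) = ((1 / (2 * Real.pi) : ℝ) : ℂ) := by push_cast; rfl
    rw [this, Complex.norm_real, Real.norm_of_nonneg (by positivity),
      div_le_one Real.two_pi_pos]
    linarith [Real.two_le_pi]
  calc _ ≤ 1 * ∫⁻ t in Ioc 0 T, ‖∫ s in (0 : ℝ)..(2 * Real.pi),
        S.perpPull (mode k f) (t, (x, s)) * Complex.exp (-(Complex.I * k * s))‖ₑ := by
        gcongr
        exact enorm_integral_le_lintegral_enorm _
    _ ≤ _ := by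
        rw [one_mul]
        exact setLIntegral_mono_ae' measurableSet_Ioc (Eventually.of_forall fun t ht =>
          hS.enorm_integral_perpPull_le hf k hx ht.1)

end

end RiemannianSurface

/-! ### Preliminaries on measures -/

/-- Cauchy-Schwarz against the constant `1`. -/
theorem sq_lintegral_le {α : Type*} [MeasurableSpace α] (μ : Measure α) {g : α → ENNReal}
    (hg : AEMeasurable g μ) : (∫⁻ a, g a ∂μ) ^ 2 ≤ μ univ * ∫⁻ a, g a ^ 2 ∂μ := by
  have h := ENNReal.lintegral_mul_le_Lp_mul_Lq μ Real.HolderConjugate.two_two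
    (aemeasurable_const (b := (1 : ENNReal))) hg
  simp only [Pi.mul_apply, one_mul, lintegral_const, ENNReal.rpow_two, one_pow] at h
  calc _ ≤ (μ univ ^ (1 / 2 : ℝ) * (∫⁻ a, g a ^ 2 ∂μ) ^ (1 / 2 : ℝ)) ^ 2 := by gcongr
    _ = _ := by
      rw [mul_pow, ← ENNReal.rpow_natCast, ← ENNReal.rpow_natCast, ← ENNReal.rpow_mul,
        ← ENNReal.rpow_mul]
      norm_num

/-- A subset of the line on whose points a function with nonzero derivative vanishes is null. -/
theorem volume_zeros_eq_zero {h : ℝ → ℝ} {s : Set ℝ}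
    (hs : ∀ x ∈ s, h x = 0 ∧ ∃ h', h' ≠ 0 ∧ HasDerivAt h h' x) : volume s = 0 := by
  -- A nonzero derivative isolates each zero, so `{x}` is a neighbourhood of `x` within `s`.
  refine measure_null_of_locally_null s fun x hx => ⟨{x}, ?_, by simp⟩
  obtain ⟨-, h', hne, hd⟩ := hs x hx
  have h1 := hd.eventually_ne (c := 0) hne
  rw [eventually_nhdsWithin_iff] at h1
  rw [mem_nhdsWithin_iff_eventually]
  filter_upwards [h1] with z hz hzs
  by_contra hne
  exact hz hne (hs z hzs).1

/-- A regular level set in the plane is null. -/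
theorem volume_regular_level_eq_zero {ρ : Plane → ℝ} (hρ : ContDiff ℝ ∞ ρ)
    (hreg : ∀ x, ρ x = 0 → fderiv ℝ ρ x ≠ 0) : volume {x | ρ x = 0} = 0 := by
  have hd : Continuous (fderiv ℝ ρ) := hρ.continuous_fderiv (by simp)
  have hz : IsClosed {x | ρ x = 0} := isClosed_eq hρ.continuous continuous_const
  have hm : ∀ v : Plane, MeasurableSet ({x | ρ x = 0} ∩ {x | fderiv ℝ ρ x v ≠ 0}) := fun v =>
    hz.measurableSet.inter (isOpen_ne_fun (hd.clm_apply continuous_const)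
      continuous_const).measurableSet
  -- At a regular zero some partial derivative is nonzero. The zeros are split accordingly, and
  -- Fubini is applied along lines in that direction.
  have h1 : volume ({x | ρ x = 0} ∩ {x | fderiv ℝ ρ x (1, 0) ≠ 0}) = 0 := by
    rw [Measure.volume_eq_prod, Measure.prod_apply_symm (hm _)]
    refine lintegral_eq_zero_of_ae_eq_zero (Filter.Eventually.of_forall fun y => ?_)
    refine volume_zeros_eq_zero (h := fun x => ρ (x, y)) fun x hx => ⟨hx.1, _, hx.2, ?_⟩
    exact ((hρ.differentiable (by simp)) (x, y)).hasFDerivAt.comp_hasDerivAt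
      (f := fun x : ℝ => (x, y)) x ((hasDerivAt_id x).prodMk (hasDerivAt_const x y))
  have h2 : volume ({x | ρ x = 0} ∩ {x | fderiv ℝ ρ x (0, 1) ≠ 0}) = 0 := by
    rw [Measure.volume_eq_prod, Measure.prod_apply (hm _)]
    refine lintegral_eq_zero_of_ae_eq_zero (Filter.Eventually.of_forall fun x => ?_)
    refine volume_zeros_eq_zero (h := fun y => ρ (x, y)) fun y hy => ⟨hy.1, _, hy.2, ?_⟩
    exact ((hρ.differentiable (by simp)) (x, y)).hasFDerivAt.comp_hasDerivAt
      (f := fun y : ℝ => (x, y)) y ((hasDerivAt_const y x).prodMk (hasDerivAt_id y))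
  refine measure_mono_null (fun x hx => ?_) (measure_union_null h1 h2)
  by_contra hcon
  simp only [mem_union, mem_inter_iff, not_or, not_and, mem_ofPred_eq, not_not] at hcon
  refine hreg x hx (ContinuousLinearMap.ext fun v => ?_)
  have hv : v = v.1 • ((1, 0) : Plane) + v.2 • ((0, 1) : Plane) := by ext <;> simp
  rw [hv, map_add, map_smul, map_smul, hcon.1 hx, hcon.2 hx]
  simp

namespace RiemannianSurface

open Filter Topology

variable {S : RiemannianSurface}

theorem volume_boundary_eq_zero : volume (S.M \ interior S.M) = 0 := by
  obtain ⟨ρ, hρ⟩ := S.smooth_boundary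
  refine measure_mono_null (fun x hx => ?_) (volume_regular_level_eq_zero hρ.1 hρ.2.2)
  have h1 := (mem_iff_of_isDefiningFunction hρ).1 hx.1
  have h2 := fun h => hx.2 ((mem_interior_iff hρ).2 h)
  exact le_antisymm h1 (not_lt.1 h2)

theorem ae_mem_interior : ∀ᵐ x ∂(volume.restrict S.M), x ∈ interior S.M := by
  rw [ae_restrict_iff' S.isCompact.measurableSet, ae_iff]
  refine measure_mono_null (fun x hx => ?_) S.volume_boundary_eq_zero
  simpa using hx

/-! ### The flow distorts volumes by a bounded factor -/

theorem det_fderiv_Φ_ne_zero (t : ℝ) (p : CircleCoord) : (fderiv ℝ (S.Φ t) p).det ≠ 0 := by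
  have h1 := ((S.contDiff_Φ_right (-t)).differentiable (by simp) (S.Φ t p)).hasFDerivAt.comp p
    ((S.contDiff_Φ_right t).differentiable (by simp) p).hasFDerivAt
  have h2 : S.Φ (-t) ∘ S.Φ t = id := funext fun p => S.isGlobalFlow_Φ.neg_apply S.lipschitz_cutX t p
  rw [h2] at h1
  have h3 := h1.unique (hasFDerivAt_id p)
  have h4 := congrArg (fun L : CircleCoord →L[ℝ] CircleCoord => L.det) h3
  intro h0
  simp only [ContinuousLinearMap.det] at h4 h0
  rw [ContinuousLinearMap.toLinearMap_comp, LinearMap.det_comp, h0] at h4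
  simp at h4

theorem exists_det_lower_bound (S : RiemannianSurface) (T : ℝ) :
    ∃ c : ℝ, 0 < c ∧ ∀ t ∈ Icc 0 T, ∀ p ∈ S.fundamentalSM, c ≤ |(fderiv ℝ (S.Φ t) p).det| := by
  have hK : IsCompact (Icc 0 T ×ˢ S.fundamentalSM) := isCompact_Icc.prod S.isCompact_fundamentalSM
  have hc : Continuous fun q : ℝ × CircleCoord => |(fderiv ℝ (S.Φ q.1) q.2).det| := by
    refine (ContinuousLinearMap.continuous_det.comp ?_).abs
    have : (fun q : ℝ × CircleCoord => fderiv ℝ (S.Φ q.1) q.2) = fun q =>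
        (fderiv ℝ S.flowMap q).comp (ContinuousLinearMap.inr ℝ ℝ CircleCoord) :=
      funext fun q => (S.hasFDerivAt_Φ q.1 q.2).fderiv
    rw [this]
    exact (S.contDiff_flowMap.continuous_fderiv (by simp)).clm_comp continuous_const
  rcases (Icc 0 T ×ˢ S.fundamentalSM).eq_empty_or_nonempty with h | h
  · exact ⟨1, one_pos, fun t ht p hp => absurd (show (t, p) ∈ Icc 0 T ×ˢ S.fundamentalSM from
      ⟨ht, hp⟩) (by simp [h])⟩
  · obtain ⟨q, -, hq⟩ := hK.exists_isMinOn h hc.continuousOn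
    exact ⟨_, abs_pos.2 (S.det_fderiv_Φ_ne_zero q.1 q.2), fun t ht p hp =>
      hq (show (t, p) ∈ Icc 0 T ×ˢ S.fundamentalSM from ⟨ht, hp⟩)⟩

theorem abs_snd_Φ_le {t T : ℝ} (ht : t ∈ Icc 0 T) {p : CircleCoord} (hp : p ∈ S.fundamentalSM) :
    |(S.Φ t p).2| ≤ 2 * Real.pi + S.speed * T := by
  have h1 := S.isGlobalFlow_Φ.norm_sub_le_of_bounded S.norm_cutX_le t 0 p
  rw [S.Φ_zero, sub_zero, abs_of_nonneg ht.1] at h1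
  have h2 : |(S.Φ t p).2 - p.2| ≤ ‖S.Φ t p - p‖ := norm_snd_le (S.Φ t p - p)
  have h3 : |p.2| ≤ 2 * Real.pi := by rw [abs_of_nonneg hp.2.1]; exact hp.2.2
  have h4 : (S.speed : ℝ) * t ≤ S.speed * T := by gcongr; exact ht.2
  have h5 := abs_add_le ((S.Φ t p).2 - p.2) p.2
  rw [sub_add_cancel] at h5
  linarith

/-- The `L²` norm of a function transported by the flow. -/
theorem exists_lintegral_comp_Φ_le (S : RiemannianSurface) (T : ℝ) :
    ∃ C : NNReal, ∀ t ∈ Icc 0 T, ∀ g : Plane → ENNReal, Measurable g →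
      ∫⁻ p in S.M ×ˢ Ioc 0 (2 * Real.pi), g (S.Φ t p).1 ≤ C * ∫⁻ x, g x := by
  obtain ⟨c, hc, hdet⟩ := S.exists_det_lower_bound T
  set N : ℝ := 2 * Real.pi + S.speed * T with hN
  refine ⟨(c⁻¹).toNNReal * (2 * N).toNNReal, fun t ht g hg => ?_⟩
  set A : Set CircleCoord := S.M ×ˢ Ioc 0 (2 * Real.pi)
  have hA : MeasurableSet A := S.isCompact.measurableSet.prod measurableSet_Ioc
  have hAK : A ⊆ S.fundamentalSM := prod_mono subset_rfl Ioc_subset_Icc_self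
  have : (volume : Measure CircleCoord).IsAddHaarMeasure :=
    have : (volume : Measure Plane).IsAddHaarMeasure := Measure.prod.instIsAddHaarMeasure _ _
    Measure.prod.instIsAddHaarMeasure _ _
  have hcv := lintegral_image_eq_lintegral_abs_det_fderiv_mul volume hA
    (fun p _ => (((S.contDiff_Φ_right t).differentiable (by simp) p).hasFDerivAt).hasFDerivWithinAt)
    (fun p _ q _ h => by
      rw [← S.isGlobalFlow_Φ.neg_apply S.lipschitz_cutX t p, h,
        S.isGlobalFlow_Φ.neg_apply S.lipschitz_cutX]) (fun q => g q.1)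
  -- The angle moves with bounded speed, so the image lies in a slab of height `2N`, over which a
  -- function of `x` alone integrates to `2N ∫ g`. A lower bound on the Jacobian replaces invariance
  -- of the Liouville measure.
  have himg : S.Φ t '' A ⊆ univ ×ˢ Icc (-N) N := by
    rintro _ ⟨p, hp, rfl⟩
    exact ⟨trivial, abs_le.1 (S.abs_snd_Φ_le ht (hAK hp))⟩
  have h1 : ∫⁻ p in A, g (S.Φ t p).1 ≤
      ∫⁻ p in A, ENNReal.ofReal c⁻¹ * (ENNReal.ofReal |(fderiv ℝ (S.Φ t) p).det| *
        g (S.Φ t p).1) := by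
    refine setLIntegral_mono_ae' hA (Eventually.of_forall fun p hp => ?_)
    rw [← mul_assoc, ← ENNReal.ofReal_mul (by positivity)]
    refine le_mul_of_one_le_left' (ENNReal.one_le_ofReal.2 ?_)
    rw [inv_mul_eq_div, one_le_div hc]
    exact hdet t ht p (hAK hp)
  have h2 : ∫⁻ q in univ ×ˢ Icc (-N) N, g (q : CircleCoord).1 =
      ENNReal.ofReal (2 * N) * ∫⁻ x, g x := by
    rw [Measure.volume_eq_prod, ← Measure.prod_restrict, Measure.restrict_univ,
      lintegral_prod (fun q : CircleCoord => g q.1) (hg.comp measurable_fst).aemeasurable]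
    simp only [lintegral_const, Measure.restrict_apply MeasurableSet.univ, univ_inter,
      Real.volume_Icc]
    rw [lintegral_mul_const _ hg, mul_comm, sub_neg_eq_add, two_mul]
  calc _ ≤ _ := h1
    _ = ENNReal.ofReal c⁻¹ * ∫⁻ q in S.Φ t '' A, g q.1 := by
      rw [lintegral_const_mul' _ _ ENNReal.ofReal_ne_top, hcv]
    _ ≤ ENNReal.ofReal c⁻¹ * ∫⁻ q in univ ×ˢ Icc (-N) N, g (q : CircleCoord).1 := by
      gcongr
    _ = _ := by
      rw [h2, ← mul_assoc, ENNReal.coe_mul]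
      rfl

end RiemannianSurface

/-! ### The `L²` bound of `W_k f` -/

namespace RiemannianSurface

open Filter Topology

variable {S : RiemannianSurface} {f : Plane → ℂ}

theorem enorm_mode (k : ℤ) (f : Plane → ℂ) (p : CircleCoord) : ‖mode k f p‖ₑ = ‖f p.1‖ₑ := by
  have h1 : ‖Complex.exp (Complex.I * k * p.2)‖ₑ = 1 := by
    rw [← ofReal_norm, Complex.norm_exp]
    simp
  rw [mode, enorm_mul, h1, mul_one]

theorem enorm_pull_mode_le (k : ℤ) (f : Plane → ℂ) (t : ℝ) (p : CircleCoord) :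
    ‖S.pull (mode k f) (t, p)‖ₑ ≤ ‖f (S.Φ t p).1‖ₑ := by
  rw [pull]
  split_ifs
  · rw [enorm_mode]; rfl
  · simp

/-- The modulus of the transported function over the interior, extended by zero. -/
def pullModulus (S : RiemannianSurface) (k : ℤ) (f : Plane → ℂ) : ℝ × CircleCoord → ENNReal :=
  (univ ×ˢ (interior S.M ×ˢ univ)).indicator fun q => ‖S.pull (mode k f) q‖ₑ

/-- Over the interior `pull` is continuous, so the extension by zero is measurable with no
information on the exit time. -/
theorem IsSimple.measurable_pullModulus (hS : S.IsSimple) (hf : S.IsTestFunction f) (k : ℤ) :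
    Measurable (S.pullModulus k f) := by
  have hO : IsOpen ((univ : Set ℝ) ×ˢ (interior S.M ×ˢ (univ : Set ℝ))) :=
    isOpen_univ.prod (isOpen_interior.prod isOpen_univ)
  have hc : ContinuousOn (S.pull (mode k f)) (univ ×ˢ (interior S.M ×ˢ univ)) := fun q hq =>
    (hS.contDiffAt_pull (contDiff_mode hf.1 k)
      (fun p _ hp => hf.eventually_mode_eq_zero k p hp) q.1 hq.2.1).continuousAt.continuousWithinAt
  classical
  have h := hc.enorm.measurable_piecewise (g := 0) continuousOn_const hO.measurableSet
  rwa [piecewise_eq_indicator] at h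

theorem pullModulus_of_mem (k : ℤ) (f : Plane → ℂ) {q : ℝ × CircleCoord}
    (hq : q.2.1 ∈ interior S.M) : S.pullModulus k f q = ‖S.pull (mode k f) q‖ₑ :=
  indicator_of_mem (show q ∈ univ ×ˢ (interior S.M ×ˢ univ) from ⟨trivial, hq, trivial⟩) _

theorem pullModulus_le (k : ℤ) (f : Plane → ℂ) (t : ℝ) (p : CircleCoord) :
    S.pullModulus k f (t, p) ≤ ‖f (S.Φ t p).1‖ₑ :=
  (indicator_le_self _ _ _).trans (S.enorm_pull_mode_le k f t p)

/-- Cauchy-Schwarz in time and in angle costs the lengths `T` and `2π` of the two intervals. -/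
theorem IsSimple.enorm_fourierCoeff_sq_le (hS : S.IsSimple) (hf : S.IsTestFunction f) (k : ℤ)
    {T : ℝ} (hT0 : 0 < T) (hT : ∀ p t, S.Stays p t → t ≤ T) {x : Plane} (hx : x ∈ interior S.M) :
    ‖fourierCoeff k (S.XperpDeriv (S.transport (mode k f))) x‖ₑ ^ 2 ≤
      ENNReal.ofReal (hS.kernelBound k) ^ 2 * (ENNReal.ofReal T * (ENNReal.ofReal (2 * Real.pi) *
        ∫⁻ t in Ioc 0 T, ∫⁻ s in Ioc 0 (2 * Real.pi), S.pullModulus k f (t, (x, s)) ^ 2)) := by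
  set B := ENNReal.ofReal (hS.kernelBound k)
  set g := S.pullModulus k f
  have hg : Measurable g := hS.measurable_pullModulus hf k
  have hgx : Measurable fun q : ℝ × ℝ => g (q.1, (x, q.2)) := hg.comp (by fun_prop)
  have h1 := hS.enorm_fourierCoeff_le hf k hT0 hT hx
  have h2 : ∫⁻ t in Ioc 0 T, ∫⁻ s in Ioc 0 (2 * Real.pi), B * ‖S.pull (mode k f) (t, (x, s))‖ₑ =
      B * ∫⁻ t in Ioc 0 T, ∫⁻ s in Ioc 0 (2 * Real.pi), g (t, (x, s)) := by
    rw [← lintegral_const_mul' _ _ ENNReal.ofReal_ne_top]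
    refine lintegral_congr fun t => ?_
    rw [← lintegral_const_mul' _ _ ENNReal.ofReal_ne_top]
    exact lintegral_congr fun s => by rw [← pullModulus_of_mem k f (q := (t, (x, s))) hx]
  rw [h2] at h1
  have h3 := sq_lintegral_le (volume.restrict (Ioc 0 T))
    (hgx.lintegral_prod_right' (ν := volume.restrict (Ioc 0 (2 * Real.pi)))).aemeasurable
  have h4 : ∀ t : ℝ, (∫⁻ s in Ioc 0 (2 * Real.pi), g (t, (x, s))) ^ 2 ≤
      ENNReal.ofReal (2 * Real.pi) * ∫⁻ s in Ioc 0 (2 * Real.pi), g (t, (x, s)) ^ 2 := fun t => by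
    have := sq_lintegral_le (volume.restrict (Ioc 0 (2 * Real.pi)))
      (g := fun s => g (t, (x, s))) (hg.comp (by fun_prop)).aemeasurable
    simpa using this
  calc _ ≤ (B * ∫⁻ t in Ioc 0 T, ∫⁻ s in Ioc 0 (2 * Real.pi), g (t, (x, s))) ^ 2 := by gcongr
    _ = B ^ 2 * (∫⁻ t in Ioc 0 T, ∫⁻ s in Ioc 0 (2 * Real.pi), g (t, (x, s))) ^ 2 := mul_pow _ _ _
    _ ≤ B ^ 2 * (ENNReal.ofReal T * ∫⁻ t in Ioc 0 T,
        ENNReal.ofReal (2 * Real.pi) * ∫⁻ s in Ioc 0 (2 * Real.pi), g (t, (x, s)) ^ 2) := by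
      gcongr
      refine h3.trans ?_
      simp only [Measure.restrict_apply MeasurableSet.univ, univ_inter, Real.volume_Ioc, sub_zero]
      gcongr
      exact h4 _
    _ = _ := by rw [lintegral_const_mul' _ _ ENNReal.ofReal_ne_top]

/-- The `L²` bound of `W_k f` with respect to the Lebesgue measure. -/
theorem IsSimple.exists_lintegral_fourierCoeff_le (hS : S.IsSimple) :
    ∃ C : NNReal, ∀ (k : ℤ) (f : Plane → ℂ), S.IsTestFunction f →
      ∫⁻ x in S.M, ‖fourierCoeff k (S.XperpDeriv (S.transport (mode k f))) x‖ₑ ^ 2 ≤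
        ENNReal.ofReal (hS.kernelBound k) ^ 2 * (C * ∫⁻ x, ‖f x‖ₑ ^ 2) := by
  obtain ⟨T, hT0, hT⟩ := hS.exists_time_bound
  obtain ⟨C, hC⟩ := S.exists_lintegral_comp_Φ_le T
  refine ⟨T.toNNReal * ((2 * Real.pi).toNNReal * (T.toNNReal * C)), fun k f hf => ?_⟩
  set g := S.pullModulus k f
  have hg : Measurable g := hS.measurable_pullModulus hf k
  have hg2 : Measurable fun q : (Plane × ℝ) × ℝ => g (q.1.2, (q.1.1, q.2)) ^ 2 :=
    (hg.comp (by fun_prop)).pow_const 2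
  have h1 : ∀ t ∈ Ioc 0 T, ∫⁻ x in S.M, ∫⁻ s in Ioc 0 (2 * Real.pi), g (t, (x, s)) ^ 2 ≤
      C * ∫⁻ x, ‖f x‖ₑ ^ 2 := fun t ht => by
    refine le_trans ?_ (hC t (Ioc_subset_Icc_self ht) (fun x => ‖f x‖ₑ ^ 2)
      (hf.1.continuous.enorm.measurable.pow_const 2))
    rw [Measure.volume_eq_prod Plane ℝ, ← Measure.prod_restrict,
      lintegral_prod (fun p : CircleCoord => ‖f (S.Φ t p).1‖ₑ ^ 2)]
    · gcongr with x s
      exact pullModulus_le k f t (x, s)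
    · refine ((Continuous.measurable ?_).pow_const 2).aemeasurable
      exact (hf.1.continuous.comp (continuous_fst.comp (S.contDiff_Φ_right t).continuous)).enorm
  calc _ ≤ ∫⁻ x in S.M, ENNReal.ofReal (hS.kernelBound k) ^ 2 * (ENNReal.ofReal T *
        (ENNReal.ofReal (2 * Real.pi) * ∫⁻ t in Ioc 0 T, ∫⁻ s in Ioc 0 (2 * Real.pi),
          g (t, (x, s)) ^ 2)) := by
        refine lintegral_mono_ae ?_
        filter_upwards [S.ae_mem_interior] with x hx using
          hS.enorm_fourierCoeff_sq_le hf k hT0 hT hx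
    _ = ENNReal.ofReal (hS.kernelBound k) ^ 2 * (ENNReal.ofReal T *
        (ENNReal.ofReal (2 * Real.pi) * ∫⁻ t in Ioc 0 T, ∫⁻ x in S.M,
          ∫⁻ s in Ioc 0 (2 * Real.pi), g (t, (x, s)) ^ 2)) := by
        rw [lintegral_const_mul' _ _ (by simp), lintegral_const_mul' _ _ ENNReal.ofReal_ne_top,
          lintegral_const_mul' _ _ ENNReal.ofReal_ne_top, lintegral_lintegral_swap]
        exact (hg2.lintegral_prod_right' (ν := volume.restrict (Ioc 0 (2 * Real.pi)))).aemeasurable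
    _ ≤ ENNReal.ofReal (hS.kernelBound k) ^ 2 * (ENNReal.ofReal T *
        (ENNReal.ofReal (2 * Real.pi) * ∫⁻ t in Ioc 0 T, C * ∫⁻ x, ‖f x‖ₑ ^ 2)) := by
        gcongr ENNReal.ofReal (hS.kernelBound k) ^ 2 * (ENNReal.ofReal T *
          (ENNReal.ofReal (2 * Real.pi) * ?_))
        exact setLIntegral_mono_ae' measurableSet_Ioc (Eventually.of_forall h1)
    _ = _ := by
        rw [setLIntegral_const, Real.volume_Ioc, sub_zero]
        simp only [ENNReal.coe_mul, ENNReal.ofReal]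
        ring

/-! ### The weighted measure on the surface -/

/-- The Riemannian area measure of `M`. -/
def area (S : RiemannianSurface) : Measure Plane :=
  (volume.restrict S.M).withDensity fun x => ENNReal.ofReal (S.areaDensity x)

theorem measurable_areaDensity : Measurable fun x => ENNReal.ofReal (S.areaDensity x) :=
  S.contDiff_areaDensity.continuous.measurable.ennreal_ofReal

theorem area_absolutelyContinuous : S.area ≪ volume.restrict S.M :=
  withDensity_absolutelyContinuous _ _

theorem exists_areaDensity_bounds (S : RiemannianSurface) :
    ∃ m K : ℝ, 0 < m ∧ 0 < K ∧ ∀ x ∈ S.M, m ≤ S.areaDensity x ∧ S.areaDensity x ≤ K := by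
  obtain ⟨a, -, ha⟩ := S.isCompact.exists_isMinOn S.nonempty
    S.contDiff_areaDensity.continuous.continuousOn
  obtain ⟨b, -, hb⟩ := S.isCompact.exists_isMaxOn S.nonempty
    S.contDiff_areaDensity.continuous.continuousOn
  exact ⟨_, _, S.areaDensity_pos a, S.areaDensity_pos b, fun x hx => ⟨ha hx, hb hx⟩⟩

theorem lintegral_area_le {K : ℝ} (hK : ∀ x ∈ S.M, S.areaDensity x ≤ K) (g : Plane → ENNReal) :
    ∫⁻ x, g x ∂S.area ≤ ENNReal.ofReal K * ∫⁻ x in S.M, g x := by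
  rw [area, lintegral_withDensity_eq_lintegral_mul_non_measurable _ S.measurable_areaDensity
    (by simp), ← lintegral_const_mul' _ _ ENNReal.ofReal_ne_top]
  refine setLIntegral_mono_ae' S.isCompact.measurableSet (Eventually.of_forall fun x hx => ?_)
  simp only [Pi.mul_apply]
  gcongr
  exact hK x hx

theorem le_lintegral_area {m : ℝ} (hm : ∀ x ∈ S.M, m ≤ S.areaDensity x) (g : Plane → ENNReal) :
    ENNReal.ofReal m * ∫⁻ x in S.M, g x ≤ ∫⁻ x, g x ∂S.area := by
  rw [area, lintegral_withDensity_eq_lintegral_mul_non_measurable _ S.measurable_areaDensity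
    (by simp), ← lintegral_const_mul' _ _ ENNReal.ofReal_ne_top]
  refine setLIntegral_mono_ae' S.isCompact.measurableSet (Eventually.of_forall fun x hx => ?_)
  simp only [Pi.mul_apply]
  gcongr
  exact hm x hx

instance : IsFiniteMeasure S.area := by
  obtain ⟨m, K, -, -, h⟩ := S.exists_areaDensity_bounds
  refine ⟨?_⟩
  rw [← lintegral_one]
  refine (lintegral_area_le (fun x hx => (h x hx).2) _).trans_lt ?_
  rw [lintegral_one, Measure.restrict_apply MeasurableSet.univ, univ_inter]
  exact ENNReal.mul_lt_top ENNReal.ofReal_lt_top S.isCompact.measure_lt_top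

theorem IsTestFunction.eq_zero_of_notMem (hf : S.IsTestFunction f) {x : Plane} (hx : x ∉ S.M) :
    f x = 0 :=
  image_eq_zero_of_notMem_tsupport fun h => hx (interior_subset (hf.2.2 h))

theorem eLpNorm_two_sq {α : Type*} [MeasurableSpace α] (μ : Measure α) (g : α → ℂ) :
    eLpNorm g 2 μ ^ 2 = ∫⁻ x, ‖g x‖ₑ ^ 2 ∂μ := by
  have := eLpNorm_nnreal_pow_eq_lintegral (f := g) (μ := μ) (p := 2) (by simp)
  simpa using this

/-- The `L²` bound of `W_k f` with respect to the Riemannian area. -/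
theorem IsSimple.exists_eLpNorm_fourierCoeff_le (hS : S.IsSimple) :
    ∃ C : ℝ, 0 < C ∧ ∀ (k : ℤ) (f : Plane → ℂ), S.IsTestFunction f →
      eLpNorm (fourierCoeff k (S.XperpDeriv (S.transport (mode k f)))) 2 S.area ≤
        ENNReal.ofReal (C * (S.gradCurvatureSup + |(k : ℝ)| * S.curvatureSup)) *
          eLpNorm f 2 S.area := by
  obtain ⟨C, hC⟩ := hS.exists_lintegral_fourierCoeff_le
  obtain ⟨m, K, hm, hK, h⟩ := S.exists_areaDensity_bounds
  -- Passing between Lebesgue and Riemannian area costs the density bounds `K` and `m⁻¹`; the added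
  -- `1` keeps the constant positive.
  set D : ℝ := √(K * (C * m⁻¹)) + 1
  have hD : K * (C * m⁻¹) ≤ D ^ 2 := by
    have h0 : 0 ≤ K * (C * m⁻¹) := by positivity
    nlinarith [Real.sq_sqrt h0, Real.sqrt_nonneg (K * (C * m⁻¹))]
  have hD0 : 0 < D := by positivity
  refine ⟨D * hS.kernelConst, mul_pos hD0 hS.kernelConst_pos, fun k f hf => ?_⟩
  rw [mul_assoc, ← kernelBound]
  have h1 : ∫⁻ x, ‖f x‖ₑ ^ 2 ≤ ENNReal.ofReal m⁻¹ * ∫⁻ x, ‖f x‖ₑ ^ 2 ∂S.area := by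
    have e1 : ∫⁻ x, ‖f x‖ₑ ^ 2 = ∫⁻ x in S.M, ‖f x‖ₑ ^ 2 := by
      rw [← lintegral_indicator S.isCompact.measurableSet]
      refine lintegral_congr fun x => ?_
      by_cases hx : x ∈ S.M
      · simp [hx]
      · simp [hx, hf.eq_zero_of_notMem hx]
    have e2 := le_lintegral_area (fun x hx => (h x hx).1) fun x => ‖f x‖ₑ ^ 2
    rw [e1]
    refine le_trans ?_ (mul_le_mul_right e2 _)
    rw [← mul_assoc, ← ENNReal.ofReal_mul (by positivity), inv_mul_cancel₀ hm.ne']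
    simp
  refine (ENNReal.pow_le_pow_left_iff two_ne_zero).1 ?_
  rw [mul_pow, eLpNorm_two_sq, eLpNorm_two_sq]
  calc _ ≤ ENNReal.ofReal K * (ENNReal.ofReal (hS.kernelBound k) ^ 2 * (C *
        (ENNReal.ofReal m⁻¹ * ∫⁻ x, ‖f x‖ₑ ^ 2 ∂S.area))) := by
        refine (lintegral_area_le (fun x hx => (h x hx).2) _).trans ?_
        gcongr
        refine (hC k f hf).trans ?_
        gcongr
    _ = ENNReal.ofReal (K * (C * m⁻¹)) * (ENNReal.ofReal (hS.kernelBound k) ^ 2 *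
        ∫⁻ x, ‖f x‖ₑ ^ 2 ∂S.area) := by
        rw [ENNReal.ofReal_mul hK.le, ENNReal.ofReal_mul C.coe_nonneg, ENNReal.ofReal_coe_nnreal]
        ring
    _ ≤ ENNReal.ofReal (D ^ 2) * (ENNReal.ofReal (hS.kernelBound k) ^ 2 *
        ∫⁻ x, ‖f x‖ₑ ^ 2 ∂S.area) := by gcongr
    _ = _ := by
        rw [ENNReal.ofReal_mul hD0.le, ENNReal.ofReal_pow hD0.le]
        ring

end RiemannianSurface

namespace RiemannianSurface

open Filter Topology

variable {S : RiemannianSurface}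

/-! ### The operator on test functions -/

/-- The coefficient of `W_k f`. -/
def opCoeff (S : RiemannianSurface) (k : ℤ) (f : Plane → ℂ) : Plane → ℂ :=
  fourierCoeff k (S.XperpDeriv (S.transport (mode k f)))

theorem IsSimple.continuousOn_XperpDeriv (hS : S.IsSimple) {f : Plane → ℂ} (hf : S.IsTestFunction f)
    (k : ℤ) : ContinuousOn (S.XperpDeriv (S.transport (mode k f))) (interior S.M ×ˢ univ) :=
  ((hS.contDiffOn_transport hf k).continuousOn_fderiv_of_isOpen
    (isOpen_interior.prod isOpen_univ) le_rfl).clm_apply S.contDiff_Xperp.continuous.continuousOn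

theorem IsSimple.aestronglyMeasurable_opCoeff (hS : S.IsSimple) {f : Plane → ℂ}
    (hf : S.IsTestFunction f) (k : ℤ) : AEStronglyMeasurable (S.opCoeff k f) S.area := by
  classical
  set u : CircleCoord → ℂ := fun p => S.XperpDeriv (S.transport (mode k f)) p *
    Complex.exp (-(Complex.I * k * p.2))
  have hu : ContinuousOn u (interior S.M ×ˢ univ) := (hS.continuousOn_XperpDeriv hf k).mul
    ((contDiff_exp_neg k).continuous.comp continuous_snd).continuousOn
  have hO : IsOpen (interior S.M ×ˢ (univ : Set ℝ)) := isOpen_interior.prod isOpen_univ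
  have hm : Measurable ((interior S.M ×ˢ univ).indicator u) := by
    have h := hu.measurable_piecewise (g := 0) continuousOn_const hO.measurableSet
    rwa [piecewise_eq_indicator] at h
  have h1 := (hm.stronglyMeasurable.integral_prod_right'
    (ν := volume.restrict (Ioc 0 (2 * Real.pi)))).const_mul (1 / (2 * Real.pi) : ℂ)
  refine ⟨_, h1, ?_⟩
  filter_upwards [S.area_absolutelyContinuous.ae_le S.ae_mem_interior] with x hx
  rw [opCoeff, fourierCoeff, intervalIntegral.integral_of_le Real.two_pi_pos.le]
  congr 1
  refine integral_congr_ae (Eventually.of_forall fun s => ?_)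
  exact (indicator_of_mem (show (x, s) ∈ interior S.M ×ˢ univ from ⟨hx, trivial⟩) u).symm

/-- Additivity needs integrability and differentiability, which are known over the interior; the
rest of `M` is null. -/
theorem IsSimple.opCoeff_add (hS : S.IsSimple) {f g : Plane → ℂ} (hf : S.IsTestFunction f)
    (hg : S.IsTestFunction g) (hfg : S.IsTestFunction (f + g)) (k : ℤ) {x : Plane}
    (hx : x ∈ interior S.M) : S.opCoeff k (f + g) x = S.opCoeff k f x + S.opCoeff k g x := by
  obtain ⟨T, -, hT⟩ := hS.exists_time_bound
  have hO : IsOpen (interior S.M ×ˢ (univ : Set ℝ)) := isOpen_interior.prod isOpen_univ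
  have hc : ∀ {f : Plane → ℂ}, S.IsTestFunction f → ∀ p ∈ interior S.M ×ˢ (univ : Set ℝ),
      Continuous fun t : ℝ => S.pull (mode k f) (t, p) := fun hf p hp =>
    continuous_iff_continuousAt.2 fun t => ContinuousAt.comp (f := fun t : ℝ => (t, p))
      (hS.contDiffAt_pull (contDiff_mode hf.1 k)
        (fun p _ hp => hf.eventually_mode_eq_zero k p hp) t hp.1).continuousAt (by fun_prop)
  have h1 : ∀ p ∈ interior S.M ×ˢ (univ : Set ℝ), S.transport (mode k (f + g)) p =
      S.transport (mode k f) p + S.transport (mode k g) p := fun p hp => by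
    rw [hS.transport_eq hT (contDiff_mode hfg.1 k).continuous (interior_subset hp.1),
      hS.transport_eq hT (contDiff_mode hf.1 k).continuous (interior_subset hp.1),
      hS.transport_eq hT (contDiff_mode hg.1 k).continuous (interior_subset hp.1),
      ← intervalIntegral.integral_add ((hc hf p hp).intervalIntegrable _ _)
        ((hc hg p hp).intervalIntegrable _ _)]
    refine intervalIntegral.integral_congr fun t _ => ?_
    simp only [pull, mode, Pi.add_apply]
    split_ifs <;> ring
  have hd : ∀ {f : Plane → ℂ}, S.IsTestFunction f → ∀ p ∈ interior S.M ×ˢ (univ : Set ℝ),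
      DifferentiableAt ℝ (S.transport (mode k f)) p := fun hf p hp =>
    ((hS.contDiffOn_transport hf k).contDiffAt (hO.mem_nhds hp)).differentiableAt (by simp)
  have h2 : ∀ p ∈ interior S.M ×ˢ (univ : Set ℝ), S.XperpDeriv (S.transport (mode k (f + g))) p =
      S.XperpDeriv (S.transport (mode k f)) p + S.XperpDeriv (S.transport (mode k g)) p :=
    fun p hp => by
      have : S.transport (mode k (f + g)) =ᶠ[𝓝 p]
          S.transport (mode k f) + S.transport (mode k g) := by
        filter_upwards [hO.mem_nhds hp] with q hq using h1 q hq
      rw [XperpDeriv, this.fderiv_eq, fderiv_add (hd hf p hp) (hd hg p hp)]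
      rfl
  have hi : ∀ {f : Plane → ℂ}, S.IsTestFunction f → Continuous fun s : ℝ =>
      S.XperpDeriv (S.transport (mode k f)) (x, s) * Complex.exp (-(Complex.I * k * s)) := fun hf =>
    ((hS.continuousOn_XperpDeriv hf k).comp_continuous (by fun_prop)
      fun s => ⟨hx, trivial⟩).mul (contDiff_exp_neg k).continuous
  rw [opCoeff, opCoeff, opCoeff, fourierCoeff, fourierCoeff, fourierCoeff, ← mul_add,
    ← intervalIntegral.integral_add ((hi hf).intervalIntegrable _ _)
      ((hi hg).intervalIntegrable _ _)]
  congr 1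
  refine intervalIntegral.integral_congr fun s _ => ?_
  simp only [h2 (x, s) ⟨hx, trivial⟩, add_mul]

/-- Unlike additivity this holds at every point, since the default values of integrals and
derivatives are homogeneous too. -/
theorem opCoeff_smul (a : ℂ) (f : Plane → ℂ) (k : ℤ) (x : Plane) :
    S.opCoeff k (a • f) x = a * S.opCoeff k f x := by
  have h1 : S.transport (mode k (a • f)) = a • S.transport (mode k f) := funext fun p => by
    simp only [transport, mode, Pi.smul_apply, smul_eq_mul, mul_assoc,
      intervalIntegral.integral_const_mul]
  have h2 : ∀ p, S.XperpDeriv (S.transport (mode k (a • f))) p =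
      a * S.XperpDeriv (S.transport (mode k f)) p := fun p => by
    rw [h1, XperpDeriv, fderiv_const_smul_field]
    rfl
  simp only [opCoeff, fourierCoeff, h2, mul_assoc, intervalIntegral.integral_const_mul]
  ring

theorem IsSimple.memLp_opCoeff (hS : S.IsSimple) {f : Plane → ℂ} (hf : S.IsTestFunction f)
    (hfL : MemLp f 2 S.area) (k : ℤ) : MemLp (S.opCoeff k f) 2 S.area := by
  obtain ⟨C, -, hC⟩ := hS.exists_eLpNorm_fourierCoeff_le
  exact ⟨hS.aestronglyMeasurable_opCoeff hf k,
    (hC k f hf).trans_lt (ENNReal.mul_lt_top ENNReal.ofReal_lt_top hfL.2)⟩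

/-- The space of test functions. -/
def testFunctions (S : RiemannianSurface) : Submodule ℂ (Plane → ℂ) where
  carrier := {f | S.IsTestFunction f}
  zero_mem' := ⟨contDiff_const, HasCompactSupport.zero, by simp [tsupport]⟩
  add_mem' := fun {f g} hf hg => ⟨hf.1.add hg.1, hf.2.1.add hg.2.1,
    (tsupport_add f g).trans (union_subset hf.2.2 hg.2.2)⟩
  smul_mem' := fun a f hf => ⟨hf.1.const_smul a, hf.2.1.smul_left (f := fun _ => a),
    (tsupport_smul_subset_right (fun _ => a) f).trans hf.2.2⟩

theorem memLp_testFunction (f : S.testFunctions) : MemLp (f : Plane → ℂ) 2 S.area :=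
  f.2.1.continuous.memLp_of_hasCompactSupport f.2.2.1

/-- The embedding of the test functions into `L²(M)`. -/
def testToLp (S : RiemannianSurface) : S.testFunctions →ₗ[ℂ] Lp ℂ 2 S.area where
  toFun f := (S.memLp_testFunction f).toLp
  map_add' _ _ := rfl
  map_smul' _ _ := rfl

/-- A function orthogonal to all test functions vanishes almost everywhere on the interior by the
fundamental lemma of the calculus of variations, and the boundary is null. -/
theorem denseRange_testToLp : DenseRange S.testToLp := by
  have : (LinearMap.range S.testToLp)ᗮ = ⊥ := by
    rw [Submodule.eq_bot_iff]
    intro h hh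
    have h1 : ∀ᵐ x ∂S.area, x ∈ interior S.M → h x = 0 := by
      refine isOpen_interior.ae_eq_zero_of_integral_contDiff_smul_eq_zero
        ((((Lp.memLp h).integrable (by simp)).locallyIntegrable).locallyIntegrableOn _)
        fun g hg hgc hgs => ?_
      have hgt : S.IsTestFunction fun x => (g x : ℂ) := by
        have hsupp : (fun x => (g x : ℂ)) = Complex.ofReal ∘ g := rfl
        refine ⟨Complex.ofRealCLM.contDiff.comp hg, hgc.comp_left Complex.ofReal_zero, ?_⟩
        exact (closure_mono (Function.support_comp_subset Complex.ofReal_zero g)).trans hgs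
      have h2 := hh _ (LinearMap.mem_range_self S.testToLp ⟨_, hgt⟩)
      rw [L2.inner_def] at h2
      rw [← h2]
      refine integral_congr_ae ?_
      filter_upwards [(S.memLp_testFunction ⟨_, hgt⟩).coeFn_toLp] with x hx
      have hx' : S.testToLp ⟨_, hgt⟩ x = (g x : ℂ) := hx
      rw [hx']
      simp [mul_comm]
    refine Lp.ext ?_
    filter_upwards [h1, S.area_absolutelyContinuous.ae_le S.ae_mem_interior,
      Lp.coeFn_zero ℂ 2 S.area] with x hx hx2 h0
    rw [hx hx2, h0]
    rfl
  have h3 := (Submodule.topologicalClosure_eq_top_iff).2 this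
  have h4 := (Submodule.dense_iff_topologicalClosure_eq_top).2 h3
  rwa [LinearMap.coe_range] at h4

/-- `W_k` on the test functions. -/
def IsSimple.preOp (hS : S.IsSimple) (k : ℤ) : S.testFunctions →ₗ[ℂ] Lp ℂ 2 S.area where
  toFun f := (hS.memLp_opCoeff f.2 (S.memLp_testFunction f) k).toLp
  map_add' f g := by
    rw [← MemLp.toLp_add]
    refine MemLp.toLp_congr _ _ ?_
    filter_upwards [S.area_absolutelyContinuous.ae_le S.ae_mem_interior] with x hx
    exact hS.opCoeff_add f.2 g.2 (f + g).2 k hx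
  map_smul' a f := by
    rw [RingHom.id_apply, ← MemLp.toLp_const_smul]
    refine MemLp.toLp_congr _ _ (Eventually.of_forall fun x => ?_)
    exact opCoeff_smul a f k x

theorem IsSimple.exists_norm_preOp_le (hS : S.IsSimple) : ∃ C : ℝ, 0 < C ∧ ∀ k f,
    ‖hS.preOp k f‖ ≤ C * (S.gradCurvatureSup + |(k : ℝ)| * S.curvatureSup) * ‖S.testToLp f‖ := by
  obtain ⟨C, hC0, hC⟩ := hS.exists_eLpNorm_fourierCoeff_le
  refine ⟨C, hC0, fun k f => ?_⟩
  have hB : 0 ≤ C * (S.gradCurvatureSup + |(k : ℝ)| * S.curvatureSup) :=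
    mul_nonneg hC0.le (add_nonneg S.gradCurvatureSup_nonneg
      (mul_nonneg (abs_nonneg _) S.curvatureSup_nonneg))
  have h1 : ‖hS.preOp k f‖ = (eLpNorm (S.opCoeff k f) 2 S.area).toReal :=
    Lp.norm_toLp _ (hS.memLp_opCoeff f.2 (S.memLp_testFunction f) k)
  have h2 : ‖S.testToLp f‖ = (eLpNorm (f : Plane → ℂ) 2 S.area).toReal :=
    Lp.norm_toLp _ (S.memLp_testFunction f)
  rw [h1, h2, ← ENNReal.toReal_ofReal hB, ← ENNReal.toReal_mul]
  exact ENNReal.toReal_mono (ENNReal.mul_ne_top ENNReal.ofReal_ne_top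
    (S.memLp_testFunction f).2.ne) (hC k f f.2)

/-! ### The identification of `H_k` with `L²(M)` -/

theorem mode_congr_ae {g g' : Plane → ℂ} (k : ℤ) (h : g =ᵐ[S.area] g') :
    mode k g =ᵐ[S.volSM] mode k g' := by
  have := (Measure.quasiMeasurePreserving_fst (μ := S.area)
    (ν := volume.restrict (Ioc 0 (2 * Real.pi)))).ae h
  filter_upwards [this] with p hp
  rw [mode, hp, mode]

theorem eLpNorm_mode {g : Plane → ℂ} (hg : AEStronglyMeasurable g S.area) (k : ℤ) :
    eLpNorm (mode k g) 2 S.volSM = ENNReal.ofReal √(2 * Real.pi) * eLpNorm g 2 S.area := by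
  refine (ENNReal.pow_right_strictMono two_ne_zero).injective ?_
  rw [mul_pow, eLpNorm_two_sq, eLpNorm_two_sq, ← ENNReal.ofReal_pow (Real.sqrt_nonneg _),
    Real.sq_sqrt Real.two_pi_pos.le]
  simp only [enorm_mode]
  change ∫⁻ p : CircleCoord, ‖g p.1‖ₑ ^ 2 ∂(S.area.prod (volume.restrict (Ioc 0 (2 * Real.pi)))) = _
  rw [lintegral_prod (fun p : CircleCoord => ‖g p.1‖ₑ ^ 2)
    ((hg.comp_fst.enorm).pow_const 2)]
  simp only [lintegral_const, Measure.restrict_apply MeasurableSet.univ, univ_inter,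
    Real.volume_Ioc, sub_zero]
  rw [lintegral_mul_const'' _ (hg.enorm.pow_const 2), mul_comm]

theorem continuous_exp_mode (k : ℤ) :
    Continuous fun p : CircleCoord => Complex.exp (Complex.I * k * p.2) :=
  Complex.continuous_exp.comp (continuous_const.mul (Complex.continuous_ofReal.comp continuous_snd))

theorem memLp_mode {g : Plane → ℂ} (hg : MemLp g 2 S.area) (k : ℤ) :
    MemLp (mode k g) 2 S.volSM := by
  refine ⟨hg.1.comp_fst.mul (continuous_exp_mode k).aestronglyMeasurable, ?_⟩
  rw [S.eLpNorm_mode hg.1]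
  exact ENNReal.mul_lt_top ENNReal.ofReal_lt_top hg.2

/-- Multiplication by `e^{-ikθ}` recovers `g(x)` as a function on the product, and the fibre measure
is finite and nonzero. This makes `modeToH` surjective, as `H` asks no regularity of `f̃`. -/
theorem memLp_of_memLp_mode {g : Plane → ℂ} {k : ℤ} (h : MemLp (mode k g) 2 S.volSM) :
    MemLp g 2 S.area := by
  have h1 : AEStronglyMeasurable (fun p : CircleCoord => g p.1)
      (S.area.prod (volume.restrict (Ioc 0 (2 * Real.pi)))) := by
    refine (h.1.mul ((continuous_exp_mode (-k)).aestronglyMeasurable)).congr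
      (Eventually.of_forall fun p => ?_)
    simp only [Pi.mul_apply, mode, mul_assoc, ← Complex.exp_add]
    push_cast
    simp
  have h2 : AEStronglyMeasurable g S.area := h1.of_comp_fst (by
    rw [Ne, Measure.restrict_eq_zero, Real.volume_Ioc]
    simp [Real.pi_pos])
  refine ⟨h2, ?_⟩
  have h3 := h.2
  rw [S.eLpNorm_mode h2] at h3
  exact ENNReal.lt_top_of_mul_ne_top_right h3.ne
    (ENNReal.ofReal_pos.2 (Real.sqrt_pos.2 Real.two_pi_pos)).ne'

/-- The map `f̃ ↦ f̃(x) e^{ikθ}` from `L²(M)` to `H_k`. -/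
def modeToH (S : RiemannianSurface) (k : ℤ) : Lp ℂ 2 S.area →ₗ[ℂ] S.H k where
  toFun g := ⟨(memLp_mode (Lp.memLp g) k).toLp, g, MemLp.coeFn_toLp _⟩
  map_add' g g' := Subtype.ext (by
    refine Eq.trans ?_ (MemLp.toLp_add (memLp_mode (Lp.memLp g) k) (memLp_mode (Lp.memLp g') k))
    refine MemLp.toLp_congr (memLp_mode (Lp.memLp (g + g')) k) _ ((mode_congr_ae k (Lp.coeFn_add g g')).trans
      (Eventually.of_forall fun p => ?_))
    simp [mode, add_mul])
  map_smul' a g := Subtype.ext (by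
    refine Eq.trans ?_ (MemLp.toLp_const_smul a (memLp_mode (Lp.memLp g) k))
    refine MemLp.toLp_congr (memLp_mode (Lp.memLp (a • g)) k) _ ((mode_congr_ae k (Lp.coeFn_smul a g)).trans
      (Eventually.of_forall fun p => ?_))
    simp [mode, mul_assoc])

theorem modeToH_ae (k : ℤ) (g : Lp ℂ 2 S.area) :
    (S.modeToH k g : Lp ℂ 2 S.volSM) =ᵐ[S.volSM] mode k g :=
  MemLp.coeFn_toLp (memLp_mode (Lp.memLp g) k)

theorem norm_modeToH (k : ℤ) (g : Lp ℂ 2 S.area) : ‖S.modeToH k g‖ = √(2 * Real.pi) * ‖g‖ := by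
  have h1 : ‖S.modeToH k g‖ = (eLpNorm (mode k g) 2 S.volSM).toReal :=
    Lp.norm_toLp _ (memLp_mode (Lp.memLp g) k)
  rw [h1, S.eLpNorm_mode (Lp.aestronglyMeasurable g), ENNReal.toReal_mul,
    ENNReal.toReal_ofReal (Real.sqrt_nonneg _), Lp.norm_def]

theorem modeToH_eq_of_ae {k : ℤ} {u : S.H k} {g : Lp ℂ 2 S.area}
    (h : (u : Lp ℂ 2 S.volSM) =ᵐ[S.volSM] mode k g) : S.modeToH k g = u :=
  Subtype.ext (Lp.ext ((modeToH_ae k g).trans h.symm))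

theorem modeToH_surjective (k : ℤ) : Function.Surjective (S.modeToH k) := by
  rintro ⟨u, f, hf⟩
  have h1 : MemLp f 2 S.area := memLp_of_memLp_mode ((Lp.memLp u).ae_eq hf)
  exact ⟨h1.toLp, modeToH_eq_of_ae (hf.trans (mode_congr_ae k h1.coeFn_toLp.symm))⟩

theorem modeToH_injective (k : ℤ) : Function.Injective (S.modeToH k) := by
  refine (injective_iff_map_eq_zero _).2 fun g hg => norm_eq_zero.1 ?_
  have h := S.norm_modeToH k g
  rw [hg, norm_zero] at h
  exact (mul_eq_zero.1 h.symm).resolve_left (Real.sqrt_pos.2 Real.two_pi_pos).ne'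

theorem continuous_modeToH (k : ℤ) : Continuous (S.modeToH k) :=
  AddMonoidHomClass.continuous_of_bound _ _ fun g => (S.norm_modeToH k g).le

/-- The linear identification of `L²(M)` with `H_k`. -/
def modeEquiv (S : RiemannianSurface) (k : ℤ) : Lp ℂ 2 S.area ≃ₗ[ℂ] S.H k :=
  LinearEquiv.ofBijective (S.modeToH k) ⟨modeToH_injective k, modeToH_surjective k⟩

/-- The operator on `H_k` that corresponds to an operator on `L²(M)`. -/
def conjOp (S : RiemannianSurface) (k : ℤ) (A : Lp ℂ 2 S.area →L[ℂ] Lp ℂ 2 S.area) :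
    S.H k →L[ℂ] S.H k :=
  LinearMap.mkContinuous
    ((S.modeToH k).comp (A.toLinearMap.comp (S.modeEquiv k).symm.toLinearMap)) ‖A‖ fun u => by
      obtain ⟨g, rfl⟩ := modeToH_surjective k u
      have : (S.modeEquiv k).symm (S.modeToH k g) = g := (S.modeEquiv k).symm_apply_apply g
      simp only [LinearMap.comp_apply, LinearEquiv.coe_coe, this, norm_modeToH,
        ContinuousLinearMap.coe_coe]
      -- The factor `√(2π)` occurs on both sides, so conjugation does not increase the operator
      -- norm.
      rw [mul_left_comm]
      gcongr
      exact A.le_opNorm g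

theorem conjOp_modeToH (k : ℤ) (A : Lp ℂ 2 S.area →L[ℂ] Lp ℂ 2 S.area) (g : Lp ℂ 2 S.area) :
    S.conjOp k A (S.modeToH k g) = S.modeToH k (A g) := by
  have : (S.modeEquiv k).symm (S.modeToH k g) = g := (S.modeEquiv k).symm_apply_apply g
  change S.modeToH k (A ((S.modeEquiv k).symm (S.modeToH k g))) = _
  rw [this]

theorem norm_conjOp_le (k : ℤ) (A : Lp ℂ 2 S.area →L[ℂ] Lp ℂ 2 S.area) : ‖S.conjOp k A‖ ≤ ‖A‖ :=
  LinearMap.mkContinuous_norm_le _ (norm_nonneg _) _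

/-- `W_k` is determined by its values on the test functions. -/
theorem IsSimple.isExtensionOfWk_iff (hS : S.IsSimple) (k : ℤ) (W : S.H k →L[ℂ] S.H k) :
    S.IsExtensionOfWk k W ↔
      ∀ f, W (S.modeToH k (S.testToLp f)) = S.modeToH k (hS.preOp k f) := by
  have hpre : ∀ f : S.testFunctions, (S.modeToH k (hS.preOp k f) : Lp ℂ 2 S.volSM) =ᵐ[S.volSM]
      component k (S.XperpDeriv (S.transport (mode k f))) := fun f =>
    (modeToH_ae k _).trans (mode_congr_ae k
      (MemLp.coeFn_toLp (hS.memLp_opCoeff f.2 (S.memLp_testFunction f) k)))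
  constructor
  · intro h f
    refine Subtype.ext (Lp.ext (((h f f.2).2 _ ?_).trans (hpre f).symm))
    exact (modeToH_ae k _).trans (mode_congr_ae k (MemLp.coeFn_toLp (S.memLp_testFunction f)))
  · intro h f hf
    refine ⟨hS.contDiffOn_transport hf k, fun u hu => ?_⟩
    have hu' : S.modeToH k (S.testToLp ⟨f, hf⟩) = u := modeToH_eq_of_ae
      (hu.trans (mode_congr_ae k (MemLp.coeFn_toLp (S.memLp_testFunction ⟨f, hf⟩)).symm))
    rw [← hu', h ⟨f, hf⟩]
    exact hpre ⟨f, hf⟩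

end RiemannianSurface

end

theorem proposition5p6 (S : RiemannianSurface) (hS : S.IsSimple) :
    ∃ C₁ C₂ : ℝ, 0 < C₁ ∧ 0 < C₂ ∧ ∀ k : ℤ,
      ∃ W : S.H k →L[ℂ] S.H k,
        S.IsExtensionOfWk k W ∧
        (∀ W' : S.H k →L[ℂ] S.H k, S.IsExtensionOfWk k W' → W' = W) ∧
        ‖W‖ ≤ C₁ * S.gradCurvatureSup + |(k : ℝ)| * C₂ * S.curvatureSup := by
  obtain ⟨C, hC0, hC⟩ := hS.exists_norm_preOp_le
  have hdense := S.denseRange_testToLp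
  refine ⟨C, C, hC0, hC0, fun k => ?_⟩
  -- The extension by continuity is made on `L²(M)` and then carried to `H_k`.
  set A := (hS.preOp k).extendOfNorm S.testToLp with hA
  have hAe : ∀ f, A (S.testToLp f) = hS.preOp k f :=
    LinearMap.extendOfNorm_eq hdense ⟨_, hC k⟩
  have hW : S.IsExtensionOfWk k (S.conjOp k A) := (hS.isExtensionOfWk_iff k _).2 fun f => by
    rw [S.conjOp_modeToH, hAe]
  refine ⟨S.conjOp k A, hW, fun W' hW' => ?_, ?_⟩
  -- Two extensions agree on the dense image of the test functions, hence on `L²(M)`, and `modeToH`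
  -- reaches all of `H_k`.
  · have h1 : W' ∘ S.modeToH k = S.conjOp k A ∘ S.modeToH k := by
      refine hdense.equalizer (W'.continuous.comp (S.continuous_modeToH k))
        ((S.conjOp k A).continuous.comp (S.continuous_modeToH k)) (funext fun f => ?_)
      exact ((hS.isExtensionOfWk_iff k _).1 hW' f).trans ((hS.isExtensionOfWk_iff k _).1 hW f).symm
    refine ContinuousLinearMap.ext fun u => ?_
    obtain ⟨g, rfl⟩ := S.modeToH_surjective k u
    exact congrFun h1 g
  · have hB : 0 ≤ C * (S.gradCurvatureSup + |(k : ℝ)| * S.curvatureSup) :=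
      mul_nonneg hC0.le (add_nonneg S.gradCurvatureSup_nonneg
        (mul_nonneg (abs_nonneg _) S.curvatureSup_nonneg))
    calc _ ≤ ‖A‖ := S.norm_conjOp_le k A
      _ ≤ C * (S.gradCurvatureSup + |(k : ℝ)| * S.curvatureSup) :=
        LinearMap.opNorm_extendOfNorm_le hdense hB (hC k)
      _ = _ := by ring
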